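/- **Setting.** Let $d\ge 1$, $\mu,h\in\mathbb R$, $\lambda,\gamma\ge 0$. Let $\mathcal U$ be the CAR $C^*$-algebra generated by the fermionic annihilation operators $a_{x,s}$, $x\in\mathbb Z^d$, $s\in\{\uparrow,\downarrow\}$, let $\mathcal U_{\{0\}}\subset\mathcal U$ be the on-site algebra generated by $a_{0,\uparrow},a_{0,\downarrow}$, and put $n_{x,s}=a_{x,s}^*a_{x,s}$, $\Lambda_L=(\mathbb Z\cap[-L,L])^d$, $$h_x=2\lambda n_{x,\uparrow}n_{x,\downarrow}-\mu(n_{x,\uparrow}+n_{x,\downarrow})-h(n_{x,\uparrow}-n_{x,\downarrow}),$$ $$\mathrm H_L=\sum_{x\in\Lambda_L}h_x-\frac{\gamma}{|\Lambda_L|}\sum_{x,y\in\Lambda_L}a_{x,\uparrow}^*a_{x,\downarrow}^*a_{y,\downarrow}a_{y,\uparrow},\qquad \tau_t^{(L)}(A)=e^{it\mathrm H_L}Ae^{-it\mathrm H_L}.$$ For a continuous $c:\mathbb R\to\mathbb C$ let $\tau^{(L,c)}_{t,s}$ be the non-autonomous dynamics given by the Dyson–Phillips series $\mathbf 1+\sum_{k\ge1}\int_s^t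 dt_1\cdots\int_s^{t_{k-1}}dt_k\,\delta_{L,c(t_k)}\circ\cdots\circ\delta_{L,c(t_1)}$, where $\delta_{L,c}=i[\mathrm H_L(c),\cdot\,]$ and $\mathrm H_L(c)=\sum_{x\in\Lambda_L}\{h_x-\gamma(c\,a_{x,\uparrow}^*a_{x,\downarrow}^*+\bar c\,a_{x,\downarrow}a_{x,\uparrow})\}$, and let $\tau^{c}_{t,s}(A)=\lim_{L\to\infty}\tau^{(L,c)}_{t,s}(A)$, $A\in\mathcal U$. For an even state $\rho_0$ on $\mathcal U_{\{0\}}$, a solution of the self-consistency equation is a continuous family $(\varpi(t))_{t\in\mathbb R}$ of states on $\mathcal U_{\{0\}}$ with $\varpi(t)=\rho_0\circ\tau^{\varpi}_{t,0}|_{\mathcal U_{\{0\}}}$ for all $t$, where $\tau^\varpi=\tau^{c}$ with $c(t)=\varpi(t)(a_{0,\downarrow}a_{0,\uparrow})$. A product state $\otimes_{\mathbb Z^d}\rho_0$ is a state $\rho$ on $\mathcal U$ with $\rho(\alpha_{x_1}(A_1)\cdots\alpha_{x_m}(A_m))=\rho_0(A_1)\cdots\rho_0(A_m)$ for all $A_i\in\mathcal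 U_{\{0\}}$ and pairwise distinct $x_i$, where $\rho_0$ is an even state on $\mathcal U_{\{0\}}$ and $\alpha_x$ is the translation by $x$. For a state $\rho$ let $\kappa(\rho)=|\rho(a_{0,\downarrow}a_{0,\uparrow})|^2$, let $\theta(\rho)\in[-\pi,\pi)$ be such that $\rho(a_{0,\downarrow}a_{0,\uparrow})=\sqrt{\kappa(\rho)}\,e^{i\theta(\rho)}$, and let $\nu(\rho)=2(\mu-\lambda)+\gamma\bigl(1-\rho(n_{0,\uparrow}+n_{0,\downarrow})\bigr)$. **Statement.** (1) Let $\rho_1,\dots,\rho_n$ be product states, $u_1,\dots,u_n\in[0,1]$ with $\sum_ju_j=1$, and $\rho=\sum_ju_j\rho_j$. For every $j$ the self-consistency equation with initial state $\rho_j|_{\mathcal U_{\{0\}}}$ has a unique solution $\varpi_j$, the dynamics $\tau^{\varpi_j}_{t,s}$ exists on $\mathcal U$, and, for all $t\in\mathbb R$, in the weak$^*$ topology, $$\rho_{j,t}:=\lim_{L\to\infty}\rho_j\circ\tau^{(L)}_t=\rho_j\circ\tau^{\varpi_j}_{t,0}=\otimes_{\mathbb Z^d}\varpi_j(t),\qquad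 \rho_t:=\lim_{L\to\infty}\rho\circ\tau_t^{(L)}=\sum_{j=1}^nu_j\,\rho_j\circ\tau^{\varpi_j}_{t,0}.$$ Moreover, for all $t\in\mathbb R$, $$\rho_t(a_{0,\downarrow}a_{0,\uparrow})=\sum_{j=1}^nu_j\sqrt{\kappa(\rho_j)}\;e^{i(t\nu(\rho_j)+\theta(\rho_j))}.$$ (2) If $\gamma>0$, the Cooper-pair condensate density need not be constant in time: there is a finite convex combination $\rho$ of product states such that its infinite-volume evolution $\rho_t$ exists and $\kappa(\rho_t)\ne\kappa(\rho_{t=0})$ for some $t\in\mathbb R$. -/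

import Mathlib

open Filter Topology
open scoped ComplexOrder

noncomputable section

namespace CooperField

/-! ### Fermionic Fock space and the CAR algebra over a linearly ordered set of modes -/

section Fock

variable (I : Type) [LinearOrder I]

/-- Fermion Fock space over the modes `I`: square-summable functions on the set of finite
occupation sets, i.e. the Hilbert space with orthonormal basis `(e_S)` indexed by the finite
subsets `S` of `I`. -/
abbrev Fock : Type := lp (fun _ : Finset I => ℂ) 2

variable {I}

/-- The sign `(-1) ^ #{j ∈ S | j < i}`. -/
def jwSign (i : I) (S : Finset I) : ℂ := (-1) ^ (S.filter (fun j => j < i)).card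

/-- Coordinates of the annihilation operator of mode `i`:
`e_S ↦ (-1) ^ #{j ∈ S | j < i} • e_{S \ {i}}` if `i ∈ S`, and `e_S ↦ 0` otherwise. -/
def annFun (i : I) (f : Finset I → ℂ) (S : Finset I) : ℂ :=
  if i ∈ S then 0 else jwSign i S * f (insert i S)

lemma norm_annFun_sq_sum_le (i : I) (f : Fock I) (s : Finset (Finset I)) :
    ∑ S ∈ s, ‖annFun i f S‖ ^ (2 : ENNReal).toReal ≤ ‖f‖ ^ (2 : ENNReal).toReal := by
  classical
  have h0 : ∀ S ∈ s, i ∈ S → ‖annFun i f S‖ ^ (2 : ENNReal).toReal = 0 := by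
    intro S _ hS
    simp [annFun, hS]
  have h1 : ∑ S ∈ s, ‖annFun i f S‖ ^ (2 : ENNReal).toReal
      = ∑ S ∈ s.filter (fun S => i ∉ S), ‖f (insert i S)‖ ^ (2 : ENNReal).toReal := by
    rw [Finset.sum_filter]
    refine Finset.sum_congr rfl fun S hS => ?_
    by_cases h : i ∈ S
    · simp [h, annFun]
    · simp [h, annFun, jwSign]
  have hinj : Set.InjOn (fun S : Finset I => insert i S) (s.filter (fun S => i ∉ S)) := by
    intro S hS T hT h
    simp only [Finset.coe_filter, Set.mem_ofPred_eq] at hS hT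
    simpa [Finset.erase_insert hS.2, Finset.erase_insert hT.2] using
      congrArg (fun R : Finset I => R.erase i) h
  rw [h1, ← Finset.sum_image (f := fun S => ‖f S‖ ^ (2 : ENNReal).toReal) hinj]
  exact lp.sum_rpow_le_norm_rpow (by norm_num) f _

lemma memℓp_annFun (i : I) (f : Fock I) : Memℓp (annFun i f) 2 :=
  memℓp_gen' (fun s => norm_annFun_sq_sum_le i f s)

/-- The annihilation operator `a_i`, a bounded operator on Fock space. -/
def ann (i : I) : Fock I →L[ℂ] Fock I :=
  LinearMap.mkContinuous
    { toFun := fun f => ⟨annFun i f, memℓp_annFun i f⟩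
      map_add' := fun f g => by
        ext S
        change annFun i (⇑f + ⇑g) S = annFun i f S + annFun i g S
        by_cases h : i ∈ S <;> simp [annFun, h, mul_add]
      map_smul' := fun c f => by
        ext S
        change annFun i (c • ⇑f) S = c * annFun i f S
        by_cases h : i ∈ S <;> simp [annFun, h, mul_left_comm] }
    1
    (fun f => by
      rw [one_mul]
      exact lp.norm_le_of_forall_sum_le (by norm_num) (norm_nonneg f)
        (fun s => norm_annFun_sq_sum_le i f s))

variable (I) in
/-- The CAR `C*`-algebra of the modes `I`: the `C*`-algebra generated by the annihilation
operators (it contains their adjoints, the creation operators). -/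
def carAlgebra : StarSubalgebra ℂ (Fock I →L[ℂ] Fock I) :=
  (StarAlgebra.adjoin ℂ (Set.range (ann (I := I)))).topologicalClosure

instance : CompleteSpace (carAlgebra I) :=
  inferInstanceAs (CompleteSpace
    (StarAlgebra.adjoin ℂ (Set.range (ann (I := I)))).topologicalClosure)

instance : CStarAlgebra (carAlgebra I) where

/-- The annihilation operator `a_i` as an element of the CAR algebra. -/
def carAnn (i : I) : carAlgebra I :=
  ⟨ann i, StarSubalgebra.le_topologicalClosure _ (StarAlgebra.subset_adjoin ℂ _ ⟨i, rfl⟩)⟩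

end Fock

/-! ### States -/

/-- States: positive normalized (continuous) linear functionals. -/
def IsState {A : Type} [NormedRing A] [StarRing A] [NormedAlgebra ℂ A] (ρ : A →L[ℂ] ℂ) : Prop :=
  (∀ B : A, 0 ≤ ρ (star B * B)) ∧ ρ 1 = 1

/-! ### The lattice -/

/-- The lattice `ℤ^d`. -/
abbrev Site (d : ℕ) : Type := Fin d → ℤ

/-- The spin set `{↑, ↓}`. -/
abbrev Spin : Type := Bool

/-- Spin up. -/
abbrev up : Spin := true

/-- Spin down. -/
abbrev dn : Spin := false

/-- One-particle modes `ℤ^d × {↑, ↓}`, with the lexicographic linear order. -/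
abbrev Mode (d : ℕ) : Type := Lex (Fin d → ℤ) ×ₗ Spin

/-- The CAR algebra of the lattice `ℤ^d` with spin set `{↑, ↓}`. -/
abbrev U (d : ℕ) : Type := carAlgebra (Mode d)

variable {d : ℕ}

/-- The annihilation operator `a_{x,s}`. -/
def a (x : Site d) (s : Spin) : U d := carAnn (toLex (toLex x, s))

/-- The particle number operator `n_{x,s} = a_{x,s}^* a_{x,s}`. -/
def num (x : Site d) (s : Spin) : U d := star (a x s) * a x s

/-- The cubic box `Λ_L = (ℤ ∩ [-L, L])^d`. -/
def box (d L : ℕ) : Finset (Site d) := Fintype.piFinset fun _ => Finset.Icc (-(L : ℤ)) (L : ℤ)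

/-! ### The strong-coupling BCS-Hubbard model and its finite-volume dynamics -/

/-- Parameters: chemical potential `mu`, magnetic field `h`, Hubbard coupling `lam`,
BCS coupling `gam`. -/
structure Params where
  mu : ℝ
  h : ℝ
  lam : ℝ
  gam : ℝ

/-- On-site term
`h_x = 2 λ n_{x,↑} n_{x,↓} - μ (n_{x,↑} + n_{x,↓}) - h (n_{x,↑} - n_{x,↓})`. -/
def onSite (p : Params) (x : Site d) : U d :=
  ((2 * p.lam : ℝ) : ℂ) • (num x up * num x dn) - (p.mu : ℂ) • (num x up + num x dn)
    - (p.h : ℂ) • (num x up - num x dn)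

/-- The Hamiltonian
`H_L = ∑_{x ∈ Λ_L} h_x - (γ / |Λ_L|) ∑_{x,y ∈ Λ_L} a_{x,↑}^* a_{x,↓}^* a_{y,↓} a_{y,↑}`. -/
def hamiltonian (d : ℕ) (p : Params) (L : ℕ) : U d :=
  ∑ x ∈ box d L, onSite p x
    - ((p.gam / (box d L).card : ℝ) : ℂ) •
      ∑ x ∈ box d L, ∑ y ∈ box d L, star (a x up) * star (a x dn) * (a y dn * a y up)

/-- The finite-volume Heisenberg dynamics `τ_t^{(L)}(A) = e^{itH_L} A e^{-itH_L}`. -/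
def tau (p : Params) (L : ℕ) (t : ℝ) (A : U d) : U d :=
  NormedSpace.exp ((Complex.I * t) • hamiltonian d p L) * A *
    NormedSpace.exp (-((Complex.I * t) • hamiltonian d p L))

/-- `ρt` is the infinite-volume time evolution of the state `ρ`: the weak-* limit
`ρt t = lim_{L → ∞} ρ ∘ τ_t^{(L)}`. -/
def IsInfiniteVolumeEvolution (p : Params) (ρ : U d →L[ℂ] ℂ) (ρt : ℝ → U d →L[ℂ] ℂ) : Prop :=
  ∀ (t : ℝ) (A : U d), Tendsto (fun L : ℕ => ρ (tau p L t A)) atTop (𝓝 (ρt t A))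

/-! ### Approximating Hamiltonians and their (non-autonomous) infinite-volume dynamics -/

/-- The approximating Hamiltonian
`H_L(c) = ∑_{x ∈ Λ_L} (h_x - γ (c a_{x,↑}^* a_{x,↓}^* + c̄ a_{x,↓} a_{x,↑}))`. -/
def approxHamiltonian (d : ℕ) (p : Params) (L : ℕ) (c : ℂ) : U d :=
  ∑ x ∈ box d L, (onSite p x - (p.gam : ℂ) •
    (c • (star (a x up) * star (a x dn)) + star c • (a x dn * a x up)))

/-- The generator `δ_{L,c} = i [H_L(c), ·]`. -/
def approxGenerator (d : ℕ) (p : Params) (L : ℕ) (c : ℂ) : U d →L[ℂ] U d :=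
  Complex.I • (ContinuousLinearMap.mul ℂ (U d) (approxHamiltonian d p L c)
    - (ContinuousLinearMap.mul ℂ (U d)).flip (approxHamiltonian d p L c))

/-- The terms of the Dyson-Phillips series: the `k`-th one is
`∫_s^t dt₁ ⋯ ∫_s^{t_{k-1}} dt_k δ_{L,c(t_k)} ∘ ⋯ ∘ δ_{L,c(t₁)}`. -/
def dysonTerm (d : ℕ) (p : Params) (L : ℕ) (c : ℝ → ℂ) (s : ℝ) : ℕ → ℝ → (U d →L[ℂ] U d)
  | 0, _ => ContinuousLinearMap.id ℂ (U d)
  | k + 1, t => ∫ r in s..t, (dysonTerm d p L c s k r).comp (approxGenerator d p L (c r))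

/-- The non-autonomous finite-volume dynamics `τ_{t,s}^{(L,c)}` generated by the approximating
Hamiltonians `H_L(c(t))` (Dyson-Phillips series), for a continuous `c : ℝ → ℂ`. -/
def approxTau (d : ℕ) (p : Params) (L : ℕ) (c : ℝ → ℂ) (t s : ℝ) : U d →L[ℂ] U d :=
  ∑' k : ℕ, dysonTerm d p L c s k t

/-- The infinite-volume non-autonomous dynamics `τ_{t,s}^{c}(A) = lim_{L → ∞} τ_{t,s}^{(L,c)}(A)`. -/
def approxTauInf (p : Params) (c : ℝ → ℂ) (t s : ℝ) (A : U d) : U d :=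
  limUnder atTop (fun L : ℕ => approxTau d p L c t s A)

/-! ### On-site algebras and product states -/

/-- The on-site algebra `B(F_{{x}})`, generated by `a_{x,↑}` and `a_{x,↓}`. -/
def siteAlgebra (x : Site d) : StarSubalgebra ℂ (U d) :=
  StarAlgebra.adjoin ℂ (Set.range (a x))

/-- The generators of the on-site algebra at `x`: `(s, false)` stands for `a_{x,s}` and
`(s, true)` for `a_{x,s}^*`. -/
def siteGen (x : Site d) (g : Spin × Bool) : siteAlgebra x :=
  let b : siteAlgebra x := ⟨a x g.1, StarAlgebra.subset_adjoin ℂ _ ⟨g.1, rfl⟩⟩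
  if g.2 then star b else b

/-- Evaluation of a noncommutative polynomial `P` in the generators at the site `x`.
Every `A ∈ B(F_{{0}})` is of the form `sitePoly 0 P`, and its translated copy `α_x(A)` is then
`sitePoly x P`. -/
def sitePoly (x : Site d) : FreeAlgebra ℂ (Spin × Bool) →ₐ[ℂ] siteAlgebra x :=
  FreeAlgebra.lift ℂ (siteGen x)

/-- An on-site functional is even if it vanishes on all odd monomials in
`a_{0,s}, a_{0,s}^*`. -/
def IsEvenOnSite (ρ₀ : siteAlgebra (0 : Site d) →L[ℂ] ℂ) : Prop :=
  ∀ w : List (Spin × Bool), Odd w.length → ρ₀ (w.map (siteGen (0 : Site d))).prod = 0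

/-- `ρ = ⊗_{ℤ^d} ρ₀`: `ρ₀` is an even on-site state and `ρ` is the state with
`ρ(α_{x₁}(A₁) ⋯ α_{x_m}(A_m)) = ρ₀(A₁) ⋯ ρ₀(A_m)` for all on-site `A₁, …, A_m` and all pairwise
distinct `x₁, …, x_m`. -/
def IsProductOf (ρ : U d →L[ℂ] ℂ) (ρ₀ : siteAlgebra (0 : Site d) →L[ℂ] ℂ) : Prop :=
  IsState ρ ∧ IsState ρ₀ ∧ IsEvenOnSite ρ₀ ∧
    ∀ (m : ℕ) (x : Fin m → Site d) (P : Fin m → FreeAlgebra ℂ (Spin × Bool)),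
      Function.Injective x →
        ρ (List.ofFn fun i => (sitePoly (x i) (P i) : U d)).prod = ∏ i, ρ₀ (sitePoly (0 : Site d) (P i))

/-- The restriction of a functional to the on-site algebra at the origin. -/
def restrictSite (ρ : U d →L[ℂ] ℂ) : siteAlgebra (0 : Site d) →L[ℂ] ℂ :=
  ρ.comp ⟨(siteAlgebra (0 : Site d)).subtype.toAlgHom.toLinearMap, continuous_subtype_val⟩

/-- Product states. -/
def IsProductState (ρ : U d →L[ℂ] ℂ) : Prop :=
  IsProductOf ρ (restrictSite ρ)

/-! ### Self-consistency equation -/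

/-- The order parameter `ρ₀(a_{0,↓} a_{0,↑})` of an on-site functional. -/
def orderParam (ρ₀ : siteAlgebra (0 : Site d) →L[ℂ] ℂ) : ℂ :=
  ρ₀ (siteGen (0 : Site d) (dn, false) * siteGen (0 : Site d) (up, false))

/-- `ϖ` is a (weak-* continuous) family of on-site states solving the self-consistency equation
`ϖ(t) = ρ₀ ∘ τ_{t,0}^{ϖ}`, where `τ^{ϖ}` is generated by the approximating Hamiltonians with
`c(t) = ϖ(t)(a_{0,↓} a_{0,↑})`; implicit in it is that `τ_{t,0}^{ϖ}` preserves the on-site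
algebra. -/
def IsSelfConsistent (p : Params) (ρ₀ : siteAlgebra (0 : Site d) →L[ℂ] ℂ)
    (ϖ : ℝ → siteAlgebra (0 : Site d) →L[ℂ] ℂ) : Prop :=
  (∀ t, IsState (ϖ t)) ∧ (∀ A, Continuous fun t => ϖ t A) ∧
    ∀ (t : ℝ) (A : siteAlgebra (0 : Site d)), ∃ B : siteAlgebra (0 : Site d),
      (B : U d) = approxTauInf p (fun r => orderParam (ϖ r)) t 0 (A : U d) ∧ ϖ t A = ρ₀ B

/-! ### Densities -/

/-- The Cooper field `ρ(a_{0,↓} a_{0,↑})`. -/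
def cooperField (ρ : U d →L[ℂ] ℂ) : ℂ := ρ (a 0 dn * a 0 up)

/-- The Cooper-pair condensate density `κ(ρ) = |ρ(a_{0,↓} a_{0,↑})|²`. -/
def kappa (ρ : U d →L[ℂ] ℂ) : ℝ := ‖cooperField ρ‖ ^ 2

/-- The phase `θ(ρ) ∈ [-π, π)` of the Cooper field (the principal argument, with the value `π`
replaced by `-π`), so that `ρ(a_{0,↓} a_{0,↑}) = √κ(ρ) e^{iθ(ρ)}`. -/
def theta (ρ : U d →L[ℂ] ℂ) : ℝ :=
  if (cooperField ρ).arg = Real.pi then -Real.pi else (cooperField ρ).arg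

/-- The electron density `d(ρ) = ρ(n_{0,↑} + n_{0,↓})` (a real number for every state). -/
def electronDensity (ρ : U d →L[ℂ] ℂ) : ℝ := (ρ (num 0 up + num 0 dn)).re

/-- The frequency `ν(ρ) = 2 (μ - λ) + γ (1 - d(ρ))`. -/
def nu (p : Params) (ρ : U d →L[ℂ] ℂ) : ℝ :=
  2 * (p.mu - p.lam) + p.gam * (1 - electronDensity ρ)

/-- The convex combination `∑_j u_j ρ_j` of functionals. -/
def mixture {n : ℕ} (u : Fin n → ℝ) (ρ : Fin n → U d →L[ℂ] ℂ) : U d →L[ℂ] ℂ :=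
  ∑ j, (u j : ℂ) • ρ j

end CooperField

end

/-! Let `B` be the total pair annihilation operator of the box (`totalPair`) and `N` the total
particle number (`totalNum`). The finite-volume Hamiltonian depends on the pairs only through `B* B
/ |Λ|`, and `[B*, B] = N - |Λ|`. Hence `[H, B] = F B`, where `F` (`freqOp`) is affine in `N / |Λ|`
and commutes with `H` (`hamiltonian_mul_totalPair`, `commute_freqOp_hamiltonian`), so that `e^{itH}
B e^{-itH} = e^{itF} B` exactly. In a product state both `B / |Λ|` and `F` concentrate, at `c =
ρ(a_↓ a_↑)` and at `ν`, by the law of large numbers in the GNS seminorm. The pair average therefore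
follows `c e^{iνt}`, with an error bounded by the initial fluctuations alone
(`norm_evolved_fluctuation_le`); no Gronwall argument is needed.

Up to a scalar, `H_L - H_L(c(t))` is `-γ |Λ| m* m`, where `m = B / |Λ| - c(t)`. Its commutator with
a local `X` is `-γ (m* [B, X] + [B*, X] m)`, and the inner commutators are bounded uniformly in `L`.
Duhamel's formula and the Cauchy-Schwarz inequality then compare the two dynamics
(`norm_tau_sub_approxTau_le`, `tendsto_tau`).

The approximating dynamics does not couple the sites. It preserves each on-site algebra, is
independent of the volume on local elements, and maps product states to product states
(`IsProductState.evolve`). In the rotating field `c e^{iνt}` a gauge rotation by `N` makes the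
Hamiltonian time-independent, which yields explicit unitary propagators.

On one site the expectations of `a_↓ a_↑`, of its adjoint and of `1 - n` satisfy a closed linear
system. For a self-consistent field it forces `n` to be constant and the Cooper field to rotate with
frequency `ν`: this is uniqueness. Conversely, the deviation of the response from the prescribed
rotating field has a conserved positive quadratic form that vanishes at time zero: this is existence
(`cooperField_evolve`).

Mixtures are handled by linearity. For the second statement, two product states with equal Cooper
fields but different densities rotate at different frequencies, and at a suitable time their fields
cancel (`exists_kappa_ne`). Such states are obtained by rotating the Fock vacuum with a constant
pairing field. -/

noncomputable section

/-! ### The Dyson series in a Banach algebra -/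

section DysonSeries

variable {𝔅 : Type*} [NormedRing 𝔅] [NormedAlgebra ℝ 𝔅] [CompleteSpace 𝔅]

/-- The terms of the Dyson series of `T' = T δ`, `T s = 1`. -/
def dysonSeries (δ : ℝ → 𝔅) (s : ℝ) : ℕ → ℝ → 𝔅
  | 0, _ => 1
  | k + 1, t => ∫ r in s..t, dysonSeries δ s k r * δ r

variable {δ : ℝ → 𝔅} (hδ : Continuous δ) (s : ℝ)

include hδ in
lemma continuous_dysonSeries (k : ℕ) : Continuous (dysonSeries δ s k) := by
  induction k with
  | zero => exact continuous_const
  | succ k ih =>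
    exact intervalIntegral.continuous_primitive
      (fun a b => (ih.mul hδ).intervalIntegrable a b) s

include hδ in
lemma hasDerivAt_dysonSeries_succ (k : ℕ) (t : ℝ) :
    HasDerivAt (dysonSeries δ s (k + 1)) (dysonSeries δ s k t * δ t) t :=
  have hc : Continuous fun r => dysonSeries δ s k r * δ r :=
    (continuous_dysonSeries hδ s k).mul hδ
  intervalIntegral.integral_hasDerivAt_right (hc.intervalIntegrable s t)
    (hc.stronglyMeasurableAtFilter _ _) hc.continuousAt

/-- Integrating `|r - s| ^ k` at each step produces the factorial. The factor `‖1‖` stays because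
the algebra may be trivial, so that `‖1‖ = 1` cannot be assumed. -/
lemma norm_dysonSeries_le {M : ℝ} {R : ℝ} (hM : 0 ≤ M)
    (hb : ∀ r, |r - s| ≤ R → ‖δ r‖ ≤ M) (k : ℕ) (t : ℝ) (ht : |t - s| ≤ R) :
    ‖dysonSeries δ s k t‖ ≤ ‖(1 : 𝔅)‖ * ((M * |t - s|) ^ k / k.factorial) := by
  induction k generalizing t with
  | zero => simp [dysonSeries]
  | succ k ih =>
    have key : ∀ r ∈ Set.uIoc s t, ‖dysonSeries δ s k r * δ r‖
        ≤ ‖(1 : 𝔅)‖ * M ^ (k + 1) / k.factorial * |r - s| ^ k := by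
      intro r hr
      have hr' : |r - s| ≤ |t - s| := by
        have := Set.abs_sub_left_of_mem_uIcc (Set.uIoc_subset_uIcc hr)
        simpa using this
      have h1 := ih r (hr'.trans ht)
      have h2 := hb r (hr'.trans ht)
      calc ‖dysonSeries δ s k r * δ r‖ ≤ ‖dysonSeries δ s k r‖ * ‖δ r‖ := norm_mul_le _ _
        _ ≤ (‖(1 : 𝔅)‖ * ((M * |r - s|) ^ k / k.factorial)) * M := by gcongr
        _ = _ := by rw [mul_pow]; ring
    have hint : MeasureTheory.IntegrableOn
        (fun r => ‖(1 : 𝔅)‖ * M ^ (k + 1) / k.factorial * |r - s| ^ k) (Set.uIoc s t) := by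
      have hc : Continuous fun r : ℝ => ‖(1 : 𝔅)‖ * M ^ (k + 1) / k.factorial * |r - s| ^ k := by
        fun_prop
      exact (hc.intervalIntegrable s t).def'
    calc ‖dysonSeries δ s (k + 1) t‖ = ‖∫ r in s..t, dysonSeries δ s k r * δ r‖ := rfl
      _ = ‖∫ r in Set.uIoc s t, dysonSeries δ s k r * δ r‖ :=
        intervalIntegral.norm_intervalIntegral_eq _ _ _ _
      _ ≤ ∫ r in Set.uIoc s t, ‖(1 : 𝔅)‖ * M ^ (k + 1) / k.factorial * |r - s| ^ k :=
        MeasureTheory.norm_integral_le_of_norm_le hint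
          ((MeasureTheory.ae_restrict_iff' measurableSet_uIoc).2 (Eventually.of_forall key))
      _ = _ := by
        rw [MeasureTheory.integral_const_mul, integral_pow_abs_sub_uIoc, Nat.factorial_succ,
          mul_pow]
        push_cast
        field_simp

include hδ in
lemma exists_norm_le_of_continuous (R : ℝ) : ∃ M, 0 ≤ M ∧ ∀ r, |r - s| ≤ R → ‖δ r‖ ≤ M := by
  obtain ⟨M, hM⟩ := (isCompact_closedBall s R).exists_bound_of_continuousOn hδ.continuousOn
  refine ⟨max M 0, le_max_right _ _, fun r hr => (hM r ?_).trans (le_max_left _ _)⟩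
  simpa [Real.dist_eq] using hr

include hδ in
lemma summable_dysonSeries (t : ℝ) : Summable fun k => dysonSeries δ s k t := by
  obtain ⟨M, hM, hb⟩ := exists_norm_le_of_continuous hδ s |t - s|
  exact Summable.of_norm_bounded ((Real.summable_pow_div_factorial (M * |t - s|)).mul_left _)
    fun k => norm_dysonSeries_le s hM hb k t le_rfl

lemma tsum_dysonSeries_self : ∑' k, dysonSeries δ s k s = 1 := by
  rw [tsum_eq_single 0]
  · rfl
  · intro k hk
    obtain ⟨k, rfl⟩ := Nat.exists_eq_succ_of_ne_zero hk
    simp [dysonSeries]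

include hδ in
-- Termwise differentiation: the factorial bound is uniform on a ball around `s` that contains `t`,
-- and the derivative of term `k + 1` is term `k` times `δ`.
lemma hasDerivAt_tsum_dysonSeries (t : ℝ) :
    HasDerivAt (fun t => ∑' k, dysonSeries δ s k t) ((∑' k, dysonSeries δ s k t) * δ t) t := by
  set R := |t - s| + 1
  obtain ⟨M, hM, hb⟩ := exists_norm_le_of_continuous hδ s R
  have hR : 0 ≤ R := by positivity
  have hbd : ∀ y ∈ Metric.ball s R, ∀ k, ‖dysonSeries δ s k y * δ y‖
      ≤ ‖(1 : 𝔅)‖ * ((M * R) ^ k / k.factorial) * M := by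
    intro y hy k
    have hy' : |y - s| ≤ R := by simpa [Real.dist_eq] using (Metric.mem_ball.1 hy).le
    refine (norm_mul_le _ _).trans ?_
    have := hb y hy'
    refine mul_le_mul ((norm_dysonSeries_le s hM hb k y hy').trans ?_) this (norm_nonneg _)
      (by positivity)
    gcongr
  have hsum : Summable fun k : ℕ => ‖(1 : 𝔅)‖ * ((M * R) ^ k / k.factorial) * M :=
    ((Real.summable_pow_div_factorial (M * R)).mul_left _).mul_right _
  have hts : t ∈ Metric.ball s R := by
    simp only [Metric.mem_ball, Real.dist_eq]
    exact lt_add_one _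
  have h := hasDerivAt_tsum_of_isPreconnected (g := fun k t => dysonSeries δ s (k + 1) t)
    (g' := fun k t => dysonSeries δ s k t * δ t) hsum Metric.isOpen_ball
    (convex_ball s R).isPreconnected
    (fun k y _ => hasDerivAt_dysonSeries_succ hδ s k y) (fun k y hy => hbd y hy k) hts
    ((summable_nat_add_iff 1).2 (summable_dysonSeries hδ s t)) hts
  have h0 : (fun t => ∑' k, dysonSeries δ s k t)
      = fun t => 1 + ∑' k, dysonSeries δ s (k + 1) t := by
    funext t
    exact (summable_dysonSeries hδ s t).tsum_eq_zero_add
  rw [h0]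
  have := h.const_add 1
  rwa [(summable_dysonSeries hδ s t).tsum_mul_right] at this

include hδ in
/-- A solution of `S' = S δ`, `S s = 1` with values in invertible elements is the sum of the
Dyson series. -/
lemma tsum_dysonSeries_eq {S S' : ℝ → 𝔅} (hS' : ∀ t, HasDerivAt S' (-(δ t * S' t)) t)
    (hSS : ∀ t, S' t * S t = 1) (hs : S' s = 1) (t : ℝ) :
    ∑' k, dysonSeries δ s k t = S t := by
  set T := fun t => ∑' k, dysonSeries δ s k t
  -- `(T S')' = T δ S' - T δ S' = 0`. Thus `T S' = 1`, and the left inverse property of `S'`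
  -- identifies `T` with `S` without differentiating `S`.
  have hd : ∀ t, HasDerivAt (fun t => T t * S' t) 0 t := by
    intro t
    have := (hasDerivAt_tsum_dysonSeries hδ s t).mul (hS' t)
    convert! this using 1
    simp [mul_assoc]
  have hc := is_const_of_deriv_eq_zero (fun t => (hd t).differentiableAt)
    (fun t => (hd t).deriv) t s
  have hc' : T t * S' t = 1 := by
    rw [hc, hs, mul_one]
    exact tsum_dysonSeries_self s
  calc T t = T t * (S' t * S t) := by rw [hSS, mul_one]
    _ = S t := by rw [← mul_assoc, hc', one_mul]

end DysonSeries

/-! ### Dyson series of operators: invariant subspaces and comparison of generators. -/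

section OperatorDyson

variable {E : Type*} [NormedAddCommGroup E] [NormedSpace ℂ E] [CompleteSpace E]
  {δ : ℝ → E →L[ℂ] E} (hδ : Continuous δ) (s : ℝ)

/-- A closed subspace is complete, so the integral can be taken inside it and commutes with the
inclusion. -/
lemma intervalIntegral_mem_of_isClosed {E : Type*} [NormedAddCommGroup E] [NormedSpace ℝ E]
    [CompleteSpace E] {R : Submodule ℝ E} (hR : IsClosed (R : Set E)) {f : ℝ → E}
    (hf : ∀ r, f r ∈ R) (hc : Continuous f) (s t : ℝ) : ∫ r in s..t, f r ∈ R := by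
  have : CompleteSpace R := hR.completeSpace_coe
  let g : ℝ → R := fun r => ⟨f r, hf r⟩
  have hg : Continuous g := hc.subtype_mk _
  have := R.subtypeL.intervalIntegral_comp_comm
    (hg.intervalIntegrable (μ := MeasureTheory.volume) s t)
  have h2 : ∫ r in s..t, f r = R.subtypeL (∫ r in s..t, g r) := this
  rw [h2]
  exact (∫ r in s..t, g r).2

include hδ in
lemma clm_dysonSeries_succ {F : Type*} [NormedAddCommGroup F] [NormedSpace ℂ F] [CompleteSpace F]
    (Ψ : (E →L[ℂ] E) →L[ℂ] F) (k : ℕ) (t : ℝ) :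
    Ψ (dysonSeries δ s (k + 1) t) = ∫ r in s..t, Ψ (dysonSeries δ s k r * δ r) :=
  ((Ψ.restrictScalars ℝ).intervalIntegral_comp_comm
    (((continuous_dysonSeries hδ s k).mul hδ).intervalIntegrable
      (μ := MeasureTheory.volume) s t)).symm

include hδ in
lemma hasDerivAt_tsum_dysonSeries_apply (t : ℝ) (v : E) :
    HasDerivAt (fun t => (∑' k, dysonSeries δ s k t) v) ((∑' k, dysonSeries δ s k t) (δ t v)) t :=
  ((ContinuousLinearMap.apply ℂ E v).restrictScalars ℝ).hasFDerivAt.comp_hasDerivAt t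
    (hasDerivAt_tsum_dysonSeries hδ s t)

include hδ in
/-- A closed subspace of pairs that is invariant under the generators is invariant under the
sum of the Dyson series. -/
lemma tsum_dysonSeries_mem_pair {R : Submodule ℂ (E × E)} (hR : IsClosed (R : Set (E × E)))
    (hinv : ∀ z ∈ R, ∀ r, (δ r z.1, δ r z.2) ∈ R) {z : E × E} (hz : z ∈ R) (t : ℝ) :
    ((∑' k, dysonSeries δ s k t) z.1, (∑' k, dysonSeries δ s k t) z.2) ∈ R := by
  let Ψ (z : E × E) : (E →L[ℂ] E) →L[ℂ] E × E :=
    (ContinuousLinearMap.apply ℂ E z.1).prod (ContinuousLinearMap.apply ℂ E z.2)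
  -- The induction runs over all `z` at once, because the recursion peels off the generator that
  -- acts first and thereby replaces `z` by its image.
  have key : ∀ k t, ∀ z ∈ R, Ψ z (dysonSeries δ s k t) ∈ R := by
    intro k
    induction k with
    | zero => intro t z hz; exact hz
    | succ k ih =>
      intro t z hz
      rw [clm_dysonSeries_succ hδ]
      exact intervalIntegral_mem_of_isClosed (R := R.restrictScalars ℝ) hR
        (fun r => ih r _ (hinv z hz r))
        ((Ψ z).continuous.comp ((continuous_dysonSeries hδ s k).mul hδ)) s t
  have hsum := ((summable_dysonSeries hδ s t).hasSum).mapL (Ψ z)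
  exact hR.mem_of_tendsto hsum (Eventually.of_forall fun F => sum_mem fun k _ => key k t z hz)

include hδ in
/-- Two generators that agree on an invariant set have the same Dyson series there. -/
lemma tsum_dysonSeries_congr {δ' : ℝ → E →L[ℂ] E} (hδ' : Continuous δ') {R : Set E}
    (hinv : ∀ v ∈ R, ∀ r, δ r v ∈ R) (heq : ∀ v ∈ R, ∀ r, δ' r v = δ r v) {v : E} (hv : v ∈ R)
    (t : ℝ) : (∑' k, dysonSeries δ' s k t) v = (∑' k, dysonSeries δ s k t) v := by
  have key : ∀ k t, ∀ v ∈ R, dysonSeries δ' s k t v = dysonSeries δ s k t v := by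
    intro k
    induction k with
    | zero => intros; rfl
    | succ k ih =>
      intro t v hv
      refine (clm_dysonSeries_succ hδ' s (ContinuousLinearMap.apply ℂ E v) k t).trans
        (Eq.trans ?_ (clm_dysonSeries_succ hδ s (ContinuousLinearMap.apply ℂ E v) k t).symm)
      congr 1
      funext r
      change dysonSeries δ' s k r (δ' r v) = dysonSeries δ s k r (δ r v)
      rw [heq v hv r]
      exact ih r _ (hinv v hv r)
  have h1 := (ContinuousLinearMap.apply ℂ E v).map_tsum (summable_dysonSeries hδ' s t)
  have h2 := (ContinuousLinearMap.apply ℂ E v).map_tsum (summable_dysonSeries hδ s t)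
  refine h1.trans (Eq.trans ?_ h2.symm)
  exact tsum_congr fun k => key k t v hv

end OperatorDyson

/-- The solution of a scalar linear differential equation. -/
lemma eq_mul_exp_of_hasDerivAt {f : ℝ → ℂ} {k : ℂ} (hf : ∀ t, HasDerivAt f (k * f t) t) (t : ℝ) :
    f t = f 0 * Complex.exp (k * t) := by
  have he : ∀ t : ℝ, HasDerivAt (fun t : ℝ => Complex.exp (-(k * t)))
      (Complex.exp (-(k * t)) * -k) t := fun t => by
    have : HasDerivAt (fun t : ℝ => -(k * (t : ℂ))) (-k) t := by
      have h := (Complex.ofRealCLM.hasDerivAt (x := t)).const_mul k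
      simp only [Complex.ofRealCLM_apply, Complex.ofReal_one, mul_one] at h
      exact h.neg
    exact this.cexp
  have hd : ∀ t, HasDerivAt (fun t => f t * Complex.exp (-(k * t))) 0 t := fun t => by
    convert! (hf t).mul (he t) using 1
    ring
  have hc := is_const_of_deriv_eq_zero (fun t => (hd t).differentiableAt)
    (fun t => (hd t).deriv) t 0
  simp only [Complex.ofReal_zero, mul_zero, neg_zero, Complex.exp_zero, mul_one] at hc
  rw [← hc, mul_assoc, ← Complex.exp_add]
  simp

end

noncomputable section
namespace CooperField

/-! ### Canonical anticommutation relations on Fock space. -/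

section FockCAR

variable {I : Type} [LinearOrder I]

lemma ann_apply (i : I) (f : Fock I) (S : Finset I) :
    ann i f S = if i ∈ S then 0 else jwSign i S * f (insert i S) := rfl

lemma jwSign_mul_self (i : I) (S : Finset I) : jwSign i S * jwSign i S = 1 := by
  rw [jwSign, ← mul_pow]; simp

lemma star_jwSign (i : I) (S : Finset I) : star (jwSign i S) = jwSign i S := by
  simp [jwSign]

lemma jwSign_insert_self (i : I) (S : Finset I) : jwSign i (insert i S) = jwSign i S := by
  simp [jwSign, Finset.filter_insert]

lemma jwSign_erase_self (i : I) (S : Finset I) : jwSign i (S.erase i) = jwSign i S := by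
  rw [jwSign, jwSign, Finset.filter_erase, Finset.erase_eq_of_notMem (by simp)]

lemma jwSign_insert (i j : I) (S : Finset I) (hj : j ∉ S) :
    jwSign i (insert j S) = (if j < i then -1 else 1) * jwSign i S := by
  unfold jwSign
  rw [Finset.filter_insert]
  split_ifs with h
  · rw [Finset.card_insert_of_notMem (by simp [hj]), pow_succ]; ring
  · simp

lemma jwSign_erase (i j : I) (S : Finset I) (hj : j ∈ S) :
    jwSign i (S.erase j) = (if j < i then -1 else 1) * jwSign i S := by
  have h := jwSign_insert i j (S.erase j) (Finset.notMem_erase j S)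
  rw [Finset.insert_erase hj] at h
  rw [h, ← mul_assoc]
  split_ifs <;> simp

/-- The creation operator in coordinates. -/
lemma adjoint_ann_apply (i : I) (f : Fock I) (S : Finset I) :
    (star (ann i) : Fock I →L[ℂ] Fock I) f S
      = if i ∈ S then jwSign i S * f (S.erase i) else 0 := by
  -- The coordinate of `a_i^* f` at `S` is the inner product of `a_i e_S` with `f`, so the action on
  -- basis vectors determines the adjoint.
  have h1 : ann i (lp.single 2 S (1 : ℂ))
      = if i ∈ S then jwSign i S • (lp.single 2 (S.erase i) (1 : ℂ) : Fock I) else 0 := by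
    ext T
    rw [ann_apply]
    split_ifs with h2 h3 h3
    · have : T ≠ S.erase i := fun h => by simp [h] at h2
      simp [this]
    · simp
    · by_cases h : insert i T = S
      · subst h
        simp [Finset.erase_insert h2, jwSign_insert_self]
      · have : T ≠ S.erase i := fun h' => h (by rw [h', Finset.insert_erase h3])
        simp [this, h]
    · have : insert i T ≠ S := fun h => h3 (by simp [← h])
      simp [this]
  have h2 : (star (ann i) : Fock I →L[ℂ] Fock I) f S
      = inner ℂ (ann i (lp.single 2 S (1 : ℂ))) f := by
    rw [ContinuousLinearMap.star_eq_adjoint, ← ContinuousLinearMap.adjoint_inner_right,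
      lp.inner_single_left]
    simp
  rw [h2, h1]
  split_ifs
  · rw [inner_smul_left, lp.inner_single_left]
    have := star_jwSign i S
    simp only [Complex.star_def] at this
    simp [this]
  · simp

/-- For `i ≠ j` exactly one of `j < i` and `i < j` holds, so exactly one of the two orders of
removal picks up an extra sign. -/
lemma ann_mul_ann (i j : I) : ann i * ann j = -(ann j * ann i) := by
  ext f S
  change ann i (ann j f) S = -(ann j (ann i f) S)
  simp only [ann_apply]
  rcases eq_or_ne i j with rfl | hij
  · simp
  · by_cases hi : i ∈ S <;> by_cases hj : j ∈ S <;> simp [hi, hj, hij, hij.symm]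
    rw [jwSign_insert _ _ _ hi, jwSign_insert _ _ _ hj, Finset.insert_comm]
    rcases lt_or_gt_of_ne hij with h | h
    · simp [h, h.not_gt]; ring
    · simp [h, h.not_gt]; ring

lemma ann_mul_star_ann (i j : I) :
    ann i * star (ann j) + star (ann j) * ann i = if i = j then 1 else 0 := by
  ext f S
  change ann i ((star (ann j) : Fock I →L[ℂ] Fock I) f) S
    + (star (ann j) : Fock I →L[ℂ] Fock I) (ann i f) S = _
  simp only [ann_apply, adjoint_ann_apply]
  rcases eq_or_ne i j with rfl | hij
  · by_cases hi : i ∈ S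
    · simp [hi, jwSign_erase_self, Finset.insert_erase, ← mul_assoc, jwSign_mul_self]
    · simp [hi, jwSign_insert_self, ← mul_assoc, jwSign_mul_self]
  · by_cases hi : i ∈ S <;> by_cases hj : j ∈ S <;> simp [hi, hj, hij, hij.symm]
    rw [jwSign_insert _ _ _ hi, jwSign_erase _ _ _ hj, Finset.erase_insert_of_ne hij]
    rcases lt_or_gt_of_ne hij with h | h
    · simp [h, h.not_gt]; ring
    · simp [h, h.not_gt]; ring

lemma carAnn_mul_carAnn (i j : I) : carAnn i * carAnn j = -(carAnn j * carAnn i) :=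
  Subtype.ext (ann_mul_ann i j)

lemma carAnn_mul_star_carAnn (i j : I) :
    carAnn i * star (carAnn j) + star (carAnn j) * carAnn i = if i = j then 1 else 0 := by
  apply Subtype.ext
  have h := ann_mul_star_ann i j
  split_ifs at h ⊢ <;> exact h

/-- A star subalgebra that contains the annihilation operators is dense in the CAR algebra. -/
lemma dense_of_carAnn_mem (R : StarSubalgebra ℂ (carAlgebra I)) (h : ∀ i, carAnn i ∈ R) :
    Dense (R : Set (carAlgebra I)) := by
  have key : ∀ x ∈ StarAlgebra.adjoin ℂ (Set.range (ann (I := I))),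
      ∀ hx : x ∈ carAlgebra I, (⟨x, hx⟩ : carAlgebra I) ∈ R := by
    intro x hx
    have hle : StarAlgebra.adjoin ℂ (Set.range (ann (I := I)))
        ≤ R.map (carAlgebra I).subtype := by
      rw [StarAlgebra.adjoin_le_iff]
      rintro _ ⟨i, rfl⟩
      exact ⟨carAnn i, h i, rfl⟩
    obtain ⟨y, hy, rfl⟩ := hle hx
    intro _
    exact hy
  intro u
  rw [Metric.mem_closure_iff]
  intro ε hε
  have hu : (u : Fock I →L[ℂ] Fock I)
      ∈ closure (StarAlgebra.adjoin ℂ (Set.range (ann (I := I))) : Set (Fock I →L[ℂ] Fock I)) :=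
    u.2
  obtain ⟨v, hv, hd⟩ := Metric.mem_closure_iff.1 hu ε hε
  exact ⟨⟨v, StarSubalgebra.le_topologicalClosure _ hv⟩, key v hv _, hd⟩

end FockCAR

/-! Shortcut instances, which keep instance search on the CAR algebra fast. -/

scoped instance (I : Type) [LinearOrder I] : NormedRing (carAlgebra I) := inferInstance
scoped instance (I : Type) [LinearOrder I] : Ring (carAlgebra I) := inferInstance
scoped instance (I : Type) [LinearOrder I] : Semiring (carAlgebra I) := inferInstance
scoped instance (I : Type) [LinearOrder I] : NonUnitalNonAssocRing (carAlgebra I) := inferInstance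
scoped instance (I : Type) [LinearOrder I] : Mul (carAlgebra I) := inferInstance
scoped instance (I : Type) [LinearOrder I] : MulOneClass (carAlgebra I) := inferInstance
scoped instance (I : Type) [LinearOrder I] : One (carAlgebra I) := inferInstance
scoped instance (I : Type) [LinearOrder I] : Star (carAlgebra I) := inferInstance
scoped instance (I : Type) [LinearOrder I] : StarRing (carAlgebra I) := inferInstance
scoped instance (I : Type) [LinearOrder I] : NormedAddCommGroup (carAlgebra I) := inferInstance
scoped instance (I : Type) [LinearOrder I] : AddCommGroup (carAlgebra I) := inferInstance
scoped instance (I : Type) [LinearOrder I] : AddCommMonoid (carAlgebra I) := inferInstance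
scoped instance (I : Type) [LinearOrder I] : NonUnitalCStarAlgebra (carAlgebra I) := inferInstance

end CooperField
end

noncomputable section
namespace CooperField

/-! ### The relations of a single site, in an abstract algebra. -/

section CarPair

variable {A : Type*} [Ring A] [StarRing A] [Algebra ℂ A]

/-- The canonical anticommutation relations for the two modes of a site. -/
structure IsCar (a : Spin → A) : Prop where
  mul (s s' : Spin) : a s * a s' = -(a s' * a s)
  mul_star (s s' : Spin) : a s * star (a s') + star (a s') * a s = if s = s' then 1 else 0

/-- The generators of the algebra of a site: annihilation and creation operators. -/
def carGen (a : Spin → A) (g : Spin × Bool) : A := if g.2 then star (a g.1) else a g.1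

namespace IsCar

variable {a : Spin → A} (h : IsCar a)
include h

lemma mul_self (s : Spin) : a s * a s = 0 := by
  have h2 : (2 : ℂ) • (a s * a s) = 0 := by
    rw [two_smul]
    nth_rw 1 [h.mul s s]
    exact neg_add_cancel _
  simpa using congrArg ((2⁻¹ : ℂ) • ·) h2

/-- All relations are oriented towards the normal order `a_↑^*`, `a_↓^*`, `a_↑`, `a_↓`. Used as
rewriting rules, together with `IsCar.rules_assoc`, they reduce identities on a site to linear
algebra. -/
lemma rules :
    a up * a up = 0 ∧ a dn * a dn = 0 ∧ star (a up) * star (a up) = 0 ∧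
    star (a dn) * star (a dn) = 0 ∧ a dn * a up = -(a up * a dn) ∧
    star (a dn) * star (a up) = -(star (a up) * star (a dn)) ∧
    a up * star (a up) = 1 - star (a up) * a up ∧ a dn * star (a dn) = 1 - star (a dn) * a dn ∧
    a up * star (a dn) = -(star (a dn) * a up) ∧ a dn * star (a up) = -(star (a up) * a dn) := by
  refine ⟨h.mul_self up, h.mul_self dn, ?_, ?_, h.mul dn up, ?_, ?_, ?_, ?_, ?_⟩
  · rw [← star_mul, h.mul_self, star_zero]
  · rw [← star_mul, h.mul_self, star_zero]
  · rw [← star_mul, ← star_mul, h.mul, star_neg]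
  · simpa using eq_sub_of_add_eq (h.mul_star up up)
  · simpa using eq_sub_of_add_eq (h.mul_star dn dn)
  · simpa using eq_sub_of_add_eq (h.mul_star up dn)
  · simpa using eq_sub_of_add_eq (h.mul_star dn up)

end IsCar

/-- The relations `IsCar.rules` with a further factor on the right. -/
lemma IsCar.rules_assoc {a : Spin → A} (h : IsCar a) (x : A) :
    a up * (a up * x) = 0 ∧ a dn * (a dn * x) = 0 ∧ star (a up) * (star (a up) * x) = 0 ∧
    star (a dn) * (star (a dn) * x) = 0 ∧ a dn * (a up * x) = -(a up * (a dn * x)) ∧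
    star (a dn) * (star (a up) * x) = -(star (a up) * (star (a dn) * x)) ∧
    a up * (star (a up) * x) = x - star (a up) * (a up * x) ∧
    a dn * (star (a dn) * x) = x - star (a dn) * (a dn * x) ∧
    a up * (star (a dn) * x) = -(star (a dn) * (a up * x)) ∧
    a dn * (star (a up) * x) = -(star (a up) * (a dn * x)) := by
  obtain ⟨h1, h2, h3, h4, h5, h6, h7, h8, h9, h10⟩ := h.rules
  simp only [← mul_assoc, h1, h2, h3, h4, h5, h6, h7, h8, h9, h10]
  simp [sub_mul]

variable {a : Spin → A} (h : IsCar a)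
include h

lemma IsCar.num_mul_pair (s : Spin) :
    (star (a s) * a s) * (a dn * a up) = (a dn * a up) * (star (a s) * a s) - a dn * a up := by
  cases s <;>
  simp only [mul_assoc, mul_sub, mul_neg, neg_mul, mul_zero, h.rules, h.rules_assoc] <;> abel

/-- The pair operators and `n - 1` close under commutators: they form the pseudo-spin copy of
`su(2)` on which the model rests. -/
lemma IsCar.star_pair_mul_pair :
    (star (a up) * star (a dn)) * (a dn * a up) - (a dn * a up) * (star (a up) * star (a dn))
      = star (a up) * a up + star (a dn) * a dn - 1 := by
  simp only [mul_assoc, mul_sub, mul_neg, neg_mul, mul_one, h.rules,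
    h.rules_assoc]
  abel

lemma IsCar.commute_num (s s' : Spin) : Commute (star (a s) * a s) (star (a s') * a s') := by
  have key : Commute (star (a up) * a up) (star (a dn) * a dn) := by
    rw [Commute, SemiconjBy]
    simp only [mul_assoc, mul_neg, h.rules, h.rules_assoc, neg_neg]
  cases s <;> cases s'
  exacts [Commute.refl _, key.symm, key, Commute.refl _]

end CarPair

/-! ### Polynomials in the generators of a site. -/

section Words

variable {A : Type*} [Ring A] [StarRing A] [Algebra ℂ A]

/-- The span of the words in the generators of a site whose length has a given property. -/
def wordSpan (a : Spin → A) (q : ℕ → Prop) : Submodule ℂ A :=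
  Submodule.span ℂ {x | ∃ w : List (Spin × Bool), q w.length ∧ x = (w.map (carGen a)).prod}

lemma word_mem_wordSpan (a : Spin → A) (q : ℕ → Prop) (w : List (Spin × Bool)) (hw : q w.length) :
    (w.map (carGen a)).prod ∈ wordSpan a q :=
  Submodule.subset_span ⟨w, hw, rfl⟩

lemma mul_mem_wordSpan {a : Spin → A} {q₁ q₂ q : ℕ → Prop}
    (hq : ∀ m n, q₁ m → q₂ n → q (m + n)) {x y : A} (hx : x ∈ wordSpan a q₁)
    (hy : y ∈ wordSpan a q₂) : x * y ∈ wordSpan a q := by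
  have h : wordSpan a q₁ * wordSpan a q₂ ≤ wordSpan a q := by
    rw [wordSpan, wordSpan, Submodule.span_mul_span, Submodule.span_le]
    rintro _ ⟨_, ⟨w, hw, rfl⟩, _, ⟨w', hw', rfl⟩, rfl⟩
    have := word_mem_wordSpan a q (w ++ w') (by simpa using hq _ _ hw hw')
    simpa using this
  exact h (Submodule.mul_mem_mul hx hy)

/-- Passes between linear spans, suited to closedness and invariance arguments, and evaluations of
noncommutative polynomials, in which product states are formulated. -/
lemma mem_wordSpan_iff_mem_range (a : Spin → A) (x : A) :
    x ∈ wordSpan a (fun _ => True) ↔ ∃ P, FreeAlgebra.lift ℂ (carGen a) P = x := by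
  constructor
  · intro hx
    refine Submodule.span_induction (p := fun x _ => ∃ P, FreeAlgebra.lift ℂ (carGen a) P = x)
      ?_ ?_ ?_ ?_ hx
    · rintro _ ⟨w, -, rfl⟩
      exact ⟨(w.map (FreeAlgebra.ι ℂ)).prod, by
        rw [map_list_prod, List.map_map]
        congr 2
        funext g
        simp⟩
    · exact ⟨0, map_zero _⟩
    · rintro _ _ - - ⟨P, rfl⟩ ⟨Q, rfl⟩
      exact ⟨P + Q, map_add _ _ _⟩
    · rintro c _ - ⟨P, rfl⟩
      exact ⟨c • P, map_smul _ _ _⟩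
  · rintro ⟨P, rfl⟩
    induction P using FreeAlgebra.induction with
    | grade0 r =>
      rw [AlgHom.commutes, Algebra.algebraMap_eq_smul_one]
      exact Submodule.smul_mem _ _ (word_mem_wordSpan a _ [] trivial)
    | grade1 g =>
      have := word_mem_wordSpan a (fun _ => True) [g] trivial
      simpa using this
    | mul P Q hP hQ =>
      rw [map_mul]
      exact mul_mem_wordSpan (fun _ _ _ _ => trivial) hP hQ
    | add P Q hP hQ =>
      rw [map_add]
      exact Submodule.add_mem _ hP hQ

variable {a : Spin → A} (h : IsCar a)
include h

/-- The algebra of a site is finite-dimensional. -/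
lemma IsCar.finiteDimensional_wordSpan (q : ℕ → Prop) : FiniteDimensional ℂ (wordSpan a q) := by
  obtain ⟨h1, h2, h3, h4, h5, h6, h7, h8, h9, h10⟩ := h.rules
  -- `X` and `Y` are the algebras of the two modes. Their product contains `1` and is stable under
  -- left multiplication by every generator, hence contains all words.
  set X : Submodule ℂ A := Submodule.span ℂ {1, a up, star (a up), star (a up) * a up} with hX
  set Y : Submodule ℂ A := Submodule.span ℂ {1, a dn, star (a dn), star (a dn) * a dn} with hY
  have mX : 1 ∈ X ∧ a up ∈ X ∧ star (a up) ∈ X ∧ star (a up) * a up ∈ X := by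
    refine ⟨?_, ?_, ?_, ?_⟩ <;> exact Submodule.subset_span (by simp)
  have mY : 1 ∈ Y ∧ a dn ∈ Y ∧ star (a dn) ∈ Y ∧ star (a dn) * a dn ∈ Y := by
    refine ⟨?_, ?_, ?_, ?_⟩ <;> exact Submodule.subset_span (by simp)
  have lin : ∀ (Z T : Submodule ℂ A) (s : Set A) (g : A), Z = Submodule.span ℂ s →
      (∀ x ∈ s, g * x ∈ T) → ∀ x ∈ Z, g * x ∈ T := by
    rintro Z T s g rfl hs x hx
    have : Submodule.span ℂ s ≤ T.comap (LinearMap.mulLeft ℂ g) := Submodule.span_le.2 hs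
    exact this hx
  have hXa : ∀ x ∈ X, a up * x ∈ X := by
    refine lin X X _ _ hX ?_
    rintro x (rfl | rfl | rfl | rfl)
    · simpa using mX.2.1
    · simp [h1]
    · rw [h7]; exact Submodule.sub_mem _ mX.1 mX.2.2.2
    · simp [← mul_assoc, h7, sub_mul]
      simpa [mul_assoc, h1] using mX.2.1
  have hXs : ∀ x ∈ X, star (a up) * x ∈ X := by
    refine lin X X _ _ hX ?_
    rintro x (rfl | rfl | rfl | rfl)
    · simpa using mX.2.2.1
    · exact mX.2.2.2
    · simp [h3]
    · simp [← mul_assoc, h3]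
  have hYa : ∀ x ∈ Y, a dn * x ∈ Y := by
    refine lin Y Y _ _ hY ?_
    rintro x (rfl | rfl | rfl | rfl)
    · simpa using mY.2.1
    · simp [h2]
    · rw [h8]; exact Submodule.sub_mem _ mY.1 mY.2.2.2
    · simp [← mul_assoc, h8, sub_mul]
      simpa [mul_assoc, h2] using mY.2.1
  have hYs : ∀ x ∈ Y, star (a dn) * x ∈ Y := by
    refine lin Y Y _ _ hY ?_
    rintro x (rfl | rfl | rfl | rfl)
    · simpa using mY.2.2.1
    · exact mY.2.2.2
    · simp [h4]
    · simp [← mul_assoc, h4]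
  have left : ∀ g, (∀ x ∈ X, g * x ∈ X) → ∀ z ∈ X * Y, g * z ∈ X * Y := by
    intro g hg
    have : X * Y ≤ (X * Y).comap (LinearMap.mulLeft ℂ g) := by
      rw [Submodule.mul_le]
      intro x hx y hy
      simpa [mul_assoc] using Submodule.mul_mem_mul (hg x hx) hy
    exact fun z hz => this hz
  -- A generator of the second mode moves past an element of `X` at the cost of signs and then acts
  -- inside `Y`.
  have right : ∀ g, (∀ y ∈ Y, g * y ∈ Y) → g * a up = -(a up * g) →
      g * star (a up) = -(star (a up) * g) → ∀ z ∈ X * Y, g * z ∈ X * Y := by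
    intro g hg ha hs
    have comm : ∀ x ∈ X, ∃ x' ∈ X, g * x = x' * g := by
      intro x hx
      refine Submodule.span_induction (p := fun x _ => ∃ x' ∈ X, g * x = x' * g) ?_ ?_ ?_ ?_ hx
      · rintro x (rfl | rfl | rfl | rfl)
        · exact ⟨1, mX.1, by simp⟩
        · exact ⟨-a up, Submodule.neg_mem _ mX.2.1, by simp [ha]⟩
        · exact ⟨-star (a up), Submodule.neg_mem _ mX.2.2.1, by simp [hs]⟩
        · exact ⟨_, mX.2.2.2, by rw [← mul_assoc, hs, neg_mul, mul_assoc, ha]; simp [mul_assoc]⟩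
      · exact ⟨0, X.zero_mem, by simp⟩
      · rintro x y - - ⟨x', hx', e⟩ ⟨y', hy', e'⟩
        exact ⟨x' + y', X.add_mem hx' hy', by rw [mul_add, add_mul, e, e']⟩
      · rintro c x - ⟨x', hx', e⟩
        exact ⟨c • x', X.smul_mem c hx', by rw [mul_smul_comm, smul_mul_assoc, e]⟩
    have : X * Y ≤ (X * Y).comap (LinearMap.mulLeft ℂ g) := by
      rw [Submodule.mul_le]
      intro x hx y hy
      obtain ⟨x', hx', e⟩ := comm x hx
      have : g * (x * y) = x' * (g * y) := by rw [← mul_assoc, e, mul_assoc]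
      simpa [this] using Submodule.mul_mem_mul hx' (hg y hy)
    exact fun z hz => this hz
  have hgen : ∀ g, ∀ z ∈ X * Y, carGen a g * z ∈ X * Y := by
    rintro ⟨s, b⟩
    cases s <;> cases b
    · exact right _ hYa h5 h10
    · exact right _ hYs (by rw [show carGen a (false, true) = star (a dn) from rfl, h9, neg_neg]) h6
    · exact left _ hXa
    · exact left _ hXs
  have hle : wordSpan a q ≤ X * Y := by
    rw [wordSpan, Submodule.span_le]
    rintro _ ⟨w, -, rfl⟩
    induction w with
    | nil => simpa using Submodule.mul_mem_mul mX.1 mY.1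
    | cons g w ih => simpa using hgen g _ ih
  have fg : (X * Y).FG := by
    refine Submodule.FG.mul ?_ ?_
    · exact Submodule.fg_span (Set.toFinite _)
    · exact Submodule.fg_span (Set.toFinite _)
  have : FiniteDimensional ℂ ↥(X * Y) := Module.Finite.of_fg fg
  exact Submodule.finiteDimensional_of_le hle

end Words

/-! ### The one-site Hamiltonian and its commutators. -/

section LocalHam

variable {A : Type*} [Ring A] [StarRing A] [Algebra ℂ A]

/-- The term of a site in the approximating Hamiltonian, in an algebra with two modes. -/
def localHam (p : Params) (c : ℂ) (a : Spin → A) : A :=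
  ((2 * p.lam : ℝ) : ℂ) • (star (a up) * a up * (star (a dn) * a dn))
    - (p.mu : ℂ) • (star (a up) * a up + star (a dn) * a dn)
    - (p.h : ℂ) • (star (a up) * a up - star (a dn) * a dn)
    - (p.gam : ℂ) • (c • (star (a up) * star (a dn)) + star c • (a dn * a up))

lemma localHam_mem_wordSpan (p : Params) (c : ℂ) (a : Spin → A) :
    localHam p c a ∈ wordSpan a Even := by
  have e1 (g1 g2 : Spin × Bool) : carGen a g1 * carGen a g2 ∈ wordSpan a Even := by
    simpa using word_mem_wordSpan a Even [g1, g2] (by simp)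
  have n1 (s : Spin) : star (a s) * a s ∈ wordSpan a Even := e1 (s, true) (s, false)
  have hE : ∀ m n : ℕ, Even m → Even n → Even (m + n) := fun _ _ => Even.add
  exact Submodule.sub_mem _ (Submodule.sub_mem _ (Submodule.sub_mem _
    (Submodule.smul_mem _ _ (mul_mem_wordSpan hE (n1 up) (n1 dn)))
    (Submodule.smul_mem _ _ (Submodule.add_mem _ (n1 up) (n1 dn))))
    (Submodule.smul_mem _ _ (Submodule.sub_mem _ (n1 up) (n1 dn))))
    (Submodule.smul_mem _ _ (Submodule.add_mem _
      (Submodule.smul_mem _ _ (e1 (up, true) (dn, true)))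
      (Submodule.smul_mem _ _ (e1 (dn, false) (up, false)))))

variable {a : Spin → A} (h : IsCar a)
include h

/-- The magnetic field drops out since a pair carries no spin. Removing a pair costs `-2μ` from the
chemical potential and releases the repulsion `2λ`; the field term contributes `-γ c [b*, b] = γ c
(1 - n)`. Together with the next two commutators this closes on pair, adjoint pair and `1 - n`. -/
lemma IsCar.localHam_commutator_pair (p : Params) (c : ℂ) :
    localHam p c a * (a dn * a up) - a dn * a up * localHam p c a
      = (2 * (p.mu - p.lam) : ℂ) • (a dn * a up)
        + (p.gam * c) • (1 - (star (a up) * a up + star (a dn) * a dn)) := by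
  simp only [localHam, sub_mul, mul_sub, add_mul, mul_add, smul_mul_assoc, mul_smul_comm, mul_assoc,
    mul_neg, neg_mul, mul_zero, mul_one, h.rules, h.rules_assoc]
  push_cast
  module

lemma IsCar.localHam_commutator_star_pair (p : Params) (c : ℂ) :
    localHam p c a * (star (a up) * star (a dn)) - star (a up) * star (a dn) * localHam p c a
      = -(2 * (p.mu - p.lam) : ℂ) • (star (a up) * star (a dn))
        - (p.gam * star c) • (1 - (star (a up) * a up + star (a dn) * a dn)) := by
  simp only [localHam, sub_mul, mul_sub, add_mul, mul_add, smul_mul_assoc, mul_smul_comm, mul_assoc,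
    mul_neg, neg_mul, mul_zero, mul_one, h.rules, h.rules_assoc]
  push_cast
  module

lemma IsCar.localHam_commutator_num (p : Params) (c : ℂ) :
    localHam p c a * (star (a up) * a up + star (a dn) * a dn)
      - (star (a up) * a up + star (a dn) * a dn) * localHam p c a
      = (2 * p.gam * c) • (star (a up) * star (a dn)) - (2 * p.gam * star c) • (a dn * a up) := by
  simp only [localHam, sub_mul, mul_sub, add_mul, mul_add, smul_mul_assoc, mul_smul_comm, mul_assoc,
    mul_neg, neg_mul, mul_zero, mul_one, h.rules, h.rules_assoc]
  push_cast
  module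

lemma IsCar.star_localHam [StarModule ℂ A] (p : Params) (c : ℂ) :
    star (localHam p c a) = localHam p c a := by
  have h1 := (h.commute_num up dn).eq
  have h2 : a up * a dn = -(a dn * a up) := h.mul up dn
  simp only [localHam, star_sub, star_add, star_smul, star_mul, star_star, Complex.star_def,
    Complex.conj_ofReal, Complex.conj_conj, h1]
  rw [add_comm (c • _)]

/-- The vacuum projection of a site has rank one. -/
lemma IsCar.exists_vacuum_mul_mul (P : FreeAlgebra ℂ (Spin × Bool)) :
    ∃ r : ℂ, (1 - star (a up) * a up) * (1 - star (a dn) * a dn) *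
      FreeAlgebra.lift ℂ (carGen a) P * ((1 - star (a up) * a up) * (1 - star (a dn) * a dn))
      = r • ((1 - star (a up) * a up) * (1 - star (a dn) * a dn)) := by
  set p := (1 - star (a up) * a up) * (1 - star (a dn) * a dn) with hp
  have lin : ∀ (T : Submodule ℂ A) (s : Set A) (g : A),
      (∀ x ∈ s, g * x ∈ T) → ∀ x ∈ Submodule.span ℂ s, g * x ∈ T := by
    rintro T s g hs x hx
    have : Submodule.span ℂ s ≤ T.comap (LinearMap.mulLeft ℂ g) := Submodule.span_le.2 hs
    exact this hx
  -- `E` is the left ideal generated by the vacuum projection `p`, spanned by the four Fock vectors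
  -- of the site. Left multiplication by `p` kills all of them but `p` itself, which leaves a scalar
  -- multiple of `p`.
  set E : Submodule ℂ A := Submodule.span ℂ
    {p, star (a up) * p, star (a dn) * p, star (a up) * (star (a dn) * p)} with hE
  have mE : p ∈ E ∧ star (a up) * p ∈ E ∧ star (a dn) * p ∈ E ∧
      star (a up) * (star (a dn) * p) ∈ E := by
    refine ⟨?_, ?_, ?_, ?_⟩ <;> exact Submodule.subset_span (by simp)
  have hpu : a up * p = 0 := by
    simp only [hp, sub_mul, mul_sub, mul_assoc, mul_neg, mul_zero, mul_one, one_mul,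
      h.rules, h.rules_assoc]
    abel
  have hpd : a dn * p = 0 := by
    simp only [hp, sub_mul, mul_sub, mul_assoc, mul_neg, mul_zero, mul_one, one_mul,
      h.rules, h.rules_assoc]
    abel
  have hup : p * star (a up) = 0 := by
    simp only [hp, sub_mul, mul_sub, mul_assoc, mul_neg, neg_mul, mul_one, one_mul,
      h.rules, h.rules_assoc]
    abel
  have hdp : p * star (a dn) = 0 := by
    simp only [hp, sub_mul, mul_sub, mul_assoc, mul_neg, neg_mul, mul_zero, mul_one, one_mul,
      h.rules, h.rules_assoc]
    abel
  have hpp : p * p = p := by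
    calc p * p = ((1 - star (a up) * a up) * (1 - star (a dn) * a dn)) * p := by rw [← hp]
      _ = p := by simp only [sub_mul, one_mul, mul_assoc, hpu, hpd, mul_zero, sub_zero]
  have hgen : ∀ g, ∀ z ∈ E, carGen a g * z ∈ E := by
    rintro ⟨s, b⟩
    refine lin E _ _ ?_
    rintro x (rfl | rfl | rfl | rfl) <;> cases s <;> cases b <;>
      simp only [carGen, if_true, if_false, Bool.false_eq_true] <;>
      simp [h.rules_assoc, hpu, hpd, mE]
  have hmem : FreeAlgebra.lift ℂ (carGen a) P * p ∈ E := by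
    have : ∀ z ∈ E, FreeAlgebra.lift ℂ (carGen a) P * z ∈ E := by
      induction P using FreeAlgebra.induction with
      | grade0 r =>
        intro z hz
        rw [AlgHom.commutes, ← Algebra.smul_def]
        exact E.smul_mem r hz
      | grade1 g => simpa using hgen g
      | mul P Q hP hQ =>
        intro z hz
        rw [map_mul, mul_assoc]
        exact hP _ (hQ z hz)
      | add P Q hP hQ =>
        intro z hz
        rw [map_add, add_mul]
        exact E.add_mem (hP z hz) (hQ z hz)
    exact this p mE.1
  have hfin : ∀ z ∈ E, p * z ∈ Submodule.span ℂ {p} := by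
    refine lin _ _ _ ?_
    rintro x (rfl | rfl | rfl | rfl)
    · rw [hpp]; exact Submodule.mem_span_singleton_self p
    · simp [← mul_assoc, hup]
    · simp [← mul_assoc, hdp]
    · simp [← mul_assoc, hup]
  obtain ⟨r, hr⟩ := Submodule.mem_span_singleton.1 (hfin _ hmem)
  exact ⟨r, by rw [mul_assoc, hr]⟩

end LocalHam

end CooperField
end

noncomputable section
namespace CooperField

/-! ### Locality on the lattice. -/

section Lattice

variable {d : ℕ}

lemma mode_ne {x y : Site d} (hxy : x ≠ y) (s s' : Spin) :
    (toLex (toLex x, s) : Mode d) ≠ toLex (toLex y, s') := fun h => hxy (by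
  have := congrArg (fun m : Mode d => ofLex (ofLex m).1) h
  simpa using this)

lemma isCar_a (x : Site d) : IsCar (a x) where
  mul _ _ := carAnn_mul_carAnn _ _
  mul_star s s' := by
    have h := carAnn_mul_star_carAnn (toLex (toLex x, s) : Mode d) (toLex (toLex x, s'))
    by_cases hs : s = s'
    · subst hs
      rw [if_pos rfl] at h ⊢
      exact h
    · rw [if_neg hs]
      rw [if_neg] at h
      · exact h
      · intro he
        have := congrArg (fun m : Mode d => (ofLex m).2) he
        exact hs (by simpa using this)

lemma carGen_mul_carGen {x y : Site d} (hxy : x ≠ y) (g g' : Spin × Bool) :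
    carGen (a x) g * carGen (a y) g' = -(carGen (a y) g' * carGen (a x) g) := by
  have h1 (x y : Site d) (s s' : Spin) : a x s * a y s' = -(a y s' * a x s) :=
    carAnn_mul_carAnn _ _
  have h2 {x y : Site d} (hxy : x ≠ y) (s s' : Spin) :
      a x s * star (a y s') = -(star (a y s') * a x s) := by
    have h := carAnn_mul_star_carAnn (toLex (toLex x, s) : Mode d) (toLex (toLex y, s'))
    rw [if_neg (mode_ne hxy s s')] at h
    exact eq_neg_of_add_eq_zero_left h
  obtain ⟨s, b⟩ := g
  obtain ⟨s', b'⟩ := g'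
  cases b <;> cases b' <;> simp only [carGen, if_true, if_false, Bool.false_eq_true]
  · exact h1 x y s s'
  · exact h2 hxy s s'
  · rw [h2 hxy.symm s' s, neg_neg]
  · rw [← star_mul, h1, star_neg, star_mul]

lemma word_mul_carGen {x y : Site d} (hxy : x ≠ y) (w : List (Spin × Bool)) (g' : Spin × Bool) :
    (w.map (carGen (a x))).prod * carGen (a y) g'
      = (-1 : ℂ) ^ w.length • (carGen (a y) g' * (w.map (carGen (a x))).prod) := by
  induction w with
  | nil => simp
  | cons g w ih =>
    rw [List.map_cons, List.prod_cons, mul_assoc, ih, mul_smul_comm, ← mul_assoc,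
      carGen_mul_carGen hxy, List.length_cons, pow_succ]
    simp [mul_assoc]

/-- Even elements of the algebra of a site commute with the algebras of the other sites. -/
lemma commute_of_mem_wordSpan {x y : Site d} (hxy : x ≠ y) {A B : U d}
    (hA : A ∈ wordSpan (a x) Even) (hB : B ∈ wordSpan (a y) fun _ => True) : Commute A B := by
  have hw : ∀ w : List (Spin × Bool), Even w.length → ∀ v : List (Spin × Bool),
      Commute (w.map (carGen (a x))).prod (v.map (carGen (a y))).prod := by
    intro w hw v
    induction v with
    | nil => simp
    | cons g v ih =>
      rw [List.map_cons, List.prod_cons]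
      refine Commute.mul_right ?_ ih
      rw [Commute, SemiconjBy, word_mul_carGen hxy, hw.neg_one_pow, one_smul]
  refine Submodule.span_induction (p := fun A _ => Commute A B) ?_ (Commute.zero_left _)
    (fun _ _ _ _ h h' => h.add_left h') (fun c _ _ h => h.smul_left c) hA
  rintro _ ⟨w, hwe, rfl⟩
  refine Submodule.span_induction (p := fun B _ => Commute _ B) ?_ (Commute.zero_right _)
    (fun _ _ _ _ h h' => h.add_right h') (fun c _ _ h => h.smul_right c) hB
  rintro _ ⟨v, -, rfl⟩
  exact hw w hwe v

lemma wordSpan_mono {A : Type*} [Ring A] [StarRing A] [Algebra ℂ A] (a : Spin → A)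
    {q q' : ℕ → Prop} (h : ∀ n, q n → q' n) : wordSpan a q ≤ wordSpan a q' :=
  Submodule.span_mono fun _ ⟨w, hw, e⟩ => ⟨w, h _ hw, e⟩

variable (d) in
/-- Elements localized in the box `Λ_M`, in the sense that they commute with all even on-site
elements outside the box. -/
def localAlgebra (M : ℕ) : StarSubalgebra ℂ (U d) :=
  StarSubalgebra.centralizer ℂ {A | ∃ x ∉ box d M, A ∈ wordSpan (a x) Even}

lemma mem_localAlgebra {M : ℕ} {A : U d} (hA : ∀ x ∉ box d M, ∀ B ∈ wordSpan (a x) Even,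
    Commute B A) (hA' : ∀ x ∉ box d M, ∀ B ∈ wordSpan (a x) Even, Commute (star B) A) :
    A ∈ localAlgebra d M := by
  rw [localAlgebra, StarSubalgebra.mem_centralizer_iff]
  rintro B ⟨x, hx, hB⟩
  exact ⟨hA x hx B hB, hA' x hx B hB⟩

lemma commute_of_mem_localAlgebra {M : ℕ} {A B : U d} (hA : A ∈ localAlgebra d M) {x : Site d}
    (hx : x ∉ box d M) (hB : B ∈ wordSpan (a x) Even) : Commute B A :=
  ((StarSubalgebra.mem_centralizer_iff ℂ).1 hA B ⟨x, hx, hB⟩).1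

lemma star_mem_wordSpan {A : Type*} [Ring A] [StarRing A] [Algebra ℂ A] [StarModule ℂ A]
    {a : Spin → A} {q : ℕ → Prop} {x : A} (hx : x ∈ wordSpan a q) : star x ∈ wordSpan a q := by
  refine Submodule.span_induction (p := fun x _ => star x ∈ wordSpan a q) ?_ ?_ ?_ ?_ hx
  · rintro _ ⟨w, hw, rfl⟩
    have : star (w.map (carGen a)).prod
        = (((w.map fun g => (g.1, !g.2)).reverse).map (carGen a)).prod := by
      clear hw hx
      induction w with
      | nil => simp
      | cons g w ih =>
        obtain ⟨s, b⟩ := g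
        simp only [List.map_cons, List.prod_cons, star_mul, ih, List.reverse_cons, List.map_append,
          List.prod_append]
        cases b <;> simp [carGen]
    rw [this]
    exact word_mem_wordSpan a q _ (by simpa using hw)
  · simp
  · intro x y _ _ h h'
    rw [star_add]
    exact Submodule.add_mem _ h h'
  · intro c x _ h
    rw [star_smul]
    exact Submodule.smul_mem _ _ h

lemma wordSpan_le_localAlgebra {M : ℕ} {x : Site d} (hx : x ∈ box d M) {A : U d}
    (hA : A ∈ wordSpan (a x) fun _ => True) : A ∈ localAlgebra d M :=
  mem_localAlgebra
    (fun _ hy _ hB => commute_of_mem_wordSpan (fun h => hy (by rwa [h])) hB hA)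
    (fun _ hy _ hB => commute_of_mem_wordSpan (fun h => hy (by rwa [h])) (star_mem_wordSpan hB) hA)

lemma box_mono {M L : ℕ} (h : M ≤ L) : box d M ⊆ box d L := by
  refine Fintype.piFinset_subset _ _ fun _ => Finset.Icc_subset_Icc ?_ ?_ <;> omega

lemma exists_mem_box (x : Site d) : ∃ M, x ∈ box d M := by
  refine ⟨∑ i, (x i).natAbs, Fintype.mem_piFinset.2 fun i => ?_⟩
  have : (x i).natAbs ≤ ∑ i, (x i).natAbs :=
    Finset.single_le_sum (f := fun i => (x i).natAbs) (fun _ _ => Nat.zero_le _) (Finset.mem_univ i)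
  rw [Finset.mem_Icc]
  omega

lemma localAlgebra_mono {M L : ℕ} (h : M ≤ L) : localAlgebra d M ≤ localAlgebra d L :=
  StarSubalgebra.centralizer_le _ _ _ fun _ ⟨x, hx, hA⟩ => ⟨x, fun h' => hx (box_mono h h'), hA⟩

/-- The description of locality by a commutant gives closedness at once, which is what limits of
Dyson series require. -/
lemma isClosed_localAlgebra (M : ℕ) : IsClosed (localAlgebra d M : Set (U d)) :=
  Set.isClosed_centralizer _

lemma zero_mem_box (M : ℕ) : (0 : Site d) ∈ box d M :=
  Fintype.mem_piFinset.2 fun _ => by simp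

/-- The local elements are dense. -/
lemma dense_localAlgebra : Dense {A : U d | ∃ M, A ∈ localAlgebra d M} := by
  let R : StarSubalgebra ℂ (U d) :=
    { carrier := {A : U d | ∃ M, A ∈ localAlgebra d M}
      mul_mem' := by
        rintro A B ⟨M, hA⟩ ⟨N, hB⟩
        exact ⟨max M N, mul_mem (localAlgebra_mono (le_max_left _ _) hA)
          (localAlgebra_mono (le_max_right _ _) hB)⟩
      add_mem' := by
        rintro A B ⟨M, hA⟩ ⟨N, hB⟩
        exact ⟨max M N, add_mem (localAlgebra_mono (le_max_left _ _) hA)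
          (localAlgebra_mono (le_max_right _ _) hB)⟩
      algebraMap_mem' := fun r => ⟨0, algebraMap_mem _ r⟩
      star_mem' := by
        rintro A ⟨M, hA⟩
        exact ⟨M, star_mem hA⟩ }
  refine dense_of_carAnn_mem R fun m => ?_
  obtain ⟨M, hM⟩ := exists_mem_box (ofLex (ofLex m).1)
  refine ⟨M, wordSpan_le_localAlgebra hM ?_⟩
  have := word_mem_wordSpan (a (ofLex (ofLex m).1 : Site d)) (fun _ => True)
    [((ofLex m).2, false)] trivial
  simpa [carGen, a] using this

end Lattice

/-! ### The approximating dynamics on local elements. -/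

section ApproxGenerator

variable {d : ℕ} (p : Params)

lemma approxHamiltonian_eq (L : ℕ) (c : ℂ) :
    approxHamiltonian d p L c = ∑ x ∈ box d L, localHam p c (a x) := rfl

lemma approxGenerator_apply (L : ℕ) (c : ℂ) (A : U d) :
    approxGenerator d p L c A = Complex.I •
      (approxHamiltonian d p L c * A - A * approxHamiltonian d p L c) := rfl

lemma approxGenerator_eq_sum (L : ℕ) (c : ℂ) (A : U d) :
    approxGenerator d p L c A = Complex.I •
      ∑ x ∈ box d L, (localHam p c (a x) * A - A * localHam p c (a x)) := by
  rw [approxGenerator_apply, approxHamiltonian_eq, Finset.sum_mul, Finset.mul_sum,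
    Finset.sum_sub_distrib]

/-- The approximating Hamiltonian is a sum of even on-site terms, and those outside `Λ_M` commute
with `A`. There is no propagation between sites. -/
lemma approxGenerator_eq_of_le {M L : ℕ} (h : M ≤ L) (c : ℂ) {A : U d}
    (hA : A ∈ localAlgebra d M) : approxGenerator d p L c A = approxGenerator d p M c A := by
  rw [approxGenerator_eq_sum, approxGenerator_eq_sum, Finset.sum_subset (box_mono h)]
  intro x _ hx
  exact sub_eq_zero.2 (commute_of_mem_localAlgebra hA hx (localHam_mem_wordSpan p c (a x))).eq

lemma approxHamiltonian_mem (L : ℕ) (c : ℂ) : approxHamiltonian d p L c ∈ localAlgebra d L :=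
  sum_mem fun x hx => wordSpan_le_localAlgebra hx
    (wordSpan_mono _ (fun _ _ => trivial) (localHam_mem_wordSpan p c (a x)))

lemma approxGenerator_mem {M : ℕ} (c : ℂ) {A : U d} (hA : A ∈ localAlgebra d M) :
    approxGenerator d p M c A ∈ localAlgebra d M :=
  (localAlgebra d M).smul_mem (sub_mem (mul_mem (approxHamiltonian_mem p M c) hA)
    (mul_mem hA (approxHamiltonian_mem p M c))) _

/-- On the algebra of a site only the term of this site matters. -/
lemma approxGenerator_site {L : ℕ} {x : Site d} (hx : x ∈ box d L) (c : ℂ) {A : U d}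
    (hA : A ∈ wordSpan (a x) fun _ => True) :
    approxGenerator d p L c A
      = Complex.I • (localHam p c (a x) * A - A * localHam p c (a x)) := by
  rw [approxGenerator_eq_sum, Finset.sum_eq_single_of_mem x hx]
  intro y _ hyx
  exact sub_eq_zero.2 (commute_of_mem_wordSpan hyx (localHam_mem_wordSpan p c (a y)) hA).eq

lemma continuous_sub_smul_add {A : Type*} [NormedRing A] [NormedAlgebra ℂ A] {c : ℝ → ℂ}
    (hc : Continuous c) (g : ℂ) (X Y Z : A) :
    Continuous fun r => X - g • (c r • Y + star (c r) • Z) := by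
  have h1 : Continuous fun r => c r • Y := hc.smul continuous_const
  have h2 : Continuous fun r => star (c r) • Z := hc.star.smul continuous_const
  exact continuous_const.sub ((h1.add h2).const_smul g)

lemma continuous_commutator {A : Type*} [NormedRing A] [NormedAlgebra ℂ A] {H : ℝ → A}
    (hH : Continuous H) :
    Continuous fun r => Complex.I • (ContinuousLinearMap.mul ℂ A (H r)
      - (ContinuousLinearMap.mul ℂ A).flip (H r)) :=
  (((ContinuousLinearMap.mul ℂ A).continuous.comp hH).sub
    ((ContinuousLinearMap.mul ℂ A).flip.continuous.comp hH)).const_smul Complex.I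

lemma continuous_approxGenerator (L : ℕ) {c : ℝ → ℂ} (hc : Continuous c) :
    Continuous fun r => approxGenerator d p L (c r) :=
  continuous_commutator (continuous_finsetSum _ fun _ _ => continuous_sub_smul_add hc _ _ _ _)

lemma dysonTerm_eq (L : ℕ) (c : ℝ → ℂ) (s : ℝ) (k : ℕ) :
    dysonTerm d p L c s k = dysonSeries (fun r => approxGenerator d p L (c r)) s k := by
  induction k with
  | zero => rfl
  | succ k ih =>
    funext t
    simp only [dysonTerm, dysonSeries, ih]
    rfl

lemma approxTau_eq (L : ℕ) (c : ℝ → ℂ) (t s : ℝ) :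
    approxTau d p L c t s = ∑' k, dysonSeries (fun r => approxGenerator d p L (c r)) s k t := by
  simp only [approxTau, dysonTerm_eq]

lemma approxTau_self (L : ℕ) (c : ℝ → ℂ) (s : ℝ) : approxTau d p L c s s = 1 := by
  rw [approxTau_eq]
  exact tsum_dysonSeries_self s

lemma hasDerivAt_approxTau (L : ℕ) {c : ℝ → ℂ} (hc : Continuous c) (t s : ℝ) (A : U d) :
    HasDerivAt (fun t => approxTau d p L c t s A)
      (approxTau d p L c t s (approxGenerator d p L (c t) A)) t := by
  simp only [approxTau_eq]
  exact hasDerivAt_tsum_dysonSeries_apply (continuous_approxGenerator p L hc) s t A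

/-- A closed subspace of pairs that is invariant under the generators is invariant under the
dynamics. -/
lemma approxTau_mem_pair (L : ℕ) {c : ℝ → ℂ} (hc : Continuous c) {R : Submodule ℂ (U d × U d)}
    (hR : IsClosed (R : Set (U d × U d)))
    (hinv : ∀ z ∈ R, ∀ r, (approxGenerator d p L (c r) z.1, approxGenerator d p L (c r) z.2) ∈ R)
    {z : U d × U d} (hz : z ∈ R) (t s : ℝ) :
    (approxTau d p L c t s z.1, approxTau d p L c t s z.2) ∈ R := by
  rw [approxTau_eq]
  exact tsum_dysonSeries_mem_pair (continuous_approxGenerator p L hc) s hR hinv hz t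

lemma approxTau_mem (L : ℕ) {c : ℝ → ℂ} (hc : Continuous c) {R : Submodule ℂ (U d)}
    (hR : IsClosed (R : Set (U d))) (hinv : ∀ A ∈ R, ∀ r, approxGenerator d p L (c r) A ∈ R)
    {A : U d} (hA : A ∈ R) (t s : ℝ) : approxTau d p L c t s A ∈ R := by
  -- A single subspace is treated as its preimage under the first projection, with an irrelevant
  -- second component.
  have := approxTau_mem_pair p L hc (R := R.comap (LinearMap.fst ℂ (U d) (U d)))
    (hR.preimage continuous_fst) (fun z hz r => hinv z.1 hz r) (z := (A, 0)) hA t s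
  exact this

lemma approxTau_mem_localAlgebra (M : ℕ) {c : ℝ → ℂ} (hc : Continuous c) {A : U d}
    (hA : A ∈ localAlgebra d M) (t s : ℝ) : approxTau d p M c t s A ∈ localAlgebra d M :=
  approxTau_mem p M hc (R := Subalgebra.toSubmodule (localAlgebra d M).toSubalgebra)
    (isClosed_localAlgebra M) (fun _ h _ => approxGenerator_mem p _ h) hA t s

/-- On local elements the finite-volume dynamics does not depend on the volume. -/
lemma approxTau_eq_of_le {M L : ℕ} (h : M ≤ L) {c : ℝ → ℂ} (hc : Continuous c) {A : U d}
    (hA : A ∈ localAlgebra d M) (t s : ℝ) :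
    approxTau d p L c t s A = approxTau d p M c t s A := by
  rw [approxTau_eq, approxTau_eq]
  exact tsum_dysonSeries_congr (continuous_approxGenerator p M hc) s
    (continuous_approxGenerator p L hc) (R := localAlgebra d M)
    (fun _ hv _ => approxGenerator_mem p _ hv) (fun _ hv _ => approxGenerator_eq_of_le p h _ hv) hA t

/-- On local elements the sequence of finite-volume evolutions is eventually constant, for every
continuous field. -/
lemma approxTauInf_eq {M : ℕ} {c : ℝ → ℂ} (hc : Continuous c) {A : U d}
    (hA : A ∈ localAlgebra d M) (t s : ℝ) :
    approxTauInf p c t s A = approxTau d p M c t s A :=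
  (tendsto_const_nhds.congr' ((eventually_ge_atTop M).mono fun _ hL =>
    (approxTau_eq_of_le p hL hc hA t s).symm)).limUnder_eq

end ApproxGenerator

end CooperField
end

noncomputable section

/-! ### Unitary groups, propagators and Duhamel's formula in a `C*`-algebra. -/

section CStarDynamics

variable {A : Type} [CStarAlgebra A]

/-- The generator `i [H, ·]`. -/
def commGenerator (H : A) : A →L[ℂ] A :=
  Complex.I • (ContinuousLinearMap.mul ℂ A H - (ContinuousLinearMap.mul ℂ A).flip H)

lemma commGenerator_apply (H X : A) : commGenerator H X = Complex.I • (H * X - X * H) := rfl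

lemma exp_add_of_commute_cstar {x y : A} (h : Commute x y) :
    NormedSpace.exp (x + y) = NormedSpace.exp x * NormedSpace.exp y := by
  let _ : NormedAlgebra ℚ A := NormedAlgebra.restrictScalars ℚ ℂ A
  exact NormedSpace.exp_add_of_commute h

lemma semiconjBy_exp_cstar {x a b : A} (h : SemiconjBy x a b) :
    SemiconjBy x (NormedSpace.exp a) (NormedSpace.exp b) := by
  let _ : NormedAlgebra ℚ A := NormedAlgebra.restrictScalars ℚ ℂ A
  exact h.exp_right

/-- The one-parameter group `e^{itH}`. -/
def expGroup (H : A) (t : ℝ) : A := NormedSpace.exp ((Complex.I * t) • H)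

@[simp] lemma expGroup_zero (H : A) : expGroup H 0 = 1 := by simp [expGroup]

lemma expGroup_neg_eq (H : A) (t : ℝ) :
    NormedSpace.exp (-((Complex.I * t) • H)) = expGroup H (-t) := by
  simp [expGroup]

lemma expGroup_mul_neg (H : A) (t : ℝ) : expGroup H t * expGroup H (-t) = 1 := by
  rw [← expGroup_neg_eq, expGroup, ← exp_add_of_commute_cstar (Commute.refl _).neg_right]
  simp

lemma expGroup_neg_mul (H : A) (t : ℝ) : expGroup H (-t) * expGroup H t = 1 := by
  simpa using expGroup_mul_neg H (-t)

lemma star_expGroup {H : A} (hH : star H = H) (t : ℝ) : star (expGroup H t) = expGroup H (-t) := by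
  rw [expGroup, NormedSpace.star_exp, ← expGroup_neg_eq]
  simp [hH]

lemma expGroup_mem_unitary {H : A} (hH : star H = H) (t : ℝ) : expGroup H t ∈ unitary A := by
  rw [Unitary.mem_iff, star_expGroup hH]
  exact ⟨expGroup_neg_mul H t, expGroup_mul_neg H t⟩

lemma hasDerivAt_expGroup (H : A) (t : ℝ) :
    HasDerivAt (expGroup H) (Complex.I • (expGroup H t * H)) t := by
  have h := hasDerivAt_exp_smul_const (𝕂 := ℝ) (Complex.I • H) t
  have e (t : ℝ) : NormedSpace.exp (t • Complex.I • H) = expGroup H t := by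
    rw [expGroup, ← Complex.coe_smul, smul_smul, mul_comm]
  simp only [e, mul_smul_comm] at h
  exact h

lemma commute_expGroup {H X : A} (h : Commute X H) (t : ℝ) : Commute X (expGroup H t) :=
  (h.smul_right _).exp_right

lemma hasDerivAt_expGroup_neg (H : A) (t : ℝ) :
    HasDerivAt (fun t => expGroup H (-t)) (-(Complex.I • (H * expGroup H (-t)))) t := by
  have h := (hasDerivAt_expGroup H (-t)).scomp t (hasDerivAt_neg t)
  simp only [neg_smul, one_smul] at h
  rwa [(commute_expGroup (Commute.refl H) (-t)).eq]

/-- If `[H, B] = N B` with `N` commuting with `H`, then `e^{itH} B e^{-itH} = e^{itN} B`. -/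
lemma expGroup_mul_mul_neg {H B N : A} (hB : H * B = B * H + N * B) (hN : Commute N H) (t : ℝ) :
    expGroup H t * B * expGroup H (-t) = expGroup N t * B := by
  -- The hypothesis reads `B H = (H - N) B`: `B` intertwines `H` with `H - N`, and hence their
  -- exponentials.
  have h1 : SemiconjBy B ((Complex.I * t) • H) ((Complex.I * t) • H - (Complex.I * t) • N) := by
    rw [SemiconjBy, mul_smul_comm, ← smul_sub, smul_mul_assoc, sub_mul, hB, add_sub_cancel_right]
  have h2 := semiconjBy_exp_cstar h1
  have h3 : NormedSpace.exp ((Complex.I * t) • H) = expGroup N t *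
      NormedSpace.exp ((Complex.I * t) • H - (Complex.I * t) • N) := by
    rw [expGroup, ← exp_add_of_commute_cstar]
    · rw [add_sub_cancel]
    · exact ((hN.smul_left _).smul_right _).sub_right (Commute.refl _)
  rw [expGroup, h3, mul_assoc (expGroup N t), ← h2.eq, mul_assoc, mul_assoc,
    show NormedSpace.exp ((Complex.I * t) • H) = expGroup H t from rfl, expGroup_mul_neg, mul_one]

/-- The operator `X ↦ V X V'`. -/
def sandwich (V V' : A) : A →L[ℂ] A :=
  ContinuousLinearMap.mul ℂ A V * (ContinuousLinearMap.mul ℂ A).flip V'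

lemma sandwich_apply (V V' X : A) : sandwich V V' X = V * (X * V') := rfl

lemma HasDerivAt.sandwich {V V' : ℝ → A} {v v' : A} {t : ℝ} (h : HasDerivAt V v t)
    (h' : HasDerivAt V' v' t) :
    HasDerivAt (fun t => sandwich (V t) (V' t)) (sandwich v (V' t) + sandwich (V t) v') t :=
  (((ContinuousLinearMap.mul ℂ A).restrictScalars ℝ).hasFDerivAt.comp_hasDerivAt t h).mul
    ((((ContinuousLinearMap.mul ℂ A).flip).restrictScalars ℝ).hasFDerivAt.comp_hasDerivAt t h')

variable {W Hf : ℝ → A} (hHf : Continuous Hf) (hsa : ∀ t, star (Hf t) = Hf t)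
  (hW : ∀ t, HasDerivAt W (Complex.I • (W t * Hf t)) t) (hu : ∀ t, W t ∈ unitary A)

include hsa hW in
lemma hasDerivAt_star_of_unitary_evolution (t : ℝ) :
    HasDerivAt (fun t => star (W t)) (-(Complex.I • (Hf t * star (W t)))) t := by
  have := (hW t).star
  rwa [star_smul, star_mul, hsa, Complex.star_def, Complex.conj_I, neg_smul] at this

include hHf hsa hW hu in
/-- The Dyson series of the generators `i [H(t), ·]` is implemented by the unitary propagator. -/
lemma tsum_dysonSeries_commGenerator (s t : ℝ) (X : A) :
    (∑' k, dysonSeries (fun r => commGenerator (Hf r)) s k t) X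
      = star (W s) * W t * X * star (W t) * W s := by
  have hu1 (t) : star (W t) * W t = 1 := (Unitary.mem_iff.1 (hu t)).1
  have hu2 (t) : W t * star (W t) = 1 := (Unitary.mem_iff.1 (hu t)).2
  have hδ : Continuous fun r => commGenerator (Hf r) := by
    unfold commGenerator
    fun_prop
  have h1 (t) := (hasDerivAt_star_of_unitary_evolution hsa hW t).mul_const (W s)
  have h2 (t) := (hW t).const_mul (star (W s))
  -- `S'` is conjugation by the inverse unitary, so it inverts `S` and solves the adjoint equation
  -- `S'' = -δ S'`, where the second prime is the time derivative.
  have key := tsum_dysonSeries_eq hδ s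
    (S := fun t => sandwich (star (W s) * W t) (star (W t) * W s))
    (S' := fun t => sandwich (star (W t) * W s) (star (W s) * W t)) ?_ ?_ ?_ t
  · have := congrArg (fun T : A →L[ℂ] A => T X) key
    simpa only [sandwich_apply, mul_assoc] using this
  · intro t
    convert! (h1 t).sandwich (h2 t) using 1
    ext Y
    change -commGenerator (Hf t) (sandwich _ _ Y) = sandwich _ _ Y + sandwich _ _ Y
    simp only [commGenerator_apply, sandwich_apply, mul_smul_comm, smul_mul_assoc, neg_mul,
      mul_assoc]
    rw [← smul_neg, ← smul_neg, ← smul_add]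
    congr 1
    abel
  · intro t
    ext Y
    change sandwich _ _ (sandwich _ _ Y) = Y
    simp only [sandwich_apply]
    calc star (W t) * W s * (star (W s) * W t * (Y * (star (W t) * W s)) * (star (W s) * W t))
        = star (W t) * (W s * star (W s)) * W t * Y * (star (W t) * (W s * star (W s)) * W t) := by
          simp only [mul_assoc]
      _ = Y := by simp [hu1, hu2]
  · ext Y
    change sandwich _ _ Y = Y
    simp [sandwich_apply, hu1]

include hsa hW hu in
/-- Duhamel's formula, as an estimate in terms of a functional. -/
lemma norm_duhamel_le {H : A} (f : A →L[ℂ] ℂ) (X : A) (t C : ℝ) (hW0 : W 0 = 1)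
    (hC : ∀ r, |r| ≤ |t| → ‖f (expGroup H r * ((H - Hf r) * (star (W r) * W t * X * star (W t) * W r)
      - (star (W r) * W t * X * star (W t) * W r) * (H - Hf r)) * expGroup H (-r))‖ ≤ C) :
    ‖f (expGroup H t * X * expGroup H (-t)) - f (W t * X * star (W t))‖ ≤ C * |t| := by
  have hu1 (t) : star (W t) * W t = 1 := (Unitary.mem_iff.1 (hu t)).1
  set Y := W t * X * star (W t) with hY
  -- `F` interpolates between `W(t) X W(t)*` at `r = 0` and `e^{itH} X e^{-itH}` at `r = t`; its
  -- derivative contains only the difference `H - Hf r`.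
  set F : ℝ → A := fun r => (expGroup H r * star (W r)) * Y * (W r * expGroup H (-r)) with hF
  have hd : ∀ r, HasDerivAt F (Complex.I • (expGroup H r * ((H - Hf r) * (star (W r) * Y * W r)
      - (star (W r) * Y * W r) * (H - Hf r)) * expGroup H (-r))) r := by
    intro r
    have h1 := (hasDerivAt_expGroup H r).mul (hasDerivAt_star_of_unitary_evolution hsa hW r)
    have h2 := (hW r).mul (hasDerivAt_expGroup_neg H r)
    convert! (h1.mul_const Y).mul h2 using 1
    simp only [Pi.mul_apply, smul_mul_assoc, mul_smul_comm, mul_neg, neg_mul, sub_mul, mul_sub,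
      add_mul, mul_add, mul_assoc, ← smul_neg, ← smul_add]
    congr 1
    abel
  have hd' : ∀ r, HasDerivAt (fun r => f (F r)) (f (Complex.I • (expGroup H r *
      ((H - Hf r) * (star (W r) * Y * W r)
      - (star (W r) * Y * W r) * (H - Hf r)) * expGroup H (-r)))) r := fun r =>
    (f.restrictScalars ℝ).hasFDerivAt.comp_hasDerivAt r (hd r)
  have hb := (convex_uIcc (0 : ℝ) t).norm_image_sub_le_of_norm_hasDerivWithin_le
    (f := fun r => f (F r)) (C := C) (fun r _ => (hd' r).hasDerivWithinAt) ?_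
    Set.left_mem_uIcc Set.right_mem_uIcc
  · have e1 : F t = expGroup H t * X * expGroup H (-t) := by
      calc F t = expGroup H t * (star (W t) * W t) * X * (star (W t) * W t) * expGroup H (-t) := by
            simp only [hF, hY, mul_assoc]
        _ = _ := by simp [hu1]
    have e2 : F 0 = Y := by simp [hF, hW0]
    simpa [e1, e2] using hb
  · intro r hr
    have hr' : |r| ≤ |t| := by simpa using Set.abs_sub_left_of_mem_uIcc hr
    have := hC r hr'
    rw [map_smul, norm_smul, Complex.norm_I, one_mul]
    have e : star (W r) * Y * W r = star (W r) * W t * X * star (W t) * W r := by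
      simp only [hY, mul_assoc]
    rw [e]
    exact this

/-- The Gelfand–Naimark–Segal space of a positive functional. -/
lemma exists_gns (ρ : A →L[ℂ] ℂ) (hρ : ∀ B, 0 ≤ ρ (star B * B)) :
    ∃ (V : Type) (_ : NormedAddCommGroup V) (_ : InnerProductSpace ℂ V) (η : A →L[ℂ] V),
      (∀ X Y, inner ℂ (η X) (η Y) = ρ (star X * Y)) ∧ ∀ X Y, ‖η (X * Y)‖ ≤ ‖X‖ * ‖η Y‖ := by
  let _ := CStarAlgebra.spectralOrder A
  have := CStarAlgebra.spectralOrderedRing A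
  let f : A →ₚ[ℂ] ℂ := PositiveLinearMap.mk₀ ρ.toLinearMap (by
    intro x hx
    obtain ⟨b, rfl⟩ := CStarAlgebra.nonneg_iff_eq_star_mul_self.1 hx
    exact hρ b)
  have hmul : ∀ X Y : A, ‖f.toPreGNS (X * Y)‖ ≤ ‖X‖ * ‖f.toPreGNS Y‖ := fun X Y => by
    have h := (f.leftMulMapPreGNS X).le_opNorm (f.toPreGNS Y)
    have h2 : ‖f.leftMulMapPreGNS X‖ ≤ ‖X‖ := LinearMap.mkContinuous_norm_le _ (norm_nonneg _) _
    exact h.trans (mul_le_mul_of_nonneg_right h2 (norm_nonneg _))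
  let η₀ : A →L[ℂ] f.PreGNS := f.toPreGNS.toLinearMap.mkContinuous ‖f.toPreGNS 1‖ (fun X => by
    have := hmul X 1
    rw [mul_one, mul_comm] at this
    exact this)
  -- Passing to the completion also identifies vectors at distance zero, which turns the seminorm
  -- into a norm.
  let j : f.PreGNS →L[ℂ] f.GNS := UniformSpace.Completion.toComplL
  refine ⟨f.GNS, inferInstance, inferInstance, j.comp η₀, ?_, ?_⟩
  · intro X Y
    exact UniformSpace.Completion.inner_coe _ _
  · intro X Y
    have (Z : A) : ‖(j.comp η₀) Z‖ = ‖f.toPreGNS Z‖ := UniformSpace.Completion.norm_coe _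
    rw [this, this]
    exact hmul X Y

/-! ### Fluctuations in the GNS seminorm. -/

section Seminorm

variable {V : Type} [NormedAddCommGroup V] [InnerProductSpace ℂ V] {η : A →L[ℂ] V}
  (hη : ∀ X Y, ‖η (X * Y)‖ ≤ ‖X‖ * ‖η Y‖)

lemma norm_le_one_of_mem_unitary {U : A} (h : U ∈ unitary A) : ‖U‖ ≤ 1 := by
  rcases subsingleton_or_nontrivial A with _ | _
  · rw [Subsingleton.elim U 0]; simp
  · exact (CStarRing.norm_of_mem_unitary h).le

include hη in
-- The derivative of `e^{irD}` is `i e^{irD} D`, and the unitary on the left is a contraction for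
-- the seminorm. It matters that only `‖η D‖` enters: a fluctuation is small in the state, not in
-- operator norm.
lemma norm_expGroup_sub_one_le {D : A} (hD : star D = D) (t : ℝ) :
    ‖η (expGroup D t - 1)‖ ≤ |t| * ‖η D‖ := by
  have hd : ∀ r, HasDerivAt (fun r => η (expGroup D r)) (η (Complex.I • (expGroup D r * D))) r :=
    fun r => (η.restrictScalars ℝ).hasFDerivAt.comp_hasDerivAt r (hasDerivAt_expGroup D r)
  have hb := (convex_univ (𝕜 := ℝ) (E := ℝ)).norm_image_sub_le_of_norm_hasDerivWithin_le
    (f := fun r => η (expGroup D r)) (C := ‖η D‖) (x := 0) (y := t)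
    (fun r _ => (hd r).hasDerivWithinAt) ?_ (Set.mem_univ _) (Set.mem_univ _)
  · simpa [mul_comm] using hb
  · intro r _
    rw [map_smul, norm_smul, Complex.norm_I, one_mul]
    refine (hη _ _).trans ?_
    have := norm_le_one_of_mem_unitary (expGroup_mem_unitary hD r)
    nlinarith [norm_nonneg (η D)]

include hη in
/-- The evolution of the fluctuation of `B`, when `e^{itH} B e^{-itH} = e^{itN} B`. -/
lemma norm_evolved_fluctuation_le {H B N : A} (hN : star N = N)
    (hB : H * B = B * H + N * B) (hNH : Commute N H) (c : ℂ) (ν t : ℝ) :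
    ‖η (expGroup H t * (B - (c * Complex.exp (Complex.I * ν * t)) • (1 : A)) * expGroup H (-t))‖
      ≤ ‖η (B - c • (1 : A))‖ + ‖c‖ * (|t| * ‖η (N - (ν : ℂ) • (1 : A))‖) := by
  set D := N - (ν : ℂ) • (1 : A) with hDdef
  have hD : star D = D := by simp [hDdef, hN]
  have hND : expGroup N t = Complex.exp (Complex.I * ν * t) • expGroup D t := by
    have : (Complex.I * t) • N = (Complex.I * t) • D + algebraMap ℂ A (Complex.I * ν * t) := by
      rw [hDdef, Algebra.algebraMap_eq_smul_one]
      module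
    rw [expGroup, this, exp_add_of_commute_cstar (Algebra.commutes _ _).symm,
      ← NormedSpace.algebraMap_exp_comm, ← Complex.exp_eq_exp_ℂ, ← Algebra.commutes,
      ← Algebra.smul_def]
    rfl
  -- With `e^{itN} = e^{iνt} e^{itD}`, the evolved fluctuation `e^{itN} B - c e^{iνt}` splits into
  -- the initial fluctuation of `B`, multiplied by a unitary, and the dephasing `e^{itD} - 1`.
  have e : expGroup H t * (B - (c * Complex.exp (Complex.I * ν * t)) • (1 : A)) * expGroup H (-t)
      = expGroup N t * (B - c • (1 : A))
        + (c * Complex.exp (Complex.I * ν * t)) • (expGroup D t - 1) := by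
    rw [mul_sub, sub_mul, expGroup_mul_mul_neg hB hNH, mul_smul_comm, mul_one, smul_mul_assoc,
      expGroup_mul_neg, mul_sub, mul_smul_comm, mul_one]
    nth_rw 3 [hND]
    module
  rw [e, map_add]
  refine (norm_add_le _ _).trans (add_le_add ?_ ?_)
  · refine (hη _ _).trans ?_
    have := norm_le_one_of_mem_unitary (expGroup_mem_unitary hN t)
    nlinarith [norm_nonneg (η (B - c • (1 : A)))]
  · rw [map_smul, norm_smul, norm_mul, show ‖Complex.exp (Complex.I * ν * t)‖ = 1 by
      rw [Complex.norm_exp]; simp, mul_one]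
    exact mul_le_mul_of_nonneg_left (norm_expGroup_sub_one_le hη hD t) (norm_nonneg _)

end Seminorm

end CStarDynamics
end

noncomputable section
namespace CooperField

/-! ### Extensive observables and the commutation relations of the Hamiltonians. -/

section Totals

variable {d : ℕ}

/-- Distinct sites commute, the first family being even, so only the diagonal of the double sum
survives and every relation for totals reduces to one site. -/
lemma commutator_sum_sum (L : ℕ) {f g : Site d → U d} (hf : ∀ x, f x ∈ wordSpan (a x) Even)
    (hg : ∀ x, g x ∈ wordSpan (a x) fun _ => True) :
    (∑ x ∈ box d L, f x) * (∑ x ∈ box d L, g x) - (∑ x ∈ box d L, g x) * (∑ x ∈ box d L, f x)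
      = ∑ x ∈ box d L, (f x * g x - g x * f x) := by
  rw [Finset.sum_mul_sum, Finset.sum_mul_sum, Finset.sum_comm, ← Finset.sum_sub_distrib]
  refine Finset.sum_congr rfl fun x hx => ?_
  rw [← Finset.sum_sub_distrib, Finset.sum_eq_single_of_mem x hx]
  intro y _ hyx
  exact sub_eq_zero.2 (commute_of_mem_wordSpan hyx (hf y) (hg x)).eq

lemma word_two_mem (x : Site d) (g g' : Spin × Bool) :
    carGen (a x) g * carGen (a x) g' ∈ wordSpan (a x) Even := by
  simpa using word_mem_wordSpan (a x) Even [g, g'] (by simp)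

lemma mem_wordSpan_true {x : Site d} {A : U d} (h : A ∈ wordSpan (a x) Even) :
    A ∈ wordSpan (a x) fun _ => True :=
  wordSpan_mono _ (fun _ _ => trivial) h

lemma pair_mem (x : Site d) : a x dn * a x up ∈ wordSpan (a x) Even :=
  word_two_mem x (dn, false) (up, false)

lemma star_pair_mem (x : Site d) : star (a x up) * star (a x dn) ∈ wordSpan (a x) Even :=
  word_two_mem x (up, true) (dn, true)

lemma num_mem (x : Site d) : num x up + num x dn ∈ wordSpan (a x) Even :=
  Submodule.add_mem _ (word_two_mem x (up, true) (up, false))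
    (word_two_mem x (dn, true) (dn, false))

variable (d) in
/-- The total pair annihilation operator of the box. -/
def totalPair (L : ℕ) : U d := ∑ x ∈ box d L, a x dn * a x up

variable (d) in
/-- The total particle number of the box. -/
def totalNum (L : ℕ) : U d := ∑ x ∈ box d L, (num x up + num x dn)

variable (d) in
/-- The sum of the on-site terms of the box. -/
def totalOnSite (p : Params) (L : ℕ) : U d := ∑ x ∈ box d L, onSite p x

lemma star_totalPair (L : ℕ) :
    star (totalPair d L) = ∑ x ∈ box d L, star (a x up) * star (a x dn) := by
  simp only [totalPair, star_sum, star_mul]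

lemma star_totalNum (L : ℕ) : star (totalNum d L) = totalNum d L := by
  simp only [totalNum, star_sum, star_add, num, star_mul, star_star]

/-- Makes the commutators of `localHam` available for the on-site term, with the pairing switched
off. -/
lemma onSite_eq (p : Params) (x : Site d) :
    onSite p x = localHam { p with gam := 0 } 0 (a x) := by
  simp [localHam, onSite, num]

lemma star_totalOnSite (p : Params) (L : ℕ) : star (totalOnSite d p L) = totalOnSite d p L := by
  rw [totalOnSite, star_sum]
  refine Finset.sum_congr rfl fun x _ => ?_
  rw [onSite_eq, (isCar_a x).star_localHam]

lemma onSite_mem (p : Params) (x : Site d) : onSite p x ∈ wordSpan (a x) Even := by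
  rw [onSite_eq]
  exact localHam_mem_wordSpan _ _ _

lemma totalNum_commutator_pair (L : ℕ) :
    totalNum d L * totalPair d L = totalPair d L * totalNum d L + (-2 : ℂ) • totalPair d L := by
  rw [← sub_eq_iff_eq_add', totalNum, totalPair,
    commutator_sum_sum L num_mem (fun x => mem_wordSpan_true (pair_mem x)), Finset.smul_sum]
  refine Finset.sum_congr rfl fun x _ => ?_
  rw [add_mul, mul_add, num, num, (isCar_a x).num_mul_pair up, (isCar_a x).num_mul_pair dn]
  module

lemma totalNum_commutator_star_pair (L : ℕ) :
    totalNum d L * star (totalPair d L)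
      = star (totalPair d L) * totalNum d L + (2 : ℂ) • star (totalPair d L) := by
  have h := congrArg star (totalNum_commutator_pair (d := d) L)
  simp only [star_mul, star_add, star_smul, star_totalNum, Complex.star_def, map_neg,
    Complex.conj_ofNat] at h
  rw [h]
  module

lemma totalOnSite_commutator_pair (p : Params) (L : ℕ) :
    totalOnSite d p L * totalPair d L
      = totalPair d L * totalOnSite d p L + (2 * (p.mu - p.lam) : ℂ) • totalPair d L := by
  rw [← sub_eq_iff_eq_add', totalOnSite, totalPair,
    commutator_sum_sum L (onSite_mem p) (fun x => mem_wordSpan_true (pair_mem x)), Finset.smul_sum]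
  refine Finset.sum_congr rfl fun x _ => ?_
  rw [onSite_eq, (isCar_a x).localHam_commutator_pair]
  simp

lemma commute_totalNum_totalOnSite (p : Params) (L : ℕ) :
    Commute (totalNum d L) (totalOnSite d p L) := by
  rw [Commute, SemiconjBy, ← sub_eq_zero, ← neg_eq_zero, neg_sub, totalNum, totalOnSite,
    commutator_sum_sum L (onSite_mem p) (fun x => mem_wordSpan_true (num_mem x))]
  refine Finset.sum_eq_zero fun x _ => ?_
  rw [onSite_eq, num, num, (isCar_a x).localHam_commutator_num]
  simp

lemma star_totalPair_commutator (L : ℕ) :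
    star (totalPair d L) * totalPair d L - totalPair d L * star (totalPair d L)
      = totalNum d L - ((box d L).card : ℂ) • (1 : U d) := by
  rw [star_totalPair, totalPair, commutator_sum_sum L star_pair_mem
    (fun x => mem_wordSpan_true (pair_mem x)), totalNum]
  rw [Finset.sum_congr rfl fun x _ => (isCar_a x).star_pair_mul_pair, Finset.sum_sub_distrib]
  congr 1
  rw [Finset.sum_const, ← Nat.cast_smul_eq_nsmul ℂ]

lemma approxHamiltonian_eq_total (p : Params) (L : ℕ) (c : ℂ) :
    approxHamiltonian d p L c = totalOnSite d p L
      - (p.gam : ℂ) • (c • star (totalPair d L) + star c • totalPair d L) := by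
  rw [star_totalPair, approxHamiltonian, totalOnSite, totalPair, Finset.sum_sub_distrib,
    Finset.smul_sum, Finset.smul_sum, ← Finset.sum_add_distrib, Finset.smul_sum]

lemma hamiltonian_eq_total (p : Params) (L : ℕ) :
    hamiltonian d p L = totalOnSite d p L
      - ((p.gam / (box d L).card : ℝ) : ℂ) • (star (totalPair d L) * totalPair d L) := by
  rw [star_totalPair, hamiltonian, totalOnSite, totalPair, Finset.sum_mul_sum]

lemma star_approxHamiltonian (p : Params) (L : ℕ) (c : ℂ) :
    star (approxHamiltonian d p L c) = approxHamiltonian d p L c := by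
  rw [approxHamiltonian_eq, star_sum]
  exact Finset.sum_congr rfl fun x _ => (isCar_a x).star_localHam p c

lemma star_hamiltonian (p : Params) (L : ℕ) :
    star (hamiltonian d p L) = hamiltonian d p L := by
  rw [hamiltonian_eq_total, star_sub, star_totalOnSite, star_smul, star_mul, star_star,
    Complex.star_def, Complex.conj_ofReal]

variable (d) in
/-- The operator of the rotation frequency of the Cooper field in the box. -/
def freqOp (p : Params) (L : ℕ) : U d :=
  (2 * (p.mu - p.lam) + p.gam : ℂ) • (1 : U d)
    - ((p.gam / (box d L).card : ℝ) : ℂ) • totalNum d L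

lemma star_freqOp (p : Params) (L : ℕ) : star (freqOp d p L) = freqOp d p L := by
  simp [freqOp, star_totalNum]

lemma card_box_pos (L : ℕ) : 0 < (box d L).card := Finset.card_pos.2 ⟨0, zero_mem_box L⟩

/-- The on-site part contributes `2(μ - λ) B`, and the interaction contributes `-(γ/|Λ|) [B*, B] B`
with `[B*, B] = N - |Λ|`. This exact relation makes the mean-field dynamics of the pair average
solvable in finite volume. -/
lemma hamiltonian_mul_totalPair (p : Params) (L : ℕ) :
    hamiltonian d p L * totalPair d L
      = totalPair d L * hamiltonian d p L + freqOp d p L * totalPair d L := by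
  have h1 := totalOnSite_commutator_pair (d := d) p L
  have h2 : star (totalPair d L) * totalPair d L * totalPair d L
      = totalNum d L * totalPair d L - ((box d L).card : ℂ) • totalPair d L
        + totalPair d L * (star (totalPair d L) * totalPair d L) := by
    have h0 := congrArg (· * totalPair d L)
      (eq_add_of_sub_eq (star_totalPair_commutator (d := d) L))
    simpa only [add_mul, sub_mul, smul_mul_assoc, one_mul, mul_assoc (totalPair d L)] using h0
  have hv : ((box d L).card : ℂ) ≠ 0 := Nat.cast_ne_zero.2 (card_box_pos L).ne'
  have hg : ((p.gam / (box d L).card : ℝ) : ℂ) * ((box d L).card : ℂ) = p.gam := by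
    push_cast
    field_simp
  rw [hamiltonian_eq_total, freqOp]
  simp only [sub_mul, mul_sub, smul_mul_assoc, mul_smul_comm, one_mul, h1, h2, smul_add, smul_sub,
    smul_smul, hg]
  module

/-- Gauge invariance: the charges `+2` of `B*` and `-2` of `B` cancel in `B* B`. -/
lemma commute_totalNum_hamiltonian (p : Params) (L : ℕ) :
    Commute (totalNum d L) (hamiltonian d p L) := by
  rw [hamiltonian_eq_total]
  refine (commute_totalNum_totalOnSite p L).sub_right (Commute.smul_right ?_ _)
  rw [Commute, SemiconjBy, ← mul_assoc, totalNum_commutator_star_pair, add_mul, mul_assoc,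
    totalNum_commutator_pair, mul_add, ← mul_assoc, smul_mul_assoc, mul_smul_comm]
  module

lemma commute_freqOp_hamiltonian (p : Params) (L : ℕ) :
    Commute (freqOp d p L) (hamiltonian d p L) :=
  ((Commute.one_left _).smul_left _).sub_left ((commute_totalNum_hamiltonian p L).smul_left _)

end Totals

end CooperField
end

noncomputable section
namespace CooperField

/-- A `*`-homomorphism of `C*`-algebras is continuous. -/
def clmOfStarAlgHom {A : Type} [CStarAlgebra A] (T : A →⋆ₐ[ℂ] A) : A →L[ℂ] A :=
  T.toAlgHom.toLinearMap.mkContinuous 1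
    fun X => (NonUnitalStarAlgHom.norm_apply_le T X).trans_eq (one_mul _).symm

/-! ### Explicit dynamics in a rotating Cooper field. -/

section Propagator

variable {d : ℕ}

/-- The rotating Cooper field `c₀ e^{iνt}`. -/
def rotatingField (c : ℂ) (ν : ℝ) (t : ℝ) : ℂ := c * Complex.exp (Complex.I * ν * t)

lemma continuous_rotatingField (c : ℂ) (ν : ℝ) : Continuous (rotatingField c ν) := by
  unfold rotatingField
  fun_prop

lemma hasDerivAt_rotatingField (c : ℂ) (ν t : ℝ) :
    HasDerivAt (rotatingField c ν) (Complex.I * ν * rotatingField c ν t) t := by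
  have h := (Complex.ofRealCLM.hasDerivAt (x := t)).const_mul (Complex.I * ν)
  simp only [Complex.ofRealCLM_apply, Complex.ofReal_one, mul_one] at h
  convert! h.cexp.const_mul c using 1
  rw [rotatingField]
  ring

lemma expGroup_smul_one {A : Type} [CStarAlgebra A] (z : ℂ) (t : ℝ) :
    expGroup (z • (1 : A)) t = Complex.exp (Complex.I * t * z) • (1 : A) := by
  rw [expGroup, smul_smul, ← Algebra.algebraMap_eq_smul_one, ← NormedSpace.algebraMap_exp_comm,
    ← Complex.exp_eq_exp_ℂ, Algebra.algebraMap_eq_smul_one]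

lemma expGroup_conj_of_commutator {A : Type} [CStarAlgebra A] {N B : A} {z : ℂ}
    (h : N * B = B * N + z • B) (t : ℝ) :
    expGroup N t * B * expGroup N (-t) = Complex.exp (Complex.I * t * z) • B := by
  rw [expGroup_mul_mul_neg (N := z • (1 : A)) (by rw [h, smul_mul_assoc, one_mul])
    ((Commute.one_left _).smul_left _), expGroup_smul_one, smul_mul_assoc, one_mul]

variable (d) in
/-- The unitary propagator of the approximating Hamiltonians with a rotating Cooper field. -/
def propagator (p : Params) (L : ℕ) (c : ℂ) (ν t : ℝ) : U d :=
  expGroup (approxHamiltonian d p L c + ((ν / 2 : ℝ) : ℂ) • totalNum d L) t *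
    expGroup (((ν / 2 : ℝ) : ℂ) • totalNum d L) (-t)

/-- A pair carries charge 2, so the gauge rotation generated by `(ν/2) N` turns the pairing field by
the phase `e^{iνt}` and leaves the on-site terms fixed. In the rotating frame the Hamiltonian is
constant, which is the origin of `propagator`. -/
lemma approxHamiltonian_rotatingField (p : Params) (L : ℕ) (c : ℂ) (ν t : ℝ) :
    expGroup (((ν / 2 : ℝ) : ℂ) • totalNum d L) t * approxHamiltonian d p L c *
      expGroup (((ν / 2 : ℝ) : ℂ) • totalNum d L) (-t)
      = approxHamiltonian d p L (rotatingField c ν t) := by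
  set N := ((ν / 2 : ℝ) : ℂ) • totalNum d L with hN
  have h1 : N * totalPair d L = totalPair d L * N + (-ν : ℂ) • totalPair d L := by
    rw [hN, smul_mul_assoc, totalNum_commutator_pair, mul_smul_comm, smul_add, smul_smul]
    congr 2
    push_cast
    ring
  have h2 : N * star (totalPair d L) = star (totalPair d L) * N + (ν : ℂ) • star (totalPair d L) := by
    rw [hN, smul_mul_assoc, totalNum_commutator_star_pair, mul_smul_comm, smul_add, smul_smul]
    congr 2
    push_cast
    ring
  have h3 : Commute (totalOnSite d p L) (expGroup N t) :=
    commute_expGroup ((commute_totalNum_totalOnSite p L).symm.smul_right _) t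
  rw [approxHamiltonian_eq_total, approxHamiltonian_eq_total, mul_sub, sub_mul, ← h3.eq, mul_assoc,
    expGroup_mul_neg, mul_one]
  simp only [mul_smul_comm, smul_mul_assoc, mul_add, add_mul, expGroup_conj_of_commutator h1,
    expGroup_conj_of_commutator h2, smul_smul]
  congr 4
  · rw [rotatingField]
    congr 2
    ring
  · simp only [rotatingField, Complex.star_def, map_mul, ← Complex.exp_conj, Complex.conj_I,
      Complex.conj_ofReal]
    congr 2
    ring

lemma star_half_totalNum (ν : ℝ) (L : ℕ) :
    star (((ν / 2 : ℝ) : ℂ) • totalNum d L) = ((ν / 2 : ℝ) : ℂ) • totalNum d L := by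
  rw [star_smul, star_totalNum, Complex.star_def, Complex.conj_ofReal]

lemma propagator_mem_unitary (p : Params) (L : ℕ) (c : ℂ) (ν t : ℝ) :
    propagator d p L c ν t ∈ unitary (U d) :=
  (unitary (U d)).mul_mem (expGroup_mem_unitary (by rw [star_add, star_approxHamiltonian, star_half_totalNum]) t)
    (expGroup_mem_unitary (star_half_totalNum ν L) (-t))

lemma propagator_zero (p : Params) (L : ℕ) (c : ℂ) (ν : ℝ) : propagator d p L c ν 0 = 1 := by
  simp [propagator]

lemma hasDerivAt_propagator (p : Params) (L : ℕ) (c : ℂ) (ν t : ℝ) :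
    HasDerivAt (propagator d p L c ν) (Complex.I •
      (propagator d p L c ν t * approxHamiltonian d p L (rotatingField c ν t))) t := by
  set N := ((ν / 2 : ℝ) : ℂ) • totalNum d L with hN
  set H := approxHamiltonian d p L c with hH
  have h := (hasDerivAt_expGroup (H + N) t).mul (hasDerivAt_expGroup_neg N t)
  convert! h using 1
  rw [← approxHamiltonian_rotatingField, propagator, ← hN, ← hH]
  rw [smul_mul_assoc, mul_neg, mul_smul_comm, ← smul_neg, ← smul_add]
  congr 1
  -- The inner gauge factors cancel. On the other side the generator `H + N` of the first factor
  -- loses its `N` to the derivative of the second.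
  calc expGroup (H + N) t * expGroup N (-t) * (expGroup N t * H * expGroup N (-t))
      = expGroup (H + N) t * (expGroup N (-t) * expGroup N t) * H * expGroup N (-t) := by
        simp only [mul_assoc]
    _ = _ := by
        rw [expGroup_neg_mul, mul_one, mul_add, add_mul, mul_assoc _ N, add_assoc, add_neg_cancel,
          add_zero]

lemma continuous_approxHamiltonian (p : Params) (L : ℕ) {c : ℝ → ℂ} (hc : Continuous c) :
    Continuous fun r => approxHamiltonian d p L (c r) := by
  simp only [approxHamiltonian_eq_total]
  fun_prop

lemma approxTau_rotatingField (p : Params) (L : ℕ) (c : ℂ) (ν t s : ℝ) (A : U d) :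
    approxTau d p L (rotatingField c ν) t s A
      = star (propagator d p L c ν s) * propagator d p L c ν t * A *
        star (propagator d p L c ν t) * propagator d p L c ν s := by
  rw [approxTau_eq]
  have h1 := continuous_approxHamiltonian (d := d) p L (continuous_rotatingField c ν)
  have h2 (t : ℝ) := star_approxHamiltonian (d := d) p L (rotatingField c ν t)
  exact tsum_dysonSeries_commGenerator h1 h2 (hasDerivAt_propagator (d := d) p L c ν)
    (propagator_mem_unitary (d := d) p L c ν) s t A

lemma exists_unitary_approxTau (p : Params) (L : ℕ) (c : ℂ) (ν t s : ℝ) :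
    ∃ V ∈ unitary (U d), ∀ A, approxTau d p L (rotatingField c ν) t s A = V * A * star V :=
  ⟨star (propagator d p L c ν s) * propagator d p L c ν t,
    (unitary (U d)).mul_mem (Unitary.star_mem (propagator_mem_unitary p L c ν s))
      (propagator_mem_unitary p L c ν t),
    fun A => by rw [approxTau_rotatingField, star_mul, star_star]; simp only [mul_assoc]⟩

lemma norm_conj_le {A : Type} [CStarAlgebra A] {V : A} (hV : V ∈ unitary A) (X : A) :
    ‖V * X * star V‖ ≤ ‖X‖ := by
  have h1 := norm_le_one_of_mem_unitary hV
  have h2 : ‖star V‖ ≤ 1 := by rwa [norm_star]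
  calc ‖V * X * star V‖ ≤ ‖V‖ * ‖X‖ * ‖star V‖ := norm_mul₃_le
    _ ≤ 1 * ‖X‖ * 1 := by gcongr
    _ = ‖X‖ := by ring

/-- The finite-volume evolutions are contractions and are eventually constant on the dense set of
local elements, so they form a Cauchy sequence on every element. -/
lemma tendsto_approxTau (p : Params) (c : ℂ) (ν t s : ℝ) (A : U d) :
    Tendsto (fun L => approxTau d p L (rotatingField c ν) t s A) atTop
      (𝓝 (approxTauInf p (rotatingField c ν) t s A)) := by
  suffices h : CauchySeq fun L => approxTau d p L (rotatingField c ν) t s A by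
    obtain ⟨x, hx⟩ := cauchySeq_tendsto_of_complete h
    exact tendsto_nhds_limUnder ⟨x, hx⟩
  rw [Metric.cauchySeq_iff']
  intro ε hε
  obtain ⟨B, ⟨M, hB⟩, hAB⟩ := Metric.mem_closure_iff.1 (dense_localAlgebra A) (ε / 2) (by positivity)
  have hn (L : ℕ) : ‖approxTau d p L (rotatingField c ν) t s A
      - approxTau d p M (rotatingField c ν) t s B‖ ≤ ‖A - B‖ ∨ L < M := by
    rcases lt_or_ge L M with h | h
    · exact Or.inr h
    · left
      obtain ⟨V, hV, hT⟩ := exists_unitary_approxTau (d := d) p L c ν t s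
      rw [← approxTau_eq_of_le p h (continuous_rotatingField c ν) hB, ← map_sub, hT]
      exact norm_conj_le hV _
  have hn' (L : ℕ) (h : M ≤ L) := (hn L).resolve_right h.not_gt
  refine ⟨M, fun L hL => ?_⟩
  rw [dist_eq_norm] at hAB ⊢
  calc _ = ‖(approxTau d p L (rotatingField c ν) t s A
          - approxTau d p M (rotatingField c ν) t s B)
        - (approxTau d p M (rotatingField c ν) t s A
          - approxTau d p M (rotatingField c ν) t s B)‖ := by rw [sub_sub_sub_cancel_right]
    _ ≤ ‖A - B‖ + ‖A - B‖ := (norm_sub_le _ _).trans (add_le_add (hn' L hL) (hn' M le_rfl))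
    _ < ε := by linarith

/-- The infinite-volume dynamics in a rotating Cooper field, as a `*`-homomorphism. -/
def rotatingTau (p : Params) (c : ℂ) (ν t s : ℝ) : U d →⋆ₐ[ℂ] U d where
  toFun := approxTauInf p (rotatingField c ν) t s
  map_one' := by
    refine tendsto_nhds_unique (tendsto_approxTau p c ν t s 1) ?_
    refine tendsto_const_nhds.congr fun L => ?_
    obtain ⟨V, hV, hT⟩ := exists_unitary_approxTau (d := d) p L c ν t s
    rw [hT, mul_one, (Unitary.mem_iff.1 hV).2]
  map_mul' A B := by
    refine tendsto_nhds_unique (tendsto_approxTau p c ν t s (A * B)) ?_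
    refine ((tendsto_approxTau p c ν t s A).mul (tendsto_approxTau p c ν t s B)).congr fun L => ?_
    obtain ⟨V, hV, hT⟩ := exists_unitary_approxTau (d := d) p L c ν t s
    rw [hT, hT, hT]
    calc V * A * star V * (V * B * star V) = V * A * (star V * V) * B * star V := by
          simp only [mul_assoc]
      _ = _ := by rw [(Unitary.mem_iff.1 hV).1, mul_one]; simp only [mul_assoc]
  map_zero' := by
    refine tendsto_nhds_unique (tendsto_approxTau p c ν t s 0) ?_
    exact tendsto_const_nhds.congr fun L => (map_zero (approxTau d p L (rotatingField c ν) t s)).symm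
  map_add' A B := by
    refine tendsto_nhds_unique (tendsto_approxTau p c ν t s (A + B)) ?_
    exact ((tendsto_approxTau p c ν t s A).add (tendsto_approxTau p c ν t s B)).congr
      fun L => (map_add (approxTau d p L (rotatingField c ν) t s) A B).symm
  commutes' r := by
    refine tendsto_nhds_unique (tendsto_approxTau p c ν t s _) ?_
    refine tendsto_const_nhds.congr fun L => ?_
    obtain ⟨V, hV, hT⟩ := exists_unitary_approxTau (d := d) p L c ν t s
    rw [hT, ← Algebra.commutes, mul_assoc, (Unitary.mem_iff.1 hV).2, mul_one]
  map_star' A := by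
    refine tendsto_nhds_unique (tendsto_approxTau p c ν t s (star A)) ?_
    refine ((tendsto_approxTau p c ν t s A).star).congr fun L => ?_
    obtain ⟨V, hV, hT⟩ := exists_unitary_approxTau (d := d) p L c ν t s
    rw [hT, hT]
    simp only [star_mul, star_star, mul_assoc]

/-- The infinite-volume evolution of a functional in a rotating Cooper field. -/
def evolve (p : Params) (c : ℂ) (ν t : ℝ) (ρ : U d →L[ℂ] ℂ) : U d →L[ℂ] ℂ :=
  ρ.comp (clmOfStarAlgHom (rotatingTau p c ν t 0))

lemma evolve_apply (p : Params) (c : ℂ) (ν t : ℝ) (ρ : U d →L[ℂ] ℂ) (A : U d) :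
    evolve p c ν t ρ A = ρ (rotatingTau p c ν t 0 A) := rfl

lemma IsState.evolve {ρ : U d →L[ℂ] ℂ} (h : IsState ρ) (p : Params) (c : ℂ) (ν t : ℝ) :
    IsState (evolve p c ν t ρ) := by
  refine ⟨fun B => ?_, ?_⟩
  · rw [evolve_apply, map_mul, map_star]
    exact h.1 _
  · rw [evolve_apply, map_one]
    exact h.2

end Propagator

end CooperField
end

noncomputable section
namespace CooperField

/-! ### States, on-site algebras and product states. -/

section States

/-- Polarization: the values at the squares of `B`, `1 + B` and `1 + iB` are real, which fixes the
imaginary and the real part of `ρ(B*)`. -/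
lemma IsState.map_star {A : Type} [NormedRing A] [StarRing A] [NormedAlgebra ℂ A] [StarModule ℂ A]
    {ρ : A →L[ℂ] ℂ} (h : IsState ρ) (B : A) : ρ (star B) = star (ρ B) := by
  have h0 := (Complex.nonneg_iff.1 (h.1 B)).2
  have h1 := (Complex.nonneg_iff.1 (h.1 (1 + B))).2
  have h2 := (Complex.nonneg_iff.1 (h.1 (1 + Complex.I • B))).2
  simp only [star_add, star_one, star_smul, add_mul, mul_add, one_mul, mul_one, map_add, h.2,
    smul_mul_assoc, mul_smul_comm, map_smul, smul_eq_mul, Complex.star_def, Complex.conj_I,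
    Complex.add_im, Complex.one_im, Complex.mul_im, Complex.I_re, Complex.I_im, Complex.neg_im,
    Complex.neg_re, Complex.mul_re] at h1 h2
  apply Complex.ext
  · simp only [Complex.star_def, Complex.conj_re]
    linarith
  · simp only [Complex.star_def, Complex.conj_im]
    linarith

end States

section Site

variable {d : ℕ}

lemma coe_siteGen (x : Site d) (g : Spin × Bool) : (siteGen x g : U d) = carGen (a x) g := by
  obtain ⟨s, b⟩ := g
  cases b <;> rfl

lemma coe_sitePoly (x : Site d) (P : FreeAlgebra ℂ (Spin × Bool)) :
    (sitePoly x P : U d) = FreeAlgebra.lift ℂ (carGen (a x)) P := by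
  have h : ((siteAlgebra x).subtype.toAlgHom).comp (sitePoly x)
      = FreeAlgebra.lift ℂ (carGen (a x)) := by
    refine FreeAlgebra.hom_ext ?_
    funext g
    simp only [Function.comp_apply, AlgHom.comp_apply, FreeAlgebra.lift_ι_apply, sitePoly]
    exact coe_siteGen x g
  exact congrArg (fun f : FreeAlgebra ℂ (Spin × Bool) →ₐ[ℂ] U d => f P) h

lemma sitePoly_mem_wordSpan (x : Site d) (P : FreeAlgebra ℂ (Spin × Bool)) :
    (sitePoly x P : U d) ∈ wordSpan (a x) fun _ => True :=
  (mem_wordSpan_iff_mem_range _ _).2 ⟨P, (coe_sitePoly x P).symm⟩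

lemma mem_siteAlgebra_iff {x : Site d} {A : U d} :
    A ∈ siteAlgebra x ↔ A ∈ wordSpan (a x) fun _ => True := by
  constructor
  · intro h
    refine StarAlgebra.adjoin_induction (p := fun A _ => A ∈ wordSpan (a x) fun _ => True)
      ?_ ?_ ?_ ?_ ?_ h
    · rintro _ ⟨s, rfl⟩
      have := word_mem_wordSpan (a x) (fun _ => True) [(s, false)] trivial
      simpa [carGen] using this
    · intro r
      rw [Algebra.algebraMap_eq_smul_one]
      exact Submodule.smul_mem _ _ (word_mem_wordSpan (a x) _ [] trivial)
    · exact fun _ _ _ _ => Submodule.add_mem _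
    · exact fun _ _ _ _ => mul_mem_wordSpan fun _ _ _ _ => trivial
    · exact fun _ _ => star_mem_wordSpan
  · intro h
    obtain ⟨P, rfl⟩ := (mem_wordSpan_iff_mem_range _ _).1 h
    rw [← coe_sitePoly]
    exact (sitePoly x P).2

lemma restrictSite_apply (ρ : U d →L[ℂ] ℂ) (A : siteAlgebra (0 : Site d)) :
    restrictSite ρ A = ρ (A : U d) := rfl

lemma isState_restrictSite {ρ : U d →L[ℂ] ℂ} (h : IsState ρ) :
    IsState (A := siteAlgebra (0 : Site d)) (restrictSite ρ) :=
  ⟨fun B => h.1 (B : U d), h.2⟩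

lemma IsProductOf.apply_sitePoly {ρ : U d →L[ℂ] ℂ} {ρ₀ : siteAlgebra (0 : Site d) →L[ℂ] ℂ}
    (h : IsProductOf ρ ρ₀) (x : Site d) (P : FreeAlgebra ℂ (Spin × Bool)) :
    ρ (sitePoly x P : U d) = ρ₀ (sitePoly (0 : Site d) P) := by
  have := h.2.2.2 1 (fun _ => x) (fun _ => P) (Function.injective_of_subsingleton _)
  simpa using this

lemma IsProductOf.apply_mul {ρ : U d →L[ℂ] ℂ} {ρ₀ : siteAlgebra (0 : Site d) →L[ℂ] ℂ}
    (h : IsProductOf ρ ρ₀) {x y : Site d} (hxy : x ≠ y) (P Q : FreeAlgebra ℂ (Spin × Bool)) :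
    ρ ((sitePoly x P : U d) * (sitePoly y Q : U d))
      = ρ₀ (sitePoly (0 : Site d) P) * ρ₀ (sitePoly (0 : Site d) Q) := by
  have := h.2.2.2 2 ![x, y] ![P, Q] (by
    intro i j hij
    fin_cases i <;> fin_cases j <;> simp_all [hxy.symm])
  refine Eq.trans (congrArg ρ ?_) (this.trans (Fin.prod_univ_two _))
  simp
  rfl

end Site

/-! ### Product states stay product states. -/

section ProductEvolution

variable {d : ℕ} (p : Params) (c : ℂ) (ν t : ℝ)

lemma rotatingTau_eq {M : ℕ} {A : U d} (hA : A ∈ localAlgebra d M) (s : ℝ) :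
    rotatingTau p c ν t s A = approxTau d p M (rotatingField c ν) t s A :=
  approxTauInf_eq p (continuous_rotatingField c ν) hA t s

/-- Two sites can thus be treated as one site in the product algebra. A polynomial identity there,
or membership in its word span, expresses that one and the same polynomial works at both sites. -/
lemma isCar_prod {A B : Type} [Ring A] [StarRing A] [Ring B] [StarRing B]
    {f : Spin → A} {g : Spin → B} (hf : IsCar f) (hg : IsCar g) :
    IsCar fun s => ((f s, g s) : A × B) where
  mul s s' := Prod.ext (hf.mul s s') (hg.mul s s')
  mul_star s s' := by
    refine Prod.ext ((hf.mul_star s s').trans ?_) ((hg.mul_star s s').trans ?_) <;>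
    split_ifs <;> rfl

lemma map_lift_carGen {A B : Type} [Ring A] [StarRing A] [Algebra ℂ A] [Ring B] [StarRing B]
    [Algebra ℂ B] (φ : A →ₐ[ℂ] B) (hφ : ∀ X, φ (star X) = star (φ X)) (f : Spin → A)
    (P : FreeAlgebra ℂ (Spin × Bool)) :
    φ (FreeAlgebra.lift ℂ (carGen f) P) = FreeAlgebra.lift ℂ (carGen fun s => φ (f s)) P := by
  have h : φ.comp (FreeAlgebra.lift ℂ (carGen f)) = FreeAlgebra.lift ℂ (carGen fun s => φ (f s)) := by
    refine FreeAlgebra.hom_ext ?_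
    funext g
    obtain ⟨s, b⟩ := g
    cases b <;> simp [carGen, hφ]
  exact congrArg (fun f : FreeAlgebra ℂ (Spin × Bool) →ₐ[ℂ] B => f P) h

/-- The dynamics acts on the algebras of all sites in the same way. -/
lemma exists_rotatingTau_sitePoly (x : Site d) (P : FreeAlgebra ℂ (Spin × Bool)) :
    ∃ Q, rotatingTau p c ν t 0 (sitePoly (0 : Site d) P : U d) = (sitePoly (0 : Site d) Q : U d) ∧
      rotatingTau p c ν t 0 (sitePoly x P : U d) = (sitePoly x Q : U d) := by
  obtain ⟨M, hM⟩ := exists_mem_box x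
  let f : Spin → U d × U d := fun s => (a 0 s, a x s)
  have hf : IsCar f := isCar_prod (isCar_a 0) (isCar_a x)
  have fst_lift (Q : FreeAlgebra ℂ (Spin × Bool)) :
      (FreeAlgebra.lift ℂ (carGen f) Q).1 = (sitePoly (0 : Site d) Q : U d) := by
    rw [coe_sitePoly]
    exact map_lift_carGen (AlgHom.fst ℂ (U d) (U d)) (fun _ => rfl) f Q
  have snd_lift (Q : FreeAlgebra ℂ (Spin × Bool)) :
      (FreeAlgebra.lift ℂ (carGen f) Q).2 = (sitePoly x Q : U d) := by
    rw [coe_sitePoly]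
    exact map_lift_carGen (AlgHom.snd ℂ (U d) (U d)) (fun _ => rfl) f Q
  have hfin := hf.finiteDimensional_wordSpan fun _ => True
  -- Finite dimension makes the span of the diagonal words closed, so invariance under the
  -- generators passes to the dynamics and a common polynomial `Q` can be read off.
  have hclosed : IsClosed (wordSpan f (fun _ => True) : Set (U d × U d)) :=
    Submodule.closed_of_finiteDimensional _
  have hinv : ∀ z ∈ wordSpan f (fun _ => True), ∀ r,
      (approxGenerator d p M (rotatingField c ν r) z.1,
        approxGenerator d p M (rotatingField c ν r) z.2) ∈ wordSpan f (fun _ => True) := by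
    intro z hz r
    have hK : localHam p (rotatingField c ν r) f ∈ wordSpan f (fun _ => True) :=
      wordSpan_mono _ (fun _ _ => trivial) (localHam_mem_wordSpan p _ f)
    have hmem : Complex.I • (localHam p (rotatingField c ν r) f * z
        - z * localHam p (rotatingField c ν r) f) ∈ wordSpan f (fun _ => True) :=
      Submodule.smul_mem _ _ (Submodule.sub_mem _
        (mul_mem_wordSpan (fun _ _ _ _ => trivial) hK hz)
        (mul_mem_wordSpan (fun _ _ _ _ => trivial) hz hK))
    obtain ⟨Q, rfl⟩ := (mem_wordSpan_iff_mem_range _ _).1 hz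
    convert hmem using 1
    refine Prod.ext ?_ ?_
    · change approxGenerator d p M _ _ = _
      rw [fst_lift, approxGenerator_site p (zero_mem_box M) _ (sitePoly_mem_wordSpan 0 Q),
        ← fst_lift]
      rfl
    · change approxGenerator d p M _ _ = _
      rw [snd_lift, approxGenerator_site p hM _ (sitePoly_mem_wordSpan x Q), ← snd_lift]
      rfl
  have key := approxTau_mem_pair p M (continuous_rotatingField c ν) hclosed hinv
    ((mem_wordSpan_iff_mem_range f _).2 ⟨P, rfl⟩) t 0
  obtain ⟨Q, hQ⟩ := (mem_wordSpan_iff_mem_range _ _).1 key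
  refine ⟨Q, ?_, ?_⟩
  · rw [rotatingTau_eq p c ν t (wordSpan_le_localAlgebra (zero_mem_box M)
      (sitePoly_mem_wordSpan 0 P)), ← fst_lift, ← fst_lift, hQ]
  · rw [rotatingTau_eq p c ν t (wordSpan_le_localAlgebra hM (sitePoly_mem_wordSpan x P)),
      ← snd_lift, ← snd_lift, hQ]

/-- The local Hamiltonian consists of even words, so the generator preserves any length property
stable under adding even numbers. It is applied to odd lengths, for evenness of the evolved state,
and to all lengths. -/
lemma rotatingTau_mem_wordSpan {q : ℕ → Prop} (hq : ∀ m n, Even m → q n → q (m + n)) {A : U d}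
    (hA : A ∈ wordSpan (a (0 : Site d)) q) :
    rotatingTau p c ν t 0 A ∈ wordSpan (a (0 : Site d)) q := by
  have hA' : A ∈ wordSpan (a (0 : Site d)) fun _ => True := wordSpan_mono _ (fun _ _ => trivial) hA
  rw [rotatingTau_eq p c ν t (wordSpan_le_localAlgebra (zero_mem_box 0) hA')]
  have hfin := (isCar_a (0 : Site d)).finiteDimensional_wordSpan q
  have hclosed : IsClosed (wordSpan (a (0 : Site d)) q : Set (U d)) :=
    Submodule.closed_of_finiteDimensional _
  refine approxTau_mem (d := d) p 0 (continuous_rotatingField c ν) hclosed ?_ hA t 0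
  intro B hB r
  rw [approxGenerator_site p (zero_mem_box 0) _ (wordSpan_mono _ (fun _ _ => trivial) hB)]
  exact Submodule.smul_mem _ _ (Submodule.sub_mem _
    (mul_mem_wordSpan hq (localHam_mem_wordSpan p _ _) hB)
    (mul_mem_wordSpan (fun m n hm hn => by rw [add_comm]; exact hq n m hn hm) hB
      (localHam_mem_wordSpan p _ _)))

/-- Product states evolve into product states. -/
lemma IsProductState.evolve {ρ : U d →L[ℂ] ℂ} (h : IsProductState ρ) :
    IsProductState (evolve p c ν t ρ) := by
  refine ⟨h.1.evolve p c ν t, isState_restrictSite (h.1.evolve p c ν t), ?_, ?_⟩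
  · intro w hw
    have hmem := rotatingTau_mem_wordSpan p c ν t (q := Odd) (fun m n hm hn => hm.add_odd hn)
      (word_mem_wordSpan (a (0 : Site d)) Odd w hw)
    have hzero : ∀ A ∈ wordSpan (a (0 : Site d)) Odd, ρ A = 0 := by
      intro A hA
      have hle : wordSpan (a (0 : Site d)) Odd ≤ LinearMap.ker ρ.toLinearMap := by
        rw [wordSpan, Submodule.span_le]
        rintro _ ⟨v, hv, rfl⟩
        have := h.2.2.1 v hv
        rw [restrictSite_apply] at this
        simpa [Function.comp_def, coe_siteGen] using this
      exact hle hA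
    rw [restrictSite_apply, evolve_apply]
    have e : (((w.map (siteGen (0 : Site d))).prod : siteAlgebra (0 : Site d)) : U d)
        = (w.map (carGen (a 0))).prod := by
      simp [Function.comp_def, coe_siteGen]
    rw [e]
    exact hzero _ hmem
  · intro m x P hx
    choose Q hQ0 hQ using fun i => exists_rotatingTau_sitePoly p c ν t (x i) (P i)
    rw [evolve_apply, map_list_prod, List.map_ofFn]
    have e : (rotatingTau p c ν t 0 ∘ fun i => (sitePoly (x i) (P i) : U d))
        = fun i => (sitePoly (x i) (Q i) : U d) := funext hQ
    rw [e, h.2.2.2 m x Q hx]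
    refine Finset.prod_congr rfl fun i _ => ?_
    rw [restrictSite_apply, restrictSite_apply, evolve_apply, hQ0]

end ProductEvolution

end CooperField
end

noncomputable section
namespace CooperField

/-! ### The self-consistency equation. -/

section SelfConsistency

set_option maxHeartbeats 1000000 in
set_option synthInstance.maxHeartbeats 200000 in
lemma map_star_siteAlgebra {d : ℕ} {ω : siteAlgebra (0 : Site d) →L[ℂ] ℂ} (h : IsState ω)
    {X Y : siteAlgebra (0 : Site d)} (hXY : (Y : U d) = star (X : U d)) : ω Y = star (ω X) := by
  have e : Y = star X := Subtype.ext hXY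
  rw [e]
  exact IsState.map_star (A := siteAlgebra (0 : Site d)) h X

variable {d : ℕ} (p : Params) {c : ℝ → ℂ} (hc : Continuous c)

/-- The box with `L = 0` is the single site at the origin, and it already gives the full
approximating dynamics of on-site observables. -/
lemma approxGenerator_pair (z : ℂ) :
    approxGenerator d p 0 z (a 0 dn * a 0 up)
      = (Complex.I * (2 * (p.mu - p.lam))) • (a (0 : Site d) dn * a 0 up)
        + (Complex.I * (p.gam * z)) • (1 - (num (0 : Site d) up + num 0 dn)) := by
  rw [approxGenerator_site p (zero_mem_box 0) z (mem_wordSpan_true (pair_mem (0 : Site d))),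
    (isCar_a (0 : Site d)).localHam_commutator_pair, num, num]
  module

lemma approxGenerator_star_pair (z : ℂ) :
    approxGenerator d p 0 z (star (a 0 up) * star (a 0 dn))
      = (-(Complex.I * (2 * (p.mu - p.lam)))) • (star (a (0 : Site d) up) * star (a 0 dn))
        - (Complex.I * (p.gam * star z)) • (1 - (num (0 : Site d) up + num 0 dn)) := by
  rw [approxGenerator_site p (zero_mem_box 0) z (mem_wordSpan_true (star_pair_mem (0 : Site d))),
    (isCar_a (0 : Site d)).localHam_commutator_star_pair, num, num]
  module

lemma one_sub_num_mem : 1 - (num (0 : Site d) up + num 0 dn) ∈ wordSpan (a (0 : Site d)) Even :=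
  Submodule.sub_mem _ (word_mem_wordSpan (a (0 : Site d)) Even [] (by simp)) (num_mem 0)

lemma approxGenerator_one_sub_num (z : ℂ) :
    approxGenerator d p 0 z (1 - (num (0 : Site d) up + num 0 dn))
      = (Complex.I * (2 * p.gam * star z)) • (a (0 : Site d) dn * a 0 up)
        - (Complex.I * (2 * p.gam * z)) • (star (a (0 : Site d) up) * star (a 0 dn)) := by
  have h := (isCar_a (0 : Site d)).localHam_commutator_num p z
  rw [approxGenerator_site p (zero_mem_box 0) z (mem_wordSpan_true one_sub_num_mem), mul_sub,
    sub_mul, mul_one, one_mul, sub_sub_sub_cancel_left, num, num, ← neg_sub, h]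
  module

include hc

lemma hasDerivAt_functional_approxTau (ρ : U d →L[ℂ] ℂ) (A : U d) (t : ℝ) :
    HasDerivAt (fun t => ρ (approxTau d p 0 c t 0 A))
      (ρ (approxTau d p 0 c t 0 (approxGenerator d p 0 (c t) A))) t :=
  (ρ.restrictScalars ℝ).hasFDerivAt.comp_hasDerivAt t (hasDerivAt_approxTau p 0 hc t 0 A)

/-- With the next two lemmas: a closed linear system for the expectations `y`, `w`, `z` of pair,
adjoint pair and `1 - n`, for an arbitrary continuous field `c`. -/
lemma hasDerivAt_pair (ρ : U d →L[ℂ] ℂ) (t : ℝ) :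
    HasDerivAt (fun t => ρ (approxTau d p 0 c t 0 (a 0 dn * a 0 up)))
      (Complex.I * (2 * (p.mu - p.lam)) * ρ (approxTau d p 0 c t 0 (a 0 dn * a 0 up))
        + Complex.I * (p.gam * c t) *
          ρ (approxTau d p 0 c t 0 (1 - (num (0 : Site d) up + num 0 dn)))) t := by
  have h := hasDerivAt_functional_approxTau p hc ρ (a 0 dn * a 0 up) t
  rw [approxGenerator_pair p (c t), map_add, map_add, map_smul, map_smul, map_smul, map_smul,
    smul_eq_mul, smul_eq_mul] at h
  exact h

lemma hasDerivAt_star_pair (ρ : U d →L[ℂ] ℂ) (t : ℝ) :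
    HasDerivAt (fun t => ρ (approxTau d p 0 c t 0 (star (a 0 up) * star (a 0 dn))))
      (-(Complex.I * (2 * (p.mu - p.lam))) *
          ρ (approxTau d p 0 c t 0 (star (a 0 up) * star (a 0 dn)))
        - Complex.I * (p.gam * star (c t)) *
          ρ (approxTau d p 0 c t 0 (1 - (num (0 : Site d) up + num 0 dn)))) t := by
  have h := hasDerivAt_functional_approxTau p hc ρ (star (a 0 up) * star (a 0 dn)) t
  rw [approxGenerator_star_pair p (c t), map_sub, map_sub, map_smul, map_smul, map_smul, map_smul,
    smul_eq_mul, smul_eq_mul] at h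
  exact h

lemma hasDerivAt_one_sub_num (ρ : U d →L[ℂ] ℂ) (t : ℝ) :
    HasDerivAt (fun t => ρ (approxTau d p 0 c t 0 (1 - (num (0 : Site d) up + num 0 dn))))
      (Complex.I * (2 * p.gam * star (c t)) * ρ (approxTau d p 0 c t 0 (a 0 dn * a 0 up))
        - Complex.I * (2 * p.gam * c t) *
          ρ (approxTau d p 0 c t 0 (star (a 0 up) * star (a 0 dn)))) t := by
  have h := hasDerivAt_functional_approxTau p hc ρ (1 - (num (0 : Site d) up + num 0 dn)) t
  rw [approxGenerator_one_sub_num p (c t), map_sub, map_sub, map_smul, map_smul, map_smul, map_smul,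
    smul_eq_mul, smul_eq_mul] at h
  exact h

omit hc

lemma IsState.apply_one_sub_num {ρ : U d →L[ℂ] ℂ} (h : IsState ρ) :
    ρ (1 - (num (0 : Site d) up + num 0 dn)) = ((1 - electronDensity ρ : ℝ) : ℂ) := by
  have h1 := (Complex.nonneg_iff.1 (h.1 (a 0 up))).2
  have h2 := (Complex.nonneg_iff.1 (h.1 (a 0 dn))).2
  rw [map_sub, h.2, electronDensity]
  apply Complex.ext
  · simp
  · rw [map_add, num, num]
    simp [← h1, ← h2]

lemma IsState.apply_star_pair {ρ : U d →L[ℂ] ℂ} (h : IsState ρ) :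
    ρ (star (a 0 up) * star (a 0 dn)) = star (ρ (a 0 dn * a 0 up)) := by
  rw [← h.map_star, star_mul]

lemma evolve_site (c : ℂ) (ν t : ℝ) (ρ : U d →L[ℂ] ℂ) {A : U d}
    (hA : A ∈ wordSpan (a (0 : Site d)) fun _ => True) :
    evolve p c ν t ρ A = ρ (approxTau d p 0 (rotatingField c ν) t 0 A) := by
  rw [evolve_apply, rotatingTau_eq p c ν t (wordSpan_le_localAlgebra (zero_mem_box 0) hA)]

lemma nu_eq (ρ : U d →L[ℂ] ℂ) :
    (nu p ρ : ℂ) = 2 * (p.mu - p.lam) + p.gam * ((1 - electronDensity ρ : ℝ) : ℂ) := by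
  rw [nu]
  push_cast
  ring

/-- The rotating field is consistent with the evolution that it generates. -/
lemma cooperField_evolve {ρ : U d →L[ℂ] ℂ} (h : IsState ρ) (t : ℝ) :
    cooperField (evolve p (cooperField ρ) (nu p ρ) t ρ)
      = rotatingField (cooperField ρ) (nu p ρ) t := by
  set c₀ := cooperField ρ with hc₀
  set ν := nu p ρ with hν
  set c := rotatingField c₀ ν with hcdef
  have hc : Continuous c := continuous_rotatingField c₀ ν
  have hst (t : ℝ) : IsState (evolve p c₀ ν t ρ) := h.evolve p c₀ ν t
  set z₀ : ℝ := 1 - electronDensity ρ with hz₀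
  set y : ℝ → ℂ := fun t => ρ (approxTau d p 0 c t 0 (a 0 dn * a 0 up)) with hy
  set w : ℝ → ℂ := fun t => ρ (approxTau d p 0 c t 0 (star (a 0 up) * star (a 0 dn))) with hw
  set z : ℝ → ℂ := fun t => ρ (approxTau d p 0 c t 0 (1 - (num (0 : Site d) up + num 0 dn)))
    with hz
  have ey (t : ℝ) : evolve p c₀ ν t ρ (a 0 dn * a 0 up) = y t :=
    evolve_site p c₀ ν t ρ (mem_wordSpan_true (pair_mem (0 : Site d)))
  -- The evolved functional is again a state, so `w` is the conjugate of `y`, and `z` is real. This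
  -- makes the conserved form below a sum of squares.
  have ew (t : ℝ) : w t = star (y t) := by
    rw [← ey, ← (hst t).apply_star_pair]
    exact (evolve_site p c₀ ν t ρ (mem_wordSpan_true (star_pair_mem (0 : Site d)))).symm
  have ez (t : ℝ) : ∃ r : ℝ, z t = r := by
    refine ⟨1 - electronDensity (evolve p c₀ ν t ρ), ?_⟩
    · rw [← (hst t).apply_one_sub_num]
      exact (evolve_site p c₀ ν t ρ (mem_wordSpan_true (one_sub_num_mem (d := d)))).symm
  have y0 : y 0 = c₀ := by
    change ρ (approxTau d p 0 c 0 0 (a 0 dn * a 0 up)) = c₀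
    rw [approxTau_self]
    rfl
  have z0 : z 0 = z₀ := by
    change ρ (approxTau d p 0 c 0 0 (1 - (num (0 : Site d) up + num 0 dn))) = z₀
    rw [approxTau_self]
    exact h.apply_one_sub_num
  have c0 : c 0 = c₀ := by simp [hcdef, rotatingField]
  have hcd (t : ℝ) : HasDerivAt c (Complex.I * ν * c t) t := hasDerivAt_rotatingField c₀ ν t
  have hcs (t : ℝ) : HasDerivAt (fun t => star (c t)) (-(Complex.I * ν) * star (c t)) t := by
    have := (hcd t).star
    simpa using this
  have hν' : (ν : ℂ) = 2 * (p.mu - p.lam) + p.gam * z₀ := nu_eq p ρ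
  -- The choice of `ν` makes the constant state `y = c`, `z = z₀` (in the rotating frame) a
  -- solution, so the deviations satisfy the homogeneous linear system. That system is a rotation of
  -- the pseudo-spin, and this is its invariant quadratic form; the weight 4 makes the cross terms
  -- cancel. It vanishes at time zero, hence always.
  have hE (t : ℝ) : HasDerivAt (fun t => 4 * ((y t - c t) * (w t - star (c t)))
      + (z t - z₀) * (z t - z₀)) 0 t := by
    have hu := (hasDerivAt_pair p hc ρ t).sub (hcd t)
    have hv := (hasDerivAt_star_pair p hc ρ t).sub (hcs t)
    have hq := (hasDerivAt_one_sub_num p hc ρ t).sub_const (z₀ : ℂ)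
    convert! ((hu.mul hv).const_mul 4).add (hq.mul hq) using 1
    simp only [Pi.sub_apply]
    rw [hν']
    change 0 = 4 * (((Complex.I * (2 * (p.mu - p.lam)) * y t + Complex.I * (p.gam * c t) * z t
      - Complex.I * (2 * (p.mu - p.lam) + p.gam * z₀) * c t) * (w t - star (c t)))
      + ((y t - c t) * (-(Complex.I * (2 * (p.mu - p.lam))) * w t
        - Complex.I * (p.gam * star (c t)) * z t
        - -(Complex.I * (2 * (p.mu - p.lam) + p.gam * z₀)) * star (c t))))
      + ((Complex.I * (2 * p.gam * star (c t)) * y t - Complex.I * (2 * p.gam * c t) * w t)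
        * (z t - z₀) + (z t - z₀) *
        (Complex.I * (2 * p.gam * star (c t)) * y t - Complex.I * (2 * p.gam * c t) * w t))
    ring
  have hconst := is_const_of_deriv_eq_zero (fun t => (hE t).differentiableAt)
    (fun t => (hE t).deriv) t 0
  simp only [y0, c0, z0, sub_self, zero_mul, mul_zero, add_zero] at hconst
  obtain ⟨r, hr⟩ := ez t
  have h1 : ((4 * Complex.normSq (y t - c t) + (r - z₀) * (r - z₀) : ℝ) : ℂ) = 0 := by
    rw [← hconst, ew, hr, ← star_sub, Complex.star_def, Complex.mul_conj]
    push_cast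
    ring
  have h2 : 4 * Complex.normSq (y t - c t) + (r - z₀) * (r - z₀) = 0 := by exact_mod_cast h1
  have h3 : Complex.normSq (y t - c t) = 0 := by
    nlinarith [Complex.normSq_nonneg (y t - c t), mul_self_nonneg (r - z₀)]
  rw [cooperField, ey]
  exact sub_eq_zero.1 (Complex.normSq_eq_zero.1 h3)

lemma orderParam_evolve {ρ : U d →L[ℂ] ℂ} (h : IsState ρ) :
    (fun t => orderParam (restrictSite (evolve p (cooperField ρ) (nu p ρ) t ρ)))
      = rotatingField (cooperField ρ) (nu p ρ) :=
  funext fun t => cooperField_evolve p h t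

/-- The evolution in the rotating field solves the self-consistency equation. -/
lemma isSelfConsistent_evolve {ρ : U d →L[ℂ] ℂ} (h : IsState ρ) :
    IsSelfConsistent p (restrictSite ρ)
      (fun t => restrictSite (evolve p (cooperField ρ) (nu p ρ) t ρ)) := by
  refine ⟨fun t => isState_restrictSite (h.evolve p _ _ t), fun A => ?_, fun t A => ?_⟩
  · have hA := mem_siteAlgebra_iff.1 A.2
    have e : (fun t => restrictSite (evolve p (cooperField ρ) (nu p ρ) t ρ) A)
        = fun t => ρ (approxTau d p 0 (rotatingField (cooperField ρ) (nu p ρ)) t 0 (A : U d)) :=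
      funext fun t => evolve_site p _ _ t ρ hA
    rw [e]
    exact continuous_iff_continuousAt.2 fun t => (hasDerivAt_functional_approxTau p
      (continuous_rotatingField _ _) ρ (A : U d) t).continuousAt
  · have hA := mem_siteAlgebra_iff.1 A.2
    rw [orderParam_evolve p h]
    exact ⟨⟨rotatingTau p (cooperField ρ) (nu p ρ) t 0 (A : U d), mem_siteAlgebra_iff.2
      (rotatingTau_mem_wordSpan p _ _ t (fun _ _ _ _ => trivial) hA)⟩, rfl, rfl⟩

set_option maxHeartbeats 1000000 in
/-- Uniqueness of the solution of the self-consistency equation. -/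
lemma IsSelfConsistent.eq_evolve {ρ : U d →L[ℂ] ℂ} (h : IsState ρ)
    {ω : ℝ → siteAlgebra (0 : Site d) →L[ℂ] ℂ} (hω : IsSelfConsistent p (restrictSite ρ) ω) :
    ω = fun t => restrictSite (evolve p (cooperField ρ) (nu p ρ) t ρ) := by
  obtain ⟨hst, hcont, heq⟩ := hω
  set c : ℝ → ℂ := fun r => orderParam (ω r) with hcdef
  have hc : Continuous c := hcont _
  have hωT (t : ℝ) (A : siteAlgebra (0 : Site d)) :
      ω t A = ρ (approxTau d p 0 c t 0 (A : U d)) := by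
    obtain ⟨B, hB, hBA⟩ := heq t A
    rw [hBA, restrictSite_apply, hB, approxTauInf_eq p hc
      (wordSpan_le_localAlgebra (zero_mem_box 0) (mem_siteAlgebra_iff.1 A.2))]
  set y : ℝ → ℂ := fun t => ρ (approxTau d p 0 c t 0 (a 0 dn * a 0 up)) with hy
  set w : ℝ → ℂ := fun t => ρ (approxTau d p 0 c t 0 (star (a 0 up) * star (a 0 dn))) with hw
  set z : ℝ → ℂ := fun t => ρ (approxTau d p 0 c t 0 (1 - (num (0 : Site d) up + num 0 dn)))
    with hz
  let b : siteAlgebra (0 : Site d) :=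
    siteGen (0 : Site d) (dn, false) * siteGen (0 : Site d) (up, false)
  let b' : siteAlgebra (0 : Site d) :=
    siteGen (0 : Site d) (up, true) * siteGen (0 : Site d) (dn, true)
  have ey (t : ℝ) : y t = c t := (hωT t b).symm
  have ew (t : ℝ) : w t = star (c t) := by
    have h1 : (b' : U d) = star (b : U d) := (star_mul (a (0 : Site d) dn) (a 0 up)).symm
    exact (hωT t b').symm.trans (map_star_siteAlgebra (hst t) h1)
  -- Self-consistency means `y = c` and `w` conjugate to `c`, so the two terms of the derivative of
  -- `z` cancel and the density is conserved.
  have hzd (t : ℝ) : HasDerivAt z 0 t := by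
    have := hasDerivAt_one_sub_num p hc ρ t
    convert! this using 1
    change 0 = Complex.I * (2 * p.gam * star (c t)) * y t - Complex.I * (2 * p.gam * c t) * w t
    rw [ey, ew]
    ring
  have hz0 (t : ℝ) : z t = ((1 - electronDensity ρ : ℝ) : ℂ) := by
    rw [is_const_of_deriv_eq_zero (fun t => (hzd t).differentiableAt) (fun t => (hzd t).deriv) t 0,
      ← h.apply_one_sub_num]
    change ρ (approxTau d p 0 c 0 0 _) = _
    rw [approxTau_self]
    rfl
  -- With `z` constant and `c = y`, the pair equation becomes a scalar linear equation, whose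
  -- frequency is `ν`.
  have hyd (t : ℝ) : HasDerivAt y (Complex.I * nu p ρ * y t) t := by
    have := hasDerivAt_pair p hc ρ t
    convert! this using 1
    change _ = Complex.I * (2 * (p.mu - p.lam)) * y t + Complex.I * (p.gam * c t) * z t
    rw [hz0, nu_eq, ← ey]
    ring
  have hcy : c = rotatingField (cooperField ρ) (nu p ρ) := by
    funext t
    rw [← ey, eq_mul_exp_of_hasDerivAt hyd t, rotatingField]
    congr 1
    change ρ (approxTau d p 0 c 0 0 _) = _
    rw [approxTau_self]
    rfl
  funext t
  ext A
  rw [hωT, hcy, restrictSite_apply, evolve_site p _ _ t ρ (mem_siteAlgebra_iff.1 A.2)]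

end SelfConsistency

end CooperField
end

noncomputable section

/-! ### Cauchy-Schwarz bounds for fluctuations. -/

section MeanField

variable {A : Type} [CStarAlgebra A] {V : Type} [NormedAddCommGroup V] [InnerProductSpace ℂ V]
  {η : A →L[ℂ] V} {ρ : A →L[ℂ] ℂ} (hin : ∀ X Y, inner ℂ (η X) (η Y) = ρ (star X * Y))
  (hη : ∀ X Y, ‖η (X * Y)‖ ≤ ‖X‖ * ‖η Y‖)

include hη in
lemma norm_gns_conj_le {E : A} (hE : E ∈ unitary A) (X : A) :
    ‖η (E * X * star E)‖ ≤ ‖X‖ * ‖η 1‖ := by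
  have h := hη (E * X * star E) 1
  rw [mul_one] at h
  exact h.trans (mul_le_mul_of_nonneg_right (CooperField.norm_conj_le hE X) (norm_nonneg _))

include hin hη in
-- The fluctuation stands as `m*` on the left and as `m` on the right, so both terms are GNS inner
-- products that contain `η (E m E*)`. The other factors are bounded in operator norm.
lemma norm_functional_conj_le {E : A} (hE : E ∈ unitary A) (g : ℂ) (m Z Z' : A) :
    ‖ρ (E * (g • (star m * Z + Z' * m)) * star E)‖
      ≤ ‖g‖ * (‖η 1‖ * (‖Z‖ + ‖Z'‖) * ‖η (E * m * star E)‖) := by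
  have hE1 : star E * E = 1 := (Unitary.mem_iff.1 hE).1
  have e : E * (g • (star m * Z + Z' * m)) * star E
      = g • (star (E * m * star E) * (E * Z * star E)
        + star (E * star Z' * star E) * (E * m * star E)) := by
    rw [mul_smul_comm, smul_mul_assoc, mul_add, add_mul]
    congr 2
    · calc E * (star m * Z) * star E = E * star m * 1 * Z * star E := by
            simp only [mul_assoc, one_mul]
        _ = _ := by rw [← hE1]; simp only [star_mul, star_star, mul_assoc]
    · calc E * (Z' * m) * star E = E * Z' * 1 * m * star E := by
            simp only [mul_assoc, one_mul]
        _ = _ := by rw [← hE1]; simp only [star_mul, star_star, mul_assoc]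
  rw [e, map_smul, norm_smul, map_add, ← hin, ← hin]
  refine mul_le_mul_of_nonneg_left ?_ (norm_nonneg _)
  refine (norm_add_le _ _).trans ?_
  have h1 := norm_inner_le_norm (𝕜 := ℂ) (η (E * m * star E)) (η (E * Z * star E))
  have h2 := norm_inner_le_norm (𝕜 := ℂ) (η (E * star Z' * star E)) (η (E * m * star E))
  have h3 := norm_gns_conj_le hη hE Z
  have h4 := norm_gns_conj_le hη hE (star Z')
  rw [norm_star] at h4
  have h5 := mul_le_mul_of_nonneg_left h3 (norm_nonneg (η (E * m * star E)))
  have h6 := mul_le_mul_of_nonneg_right h4 (norm_nonneg (η (E * m * star E)))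
  linarith

lemma norm_commutator_le (B X : A) : ‖B * X - X * B‖ ≤ 2 * ‖B‖ * ‖X‖ := by
  refine (norm_sub_le _ _).trans ?_
  have h1 := norm_mul_le B X
  have h2 := norm_mul_le X B
  linarith

end MeanField

namespace CooperField

/-! ### The law of large numbers. -/

section MeanFieldLimit

variable {d : ℕ}

lemma tendsto_card_box (hd : 1 ≤ d) : Tendsto (fun L => ((box d L).card : ℝ)) atTop atTop := by
  refine tendsto_natCast_atTop_atTop.comp (tendsto_atTop_mono (fun L => ?_) tendsto_id)
  have h : (box d L).card = (2 * L + 1) ^ d := by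
    rw [box, Fintype.card_piFinset]
    simp only [Int.card_Icc, Finset.prod_const, Finset.card_univ, Fintype.card_fin]
    congr 1
    omega
  rw [h]
  calc L ≤ (2 * L + 1) ^ 1 := by rw [pow_one]; omega
    _ ≤ (2 * L + 1) ^ d := Nat.pow_le_pow_right (by omega) hd

variable {V : Type} [NormedAddCommGroup V] [InnerProductSpace ℂ V] {η : U d →L[ℂ] V}
  {ρ : U d →L[ℂ] ℂ} (hin : ∀ X Y, inner ℂ (η X) (η Y) = ρ (star X * Y))

include hin in
/-- The law of large numbers for product states. -/
lemma norm_sum_sitePoly_sq (h : IsProductState ρ) {P P' : FreeAlgebra ℂ (Spin × Bool)}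
    (hP : ∀ x : Site d, star (sitePoly x P : U d) = (sitePoly x P' : U d))
    (h0 : ρ (sitePoly (0 : Site d) P : U d) = 0) (L : ℕ) :
    ‖η (∑ x ∈ box d L, (sitePoly x P : U d))‖ ^ 2
      = (box d L).card * ‖η (sitePoly (0 : Site d) P : U d)‖ ^ 2 := by
  have hsq (X : U d) : ((‖η X‖ ^ 2 : ℝ) : ℂ) = ρ (star X * X) := by
    rw [← hin, inner_self_eq_norm_sq_to_K]
    simp
  have hmul (x : Site d) : ρ (star (sitePoly x P : U d) * (sitePoly x P : U d))
      = ρ (star (sitePoly (0 : Site d) P : U d) * (sitePoly (0 : Site d) P : U d)) := by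
    have key (y : Site d) : star (sitePoly y P : U d) * (sitePoly y P : U d)
        = (sitePoly y (P' * P) : U d) := by
      rw [hP, coe_sitePoly, coe_sitePoly, coe_sitePoly, map_mul]
    rw [key, key, IsProductOf.apply_sitePoly h, restrictSite_apply]
  -- The product property factorizes the correlation of two sites, and centring makes it vanish.
  have hoff (x y : Site d) (hxy : y ≠ x) :
      ρ (star (sitePoly x P : U d) * (sitePoly y P : U d)) = 0 := by
    rw [hP, IsProductOf.apply_mul h hxy.symm, restrictSite_apply ρ (sitePoly (0 : Site d) P), h0,
      mul_zero]
  have key : ((‖η (∑ x ∈ box d L, (sitePoly x P : U d))‖ ^ 2 : ℝ) : ℂ)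
      = (((box d L).card * ‖η (sitePoly (0 : Site d) P : U d)‖ ^ 2 : ℝ) : ℂ) := by
    rw [hsq, star_sum, Finset.sum_mul_sum, map_sum]
    have : ∀ x ∈ box d L, ρ (∑ y ∈ box d L, star (sitePoly x P : U d) * (sitePoly y P : U d))
        = ρ (star (sitePoly (0 : Site d) P : U d) * (sitePoly (0 : Site d) P : U d)) := by
      intro x hx
      rw [map_sum, Finset.sum_eq_single_of_mem x hx (fun y _ hyx => hoff x y hyx), hmul]
    rw [Finset.sum_congr rfl this, Finset.sum_const, ← hsq, nsmul_eq_mul]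
    push_cast
    rfl
  exact_mod_cast key

include hin in
-- The seminorm of the average is of order `|Λ|^{-1/2}`; `d ≥ 1` makes the box grow.
lemma tendsto_norm_average (hd : 1 ≤ d) (h : IsProductState ρ)
    {P P' : FreeAlgebra ℂ (Spin × Bool)}
    (hP : ∀ x : Site d, star (sitePoly x P : U d) = (sitePoly x P' : U d))
    (h0 : ρ (sitePoly (0 : Site d) P : U d) = 0) :
    Tendsto (fun L => ‖η ((((box d L).card : ℂ)⁻¹) • ∑ x ∈ box d L, (sitePoly x P : U d))‖) atTop
      (𝓝 0) := by
  have h2 : Tendsto (fun L => ((box d L).card : ℝ)⁻¹ * ‖η (sitePoly (0 : Site d) P : U d)‖ ^ 2) atTop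
      (𝓝 0) := by
    simpa using (tendsto_inv_atTop_zero.comp (tendsto_card_box hd)).mul_const
      (‖η (sitePoly (0 : Site d) P : U d)‖ ^ 2)
  have h3 := h2.sqrt
  rw [Real.sqrt_zero] at h3
  refine h3.congr fun L => ?_
  have hv : ((box d L).card : ℝ) ≠ 0 := Nat.cast_ne_zero.2 (card_box_pos L).ne'
  rw [← Real.sqrt_sq (norm_nonneg (η ((((box d L).card : ℂ)⁻¹) • _))), map_smul, norm_smul, mul_pow,
    norm_sum_sitePoly_sq hin h hP h0]
  congr 1
  simp only [norm_inv, Complex.norm_natCast]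
  field_simp

end MeanFieldLimit

end CooperField
end

noncomputable section

/-- Completing the square: for `v ≠ 0` and `m = B/v - c`, the difference of the two Hamiltonians is
`-g v m* m` plus a scalar, and the scalar drops out of the commutator. The factor `v` is absorbed by
`v [m, X] = [B, X]`. -/
lemma meanField_commutator {A : Type} [CStarAlgebra A] (T B X : A) (g : ℝ) (v : ℕ) (c : ℂ) :
    (T - ((g / v : ℝ) : ℂ) • (star B * B) - (T - (g : ℂ) • (c • star B + star c • B))) * X
      - X * (T - ((g / v : ℝ) : ℂ) • (star B * B) - (T - (g : ℂ) • (c • star B + star c • B)))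
      = (-g : ℂ) • (star ((v : ℂ)⁻¹ • B - c • (1 : A)) * (B * X - X * B)
          + (star B * X - X * star B) * ((v : ℂ)⁻¹ • B - c • (1 : A))) := by
  have hv : star ((v : ℂ)⁻¹) = (v : ℂ)⁻¹ := by simp
  have hg : ((g / v : ℝ) : ℂ) = g * (v : ℂ)⁻¹ := by push_cast; rw [div_eq_mul_inv]
  simp only [star_sub, star_smul, star_one, hv, hg, sub_mul, mul_sub, add_mul, mul_add,
    smul_mul_assoc, mul_smul_comm, one_mul, mul_one, smul_sub, smul_add, smul_smul, mul_assoc]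
  module

namespace CooperField

section

variable {d : ℕ}

/-- This bounds commutators of extensive observables with local elements uniformly in `L`. -/
lemma commutator_sum_eq_of_le {M L : ℕ} (hML : M ≤ L) {f : Site d → U d}
    (hf : ∀ x, f x ∈ wordSpan (a x) Even) {A : U d} (hA : A ∈ localAlgebra d M) :
    (∑ x ∈ box d L, f x) * A - A * (∑ x ∈ box d L, f x)
      = (∑ x ∈ box d M, f x) * A - A * (∑ x ∈ box d M, f x) := by
  simp only [Finset.sum_mul, Finset.mul_sum, ← Finset.sum_sub_distrib]
  refine (Finset.sum_subset (box_mono hML) fun x _ hx => ?_).symm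
  exact sub_eq_zero.2 (commute_of_mem_localAlgebra hA hx (hf x)).eq

lemma coe_sitePoly_sub_algebraMap (x : Site d) (P : FreeAlgebra ℂ (Spin × Bool)) (c : ℂ) :
    (sitePoly x (P - algebraMap ℂ _ c) : U d) = (sitePoly x P : U d) - c • (1 : U d) := by
  rw [coe_sitePoly, coe_sitePoly, map_sub, AlgHom.commutes, Algebra.algebraMap_eq_smul_one]

lemma coe_sitePoly_ι_mul_ι (x : Site d) (g g' : Spin × Bool) :
    (sitePoly x (FreeAlgebra.ι ℂ g * FreeAlgebra.ι ℂ g') : U d) = carGen (a x) g * carGen (a x) g' := by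
  rw [coe_sitePoly, map_mul, FreeAlgebra.lift_ι_apply, FreeAlgebra.lift_ι_apply]

lemma coe_sitePoly_pair (x : Site d) (c : ℂ) :
    (sitePoly x (FreeAlgebra.ι ℂ (dn, false) * FreeAlgebra.ι ℂ (up, false) - algebraMap ℂ _ c) : U d)
      = a x dn * a x up - c • (1 : U d) := by
  rw [coe_sitePoly_sub_algebraMap, coe_sitePoly_ι_mul_ι]
  rfl

lemma coe_sitePoly_num (x : Site d) (n : ℝ) :
    (sitePoly x (FreeAlgebra.ι ℂ (up, true) * FreeAlgebra.ι ℂ (up, false)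
        + FreeAlgebra.ι ℂ (dn, true) * FreeAlgebra.ι ℂ (dn, false) - algebraMap ℂ _ (n : ℂ)) : U d)
      = num x up + num x dn - (n : ℂ) • (1 : U d) := by
  rw [coe_sitePoly_sub_algebraMap, map_add]
  refine congrArg (· - (n : ℂ) • (1 : U d)) ?_
  exact congrArg₂ (· + ·) (coe_sitePoly_ι_mul_ι x _ _) (coe_sitePoly_ι_mul_ι x _ _)

lemma cooper_fluctuation_eq (L : ℕ) (c : ℂ) :
    (((box d L).card : ℂ)⁻¹) • totalPair d L - c • (1 : U d)
      = (((box d L).card : ℂ)⁻¹) • ∑ x ∈ box d L, (sitePoly x (FreeAlgebra.ι ℂ (dn, false) *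
          FreeAlgebra.ι ℂ (up, false) - algebraMap ℂ _ c) : U d) := by
  have hv : ((box d L).card : ℂ) ≠ 0 := Nat.cast_ne_zero.2 (card_box_pos L).ne'
  rw [Finset.sum_congr rfl fun x _ => coe_sitePoly_pair x c, Finset.sum_sub_distrib, Finset.sum_const,
    ← Nat.cast_smul_eq_nsmul ℂ, smul_sub, inv_smul_smul₀ hv]
  rfl

/-- Brings the frequency operator into the form of a centred average, to which the law of large
numbers applies. -/
lemma freqOp_fluctuation_eq (p : Params) (L : ℕ) (ν n : ℝ)
    (hν : ν = 2 * (p.mu - p.lam) + p.gam * (1 - n)) :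
    freqOp d p L - (ν : ℂ) • (1 : U d)
      = (-p.gam : ℂ) • (((box d L).card : ℂ)⁻¹) • ∑ x ∈ box d L, (sitePoly x
          (FreeAlgebra.ι ℂ (up, true) * FreeAlgebra.ι ℂ (up, false)
            + FreeAlgebra.ι ℂ (dn, true) * FreeAlgebra.ι ℂ (dn, false)
            - algebraMap ℂ _ (n : ℂ)) : U d) := by
  have hv : ((box d L).card : ℂ) ≠ 0 := Nat.cast_ne_zero.2 (card_box_pos L).ne'
  rw [Finset.sum_congr rfl fun x _ => coe_sitePoly_num x n, Finset.sum_sub_distrib, Finset.sum_const,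
    ← Nat.cast_smul_eq_nsmul ℂ, smul_sub, inv_smul_smul₀ hv, freqOp, totalNum, hν]
  push_cast
  module

set_option maxHeartbeats 1000000 in
/-- On local observables the finite-volume dynamics and the dynamics generated by the approximating
Hamiltonians differ by at most the mean-field fluctuations of the initial state. -/
lemma norm_tau_sub_approxTau_le {V : Type} [NormedAddCommGroup V] [InnerProductSpace ℂ V]
    {η : U d →L[ℂ] V} {ρ : U d →L[ℂ] ℂ} (hin : ∀ X Y, inner ℂ (η X) (η Y) = ρ (star X * Y))
    (hη : ∀ X Y, ‖η (X * Y)‖ ≤ ‖X‖ * ‖η Y‖) (p : Params) (c : ℂ) (ν t : ℝ) {M L : ℕ} (hML : M ≤ L)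
    {A : U d} (hA : A ∈ localAlgebra d M) :
    ‖ρ (tau p L t A) - ρ (approxTau d p L (rotatingField c ν) t 0 A)‖
      ≤ (|p.gam| * (‖η 1‖ * (2 * ‖totalPair d M‖ * ‖A‖ + 2 * ‖totalPair d M‖ * ‖A‖) *
        (‖η ((((box d L).card : ℂ)⁻¹) • totalPair d L - c • (1 : U d))‖
          + ‖c‖ * (|t| * ‖η (freqOp d p L - (ν : ℂ) • (1 : U d))‖)))) * |t| := by
  have h0 : approxTau d p L (rotatingField c ν) t 0 A
      = propagator d p L c ν t * A * star (propagator d p L c ν t) := by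
    rw [approxTau_rotatingField, propagator_zero]
    simp
  have h1 : tau p L t A = expGroup (hamiltonian d p L) t * A * expGroup (hamiltonian d p L) (-t) := by
    rw [← expGroup_neg_eq]
    rfl
  rw [h0, h1]
  have h2 (r : ℝ) := star_approxHamiltonian (d := d) p L (rotatingField c ν r)
  refine norm_duhamel_le h2 (hasDerivAt_propagator (d := d) p L c ν) (propagator_mem_unitary p L c ν) ρ A t _
    (propagator_zero p L c ν) fun r hr => ?_
  rw [← approxTau_rotatingField]
  set X := approxTau d p L (rotatingField c ν) t r A with hX
  have hXn : ‖X‖ ≤ ‖A‖ := by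
    obtain ⟨E, hE, hT⟩ := exists_unitary_approxTau (d := d) p L c ν t r
    rw [hX, hT]
    exact norm_conj_le hE A
  -- The approximating dynamics does not spread supports, so `X` remains in the box `Λ_M` at all
  -- times.
  have hXM : X ∈ localAlgebra d M := by
    rw [hX, approxTau_eq_of_le p hML (continuous_rotatingField c ν) hA]
    exact approxTau_mem_localAlgebra p M (continuous_rotatingField c ν) hA t r
  have hZ : ‖totalPair d L * X - X * totalPair d L‖ ≤ 2 * ‖totalPair d M‖ * ‖A‖ := by
    rw [totalPair, commutator_sum_eq_of_le hML pair_mem hXM]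
    exact (norm_commutator_le _ _).trans (by gcongr; rfl)
  have hZ' : ‖star (totalPair d L) * X - X * star (totalPair d L)‖ ≤ 2 * ‖totalPair d M‖ * ‖A‖ := by
    rw [star_totalPair, commutator_sum_eq_of_le hML star_pair_mem hXM, ← star_totalPair]
    refine (norm_commutator_le _ _).trans ?_
    rw [norm_star]
    gcongr
  rw [hamiltonian_eq_total, approxHamiltonian_eq_total, meanField_commutator,
    ← hamiltonian_eq_total, ← star_expGroup (star_hamiltonian p L)]
  refine (norm_functional_conj_le hin hη (expGroup_mem_unitary (star_hamiltonian p L) r) _ _ _ _).trans ?_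
  rw [norm_neg, Complex.norm_real, Real.norm_eq_abs, star_expGroup (star_hamiltonian p L)]
  -- The exact relation `[H, B] = F B` is linear in `B`, hence holds for the average as well.
  have hB : hamiltonian d p L * ((((box d L).card : ℂ)⁻¹) • totalPair d L)
      = ((((box d L).card : ℂ)⁻¹) • totalPair d L) * hamiltonian d p L
        + freqOp d p L * ((((box d L).card : ℂ)⁻¹) • totalPair d L) := by
    rw [mul_smul_comm, hamiltonian_mul_totalPair, smul_mul_assoc, mul_smul_comm, smul_add]
  have hm := norm_evolved_fluctuation_le hη (star_freqOp p L) hB (commute_freqOp_hamiltonian p L)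
    c ν r
  have hm' : ‖η (expGroup (hamiltonian d p L) r * ((((box d L).card : ℂ)⁻¹) • totalPair d L
      - rotatingField c ν r • (1 : U d)) * expGroup (hamiltonian d p L) (-r))‖
      ≤ ‖η ((((box d L).card : ℂ)⁻¹) • totalPair d L - c • (1 : U d))‖
          + ‖c‖ * (|t| * ‖η (freqOp d p L - (ν : ℂ) • (1 : U d))‖) :=
    hm.trans (by gcongr)
  gcongr

/-- The infinite-volume limit of the evolution of a product state. -/
theorem tendsto_tau (hd : 1 ≤ d) (p : Params) {ρ : U d →L[ℂ] ℂ} (h : IsProductState ρ) (t : ℝ)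
    (A : U d) :
    Tendsto (fun L => ρ (tau p L t A)) atTop
      (𝓝 (evolve p (cooperField ρ) (nu p ρ) t ρ A)) := by
  obtain ⟨V, _, _, η, hin, hη⟩ := exists_gns ρ h.1.1
  set c := cooperField ρ with hc
  set ν := nu p ρ with hν
  have hpair : Tendsto (fun L => ‖η ((((box d L).card : ℂ)⁻¹) • totalPair d L - c • (1 : U d))‖) atTop
      (𝓝 0) := by
    simp only [cooper_fluctuation_eq]
    refine tendsto_norm_average hin hd h (P' := FreeAlgebra.ι ℂ (up, true) *
      FreeAlgebra.ι ℂ (dn, true) - algebraMap ℂ _ (star c)) (fun x => ?_) ?_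
    · rw [coe_sitePoly_pair, coe_sitePoly_sub_algebraMap, coe_sitePoly_ι_mul_ι, star_sub, star_mul,
        star_smul, star_one]
      rfl
    · rw [coe_sitePoly_pair, map_sub, map_smul, h.1.2, smul_eq_mul, mul_one]
      exact sub_self _
  have hnum : Tendsto (fun L => ‖η (freqOp d p L - (ν : ℂ) • (1 : U d))‖) atTop (𝓝 0) := by
    simp only [freqOp_fluctuation_eq p _ ν (electronDensity ρ) hν, map_smul η (-p.gam : ℂ),
      norm_smul (-p.gam : ℂ)]
    rw [← mul_zero ‖(-p.gam : ℂ)‖]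
    refine Tendsto.const_mul _ ?_
    refine tendsto_norm_average hin hd h (P' := FreeAlgebra.ι ℂ (up, true) *
      FreeAlgebra.ι ℂ (up, false) + FreeAlgebra.ι ℂ (dn, true) * FreeAlgebra.ι ℂ (dn, false)
            - algebraMap ℂ _ (electronDensity ρ : ℂ)) (fun x => ?_) ?_
    · rw [coe_sitePoly_num, star_sub, star_add, star_smul, star_one, num, num, star_mul, star_mul,
        star_star, star_star, Complex.star_def, Complex.conj_ofReal]
    · have h1 := h.1.apply_one_sub_num
      rw [map_sub, h.1.2] at h1
      rw [coe_sitePoly_num, map_sub, map_smul, h.1.2, smul_eq_mul, mul_one]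
      push_cast at h1
      linear_combination -h1
  have hlocal {M : ℕ} {B : U d} (hB : B ∈ localAlgebra d M) :
      Tendsto (fun L => ρ (tau p L t B) - ρ (approxTau d p L (rotatingField c ν) t 0 B)) atTop
        (𝓝 0) := by
    have hlim := (((hpair.add ((hnum.const_mul |t|).const_mul ‖c‖)).const_mul
      (‖η 1‖ * (2 * ‖totalPair d M‖ * ‖B‖ + 2 * ‖totalPair d M‖ * ‖B‖))).const_mul
      |p.gam|).mul_const |t|
    simp only [mul_zero, add_zero, zero_mul] at hlim
    refine squeeze_zero_norm' ?_ hlim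
    filter_upwards [eventually_ge_atTop M] with L hL
    exact norm_tau_sub_approxTau_le hin hη p c ν t hL hB
  have hdiff : Tendsto (fun L => ρ (tau p L t A) - ρ (approxTau d p L (rotatingField c ν) t 0 A)) atTop
      (𝓝 0) := by
    rw [Metric.tendsto_nhds]
    intro ε hε
    -- Replacing `A` by a local `B` costs `‖ρ‖ ‖A - B‖` in each of the two dynamics, at most `ε / 2`
    -- in total; the other half is left for the local limit. The summand 1 avoids division by zero.
    have hpos : 0 < ε / (4 * (‖ρ‖ + 1)) := by positivity
    obtain ⟨B, ⟨M, hB⟩, hAB⟩ := Metric.mem_closure_iff.1 (dense_localAlgebra A) _ hpos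
    rw [dist_eq_norm, lt_div_iff₀ (by positivity)] at hAB
    filter_upwards [Metric.tendsto_nhds.1 (hlocal hB) (ε / 2) (by positivity)] with L hL
    rw [dist_eq_norm, sub_zero] at hL ⊢
    have e1 : ρ (tau p L t A) - ρ (tau p L t B) = ρ (tau p L t (A - B)) := by
      rw [← map_sub]
      simp only [tau, mul_sub, sub_mul]
    have e2 : ρ (approxTau d p L (rotatingField c ν) t 0 A)
        - ρ (approxTau d p L (rotatingField c ν) t 0 B)
        = ρ (approxTau d p L (rotatingField c ν) t 0 (A - B)) := by
      rw [← map_sub, ← map_sub]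
    have n1 : ‖ρ (tau p L t (A - B))‖ ≤ ‖ρ‖ * ‖A - B‖ := by
      refine (ρ.le_opNorm _).trans (mul_le_mul_of_nonneg_left ?_ (norm_nonneg _))
      rw [tau, expGroup_neg_eq, ← star_expGroup (star_hamiltonian p L)]
      exact norm_conj_le (expGroup_mem_unitary (star_hamiltonian p L) t) _
    have n2 : ‖ρ (approxTau d p L (rotatingField c ν) t 0 (A - B))‖ ≤ ‖ρ‖ * ‖A - B‖ := by
      refine (ρ.le_opNorm _).trans (mul_le_mul_of_nonneg_left ?_ (norm_nonneg _))
      obtain ⟨E, hE, hT⟩ := exists_unitary_approxTau (d := d) p L c ν t 0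
      rw [hT]
      exact norm_conj_le hE _
    have e : ρ (tau p L t A) - ρ (approxTau d p L (rotatingField c ν) t 0 A)
        = (ρ (tau p L t B) - ρ (approxTau d p L (rotatingField c ν) t 0 B))
          + (ρ (tau p L t (A - B)) - ρ (approxTau d p L (rotatingField c ν) t 0 (A - B))) := by
      rw [← e1, ← e2]
      ring
    rw [e]
    have n3 := norm_add_le (ρ (tau p L t B) - ρ (approxTau d p L (rotatingField c ν) t 0 B))
      (ρ (tau p L t (A - B)) - ρ (approxTau d p L (rotatingField c ν) t 0 (A - B)))
    have n4 := norm_sub_le (ρ (tau p L t (A - B)))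
      (ρ (approxTau d p L (rotatingField c ν) t 0 (A - B)))
    nlinarith [norm_nonneg (A - B)]
  have hlim : Tendsto (fun L => ρ (approxTau d p L (rotatingField c ν) t 0 A)) atTop
      (𝓝 (evolve p c ν t ρ A)) :=
    (ρ.continuous.tendsto _).comp (tendsto_approxTau p c ν t 0 A)
  simpa using hdiff.add hlim

end

end CooperField
end

noncomputable section

namespace CooperField

/-! ### The Fock vacuum. -/

section FockVacuum

variable {I : Type} [LinearOrder I]

variable (I) in
/-- The Fock vacuum. -/
def vacuumVector : Fock I := lp.single 2 (∅ : Finset I) (1 : ℂ)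

lemma vacuumVector_apply (S : Finset I) : vacuumVector I S = if S = ∅ then 1 else 0 := by
  rw [vacuumVector, lp.single_apply]
  split_ifs with h
  · subst h; simp
  · simp [h]

lemma inner_vacuumVector (f : Fock I) : inner ℂ (vacuumVector I) f = f ∅ := by
  rw [vacuumVector, lp.inner_single_left]
  simp

lemma ann_vacuumVector (i : I) : ann i (vacuumVector I) = 0 := by
  ext S
  change ann i (vacuumVector I) S = 0
  rw [ann_apply, vacuumVector_apply, if_neg (Finset.insert_ne_empty i S), mul_zero, ite_self]

lemma one_sub_star_carAnn_mul_vacuumVector (i : I) :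
    ((1 - star (carAnn i) * carAnn i : carAlgebra I) : Fock I →L[ℂ] Fock I) (vacuumVector I)
      = vacuumVector I := by
  change vacuumVector I - (star (ann i) : Fock I →L[ℂ] Fock I) (ann i (vacuumVector I)) = _
  rw [ann_vacuumVector, map_zero, sub_zero]

lemma even_card_of_ann_apply {f : Fock I} {n : ℕ} (hf : ∀ S, f S ≠ 0 → Even (S.card + n)) (i : I)
    {S : Finset I} (hS : ann i f S ≠ 0) : Even (S.card + (n + 1)) := by
  rw [ann_apply] at hS
  split_ifs at hS with h
  · exact absurd rfl hS
  · have := hf _ (right_ne_zero_of_mul hS)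
    rwa [Finset.card_insert_of_notMem h, add_assoc, add_comm 1] at this

lemma even_card_of_star_ann_apply {f : Fock I} {n : ℕ} (hf : ∀ S, f S ≠ 0 → Even (S.card + n)) (i : I)
    {S : Finset I} (hS : (star (ann i) : Fock I →L[ℂ] Fock I) f S ≠ 0) :
    Even (S.card + (n + 1)) := by
  rw [adjoint_ann_apply] at hS
  split_ifs at hS with h
  · have := (hf _ (right_ne_zero_of_mul hS)).add even_two
    rw [Finset.card_erase_of_mem h] at this
    have hpos := Finset.card_pos.2 ⟨i, h⟩
    convert! this using 1
    omega
  · exact absurd rfl hS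

/-- A word of length `n` in the generators changes the parity of the particle number by `n`. -/
lemma even_card_of_word_apply (w : List (I × Bool)) (S : Finset I)
    (hS : (((w.map fun g => if g.2 then star (carAnn g.1) else carAnn g.1).prod : carAlgebra I) :
      Fock I →L[ℂ] Fock I) (vacuumVector I) S ≠ 0) : Even (S.card + w.length) := by
  induction w generalizing S with
  | nil =>
    change vacuumVector I S ≠ 0 at hS
    rw [vacuumVector_apply] at hS
    have : S = ∅ := by
      by_contra h
      exact hS (if_neg h)
    simp [this]
  | cons g w ih =>
    obtain ⟨i, b⟩ := g
    rw [List.map_cons, List.prod_cons] at hS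
    cases b with
    | false => exact even_card_of_ann_apply ih i hS
    | true => exact even_card_of_star_ann_apply ih i hS

variable (I) in
/-- The vacuum state. -/
def fockVacuum : carAlgebra I →L[ℂ] ℂ :=
  (innerSL ℂ (vacuumVector I)).comp ((ContinuousLinearMap.apply ℂ (Fock I) (vacuumVector I)).comp
    ⟨(carAlgebra I).subtype.toAlgHom.toLinearMap, continuous_subtype_val⟩)

lemma fockVacuum_apply (A : carAlgebra I) :
    fockVacuum I A = inner ℂ (vacuumVector I) ((A : Fock I →L[ℂ] Fock I) (vacuumVector I)) :=
  rfl

lemma fockVacuum_mul_eq_self {X : carAlgebra I}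
    (hX : (X : Fock I →L[ℂ] Fock I) (vacuumVector I) = vacuumVector I) (A : carAlgebra I) :
    fockVacuum I (A * X) = fockVacuum I A := by
  rw [fockVacuum_apply, fockVacuum_apply]
  change inner ℂ _ ((A : Fock I →L[ℂ] Fock I) ((X : Fock I →L[ℂ] Fock I) _)) = _
  rw [hX]

lemma fockVacuum_mul_carAnn (i : I) (A : carAlgebra I) : fockVacuum I (A * carAnn i) = 0 := by
  rw [fockVacuum_apply]
  change inner ℂ _ ((A : Fock I →L[ℂ] Fock I) (ann i _)) = _
  rw [ann_vacuumVector, map_zero, inner_zero_right]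

lemma isState_fockVacuum : IsState (fockVacuum I) := by
  refine ⟨fun B => ?_, ?_⟩
  · rw [fockVacuum_apply]
    change 0 ≤ inner ℂ (vacuumVector I) (ContinuousLinearMap.adjoint (B : Fock I →L[ℂ] Fock I)
        ((B : Fock I →L[ℂ] Fock I) (vacuumVector I)))
    rw [ContinuousLinearMap.adjoint_inner_right, inner_self_eq_norm_sq_to_K]
    change 0 ≤ ((‖(B : Fock I →L[ℂ] Fock I) (vacuumVector I)‖ : ℝ) : ℂ) ^ 2
    rw [← Complex.ofReal_pow]
    exact Complex.zero_le_real.2 (sq_nonneg _)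
  · rw [fockVacuum_apply]
    change inner ℂ (vacuumVector I) (vacuumVector I) = (1 : ℂ)
    rw [inner_vacuumVector, vacuumVector_apply, if_pos rfl]

end FockVacuum

/-! ### The vacuum as a product state. -/

section Vacuum

variable {d : ℕ}

variable (d) in
/-- The vacuum state of the lattice. -/
def vacuum : U d →L[ℂ] ℂ := fockVacuum (Mode d)

lemma isState_vacuum : IsState (vacuum d) := isState_fockVacuum

/-- The vacuum projection of a site. -/
def siteVacuum (x : Site d) : U d :=
  (1 - star (a x up) * a x up) * (1 - star (a x dn) * a x dn)

lemma siteVacuum_mem (x : Site d) : siteVacuum x ∈ wordSpan (a x) Even := by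
  have h (s : Spin) : 1 - star (a x s) * a x s ∈ wordSpan (a x) Even :=
    Submodule.sub_mem _ (word_mem_wordSpan (a x) Even [] (by simp))
      (word_two_mem x (s, true) (s, false))
  exact mul_mem_wordSpan (fun _ _ hm hn => hm.add hn) (h up) (h dn)

/-- Both factors of the site projection fix the vacuum vector. -/
lemma vacuum_mul_siteVacuum (x : Site d) (A : U d) : vacuum d (A * siteVacuum x) = vacuum d A := by
  rw [siteVacuum, ← mul_assoc]
  exact (fockVacuum_mul_eq_self (one_sub_star_carAnn_mul_vacuumVector _) _).trans
    (fockVacuum_mul_eq_self (one_sub_star_carAnn_mul_vacuumVector _) _)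

lemma star_siteVacuum (x : Site d) : star (siteVacuum x) = siteVacuum x := by
  rw [siteVacuum, star_mul]
  simp only [star_sub, star_mul, star_star, star_one]
  exact ((Commute.one_left _).sub_left
    ((Commute.one_right _).sub_right ((isCar_a x).commute_num up dn).symm)).eq

lemma vacuum_siteVacuum_mul (x : Site d) (A : U d) : vacuum d (siteVacuum x * A) = vacuum d A := by
  have h := vacuum_mul_siteVacuum x (star A)
  have h2 : star A * siteVacuum x = star (siteVacuum x * A) := by
    rw [star_mul, star_siteVacuum]
  rw [h2, isState_vacuum.map_star, isState_vacuum.map_star] at h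
  exact star_injective h

lemma exists_siteVacuum_mul_mul (x : Site d) (P : FreeAlgebra ℂ (Spin × Bool)) :
    ∃ r : ℂ, siteVacuum (0 : Site d) * (sitePoly (0 : Site d) P : U d) * siteVacuum (0 : Site d)
        = r • siteVacuum (0 : Site d) ∧
      siteVacuum x * (sitePoly x P : U d) * siteVacuum x = r • siteVacuum x := by
  let f : Spin → U d × U d := fun s => (a 0 s, a x s)
  have hf : IsCar f := isCar_prod (isCar_a 0) (isCar_a x)
  obtain ⟨r, hr⟩ := hf.exists_vacuum_mul_mul P
  have h1 : (FreeAlgebra.lift ℂ (carGen f) P).1 = (sitePoly (0 : Site d) P : U d) := by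
    rw [coe_sitePoly]
    exact map_lift_carGen (AlgHom.fst ℂ (U d) (U d)) (fun _ => rfl) f P
  have h2 : (FreeAlgebra.lift ℂ (carGen f) P).2 = (sitePoly x P : U d) := by
    rw [coe_sitePoly]
    exact map_lift_carGen (AlgHom.snd ℂ (U d) (U d)) (fun _ => rfl) f P
  rw [← h1, ← h2]
  exact ⟨r, congrArg Prod.fst hr, congrArg Prod.snd hr⟩

lemma commute_siteVacuum_list_prod {m : ℕ} {x : Site d} {y : Fin m → Site d} (hy : ∀ i, y i ≠ x)
    (P : Fin m → FreeAlgebra ℂ (Spin × Bool)) :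
    Commute (siteVacuum x) (List.ofFn fun i => (sitePoly (y i) (P i) : U d)).prod := by
  refine Commute.list_prod_right _ _ fun A hA => ?_
  obtain ⟨i, rfl⟩ := (List.mem_ofFn' _ _).1 hA
  exact commute_of_mem_wordSpan (hy i).symm (siteVacuum_mem x) (sitePoly_mem_wordSpan (y i) (P i))

/-- Site projections can be inserted at both ends for free. The right one moves past `A`, and the
compressed polynomial is a scalar, the same at `x` as at the origin. -/
lemma vacuum_sitePoly_mul (x : Site d) (P : FreeAlgebra ℂ (Spin × Bool)) {A : U d}
    (hA : Commute (siteVacuum x) A) :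
    vacuum d ((sitePoly x P : U d) * A) = vacuum d (sitePoly (0 : Site d) P : U d) * vacuum d A := by
  obtain ⟨r, h0, hx⟩ := exists_siteVacuum_mul_mul x P
  have e0 : vacuum d (sitePoly (0 : Site d) P : U d) = r := by
    rw [← vacuum_siteVacuum_mul 0, ← vacuum_mul_siteVacuum 0, h0, map_smul,
      ← mul_one (siteVacuum 0), vacuum_siteVacuum_mul, isState_vacuum.2, smul_eq_mul, mul_one]
  rw [e0, ← vacuum_siteVacuum_mul x, ← vacuum_mul_siteVacuum x, mul_assoc, mul_assoc, ← hA.eq,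
    ← mul_assoc, ← mul_assoc, hx, smul_mul_assoc, map_smul, vacuum_siteVacuum_mul, smul_eq_mul]

/-- The vacuum is a product state. -/
lemma isProductState_vacuum : IsProductState (vacuum d) := by
  refine ⟨isState_vacuum, isState_restrictSite isState_vacuum, fun w hw => ?_, fun m => ?_⟩
  · have e : (((w.map (siteGen (0 : Site d))).prod : siteAlgebra (0 : Site d)) : U d)
        = (w.map (carGen (a 0))).prod := by
      simp [Function.comp_def, coe_siteGen]
    rw [restrictSite_apply, e, vacuum, fockVacuum_apply, inner_vacuumVector]
    -- The expectation of a word is its amplitude at the empty set, and a nonzero amplitude there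
    -- would force the length to be even.
    by_contra h
    have := even_card_of_word_apply (w.map fun g => ((toLex (toLex 0, g.1) : Mode d), g.2)) ∅
      (by rw [List.map_map]; exact h)
    rw [Finset.card_empty, zero_add, List.length_map] at this
    exact Nat.not_even_iff_odd.2 hw this
  · induction m with
    | zero =>
      intro x P _
      rw [List.ofFn_zero, List.prod_nil, isState_vacuum.2, Fin.prod_univ_zero]
    | succ m ih =>
      intro x P hx
      rw [List.ofFn_succ, List.prod_cons, Fin.prod_univ_succ]
      refine (vacuum_sitePoly_mul (x 0) (P 0) (commute_siteVacuum_list_prod (fun i => ?_) _)).trans ?_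
      · exact fun h => (Fin.succ_ne_zero i) (hx h)
      · exact congrArg _ (ih (fun i => x i.succ) (fun i => P i.succ)
          fun i j h => Fin.succ_injective _ (hx h))

end Vacuum

end CooperField
end

noncomputable section

namespace CooperField

/-! ### Product states with prescribed Cooper field and density. -/

section RotatedVacuum

variable {d : ℕ}

lemma cooperField_vacuum : cooperField (vacuum d) = 0 := fockVacuum_mul_carAnn _ _

lemma vacuum_one_sub_num : vacuum d (1 - (num (0 : Site d) up + num 0 dn)) = 1 := by
  have h (s : Spin) : vacuum d (num (0 : Site d) s) = 0 := fockVacuum_mul_carAnn _ _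
  rw [map_sub, map_add, h, h, isState_vacuum.2, add_zero, sub_zero]

variable (d) in
/-- The vacuum rotated by a pairing field: a product state with a nonzero Cooper field. -/
def rotatedVacuum (t : ℝ) : U d →L[ℂ] ℂ := evolve ⟨0, 0, 0, 1⟩ 1 0 t (vacuum d)

lemma isProductState_rotatedVacuum (t : ℝ) : IsProductState (rotatedVacuum d t) :=
  isProductState_vacuum.evolve _ _ _ _

/-- With constant field 1 and no on-site terms, the pseudo-spin precesses uniformly about a fixed
axis: the linear system for `y`, `w`, `z` has constant coefficients. -/
lemma rotatedVacuum_eq (t : ℝ) :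
    cooperField (rotatedVacuum d t) = Complex.I / 2 * Complex.sin (2 * t) ∧
      electronDensity (rotatedVacuum d t) = 1 - Real.cos (2 * t) := by
  set p : Params := ⟨0, 0, 0, 1⟩ with hp
  have hc := continuous_rotatingField 1 0
  set c := rotatingField 1 0 with hcdef
  have hc1 (t : ℝ) : c t = 1 := by simp [hcdef, rotatingField]
  set y : ℝ → ℂ := fun t => vacuum d (approxTau d p 0 c t 0 (a 0 dn * a 0 up)) with hy
  set w : ℝ → ℂ := fun t => vacuum d (approxTau d p 0 c t 0 (star (a 0 up) * star (a 0 dn))) with hw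
  set z : ℝ → ℂ := fun t => vacuum d (approxTau d p 0 c t 0 (1 - (num (0 : Site d) up + num 0 dn)))
    with hz
  have dy (t : ℝ) : HasDerivAt y (Complex.I * z t) t := by
    have h := hasDerivAt_pair (d := d) p hc (vacuum d) t
    rw [hc1] at h
    convert! h using 1
    simp [hp, hz]
  have dw (t : ℝ) : HasDerivAt w (-(Complex.I * z t)) t := by
    have h := hasDerivAt_star_pair (d := d) p hc (vacuum d) t
    rw [hc1] at h
    convert! h using 1
    simp [hp, hz]
  have dz (t : ℝ) : HasDerivAt z (2 * Complex.I * (y t - w t)) t := by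
    have h := hasDerivAt_one_sub_num (d := d) p hc (vacuum d) t
    rw [hc1] at h
    convert! h using 1
    simp [hp, hy, hw]
    ring
  have y0 : y 0 = 0 := by
    rw [hy]
    simp only [approxTau_self]
    exact cooperField_vacuum
  have w0 : w 0 = 0 := by
    rw [hw]
    simp only [approxTau_self]
    exact (isState_vacuum.apply_star_pair).trans ((congrArg star cooperField_vacuum).trans (star_zero ℂ))
  have z0 : z 0 = 1 := by
    rw [hz]
    simp only [approxTau_self]
    exact vacuum_one_sub_num
  -- The combinations `z + (y - w)`, `z - (y - w)` and `y + w` diagonalize the system, with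
  -- eigenvalues `2i`, `-2i` and `0`.
  have h1 := eq_mul_exp_of_hasDerivAt (f := fun t => z t + (y t - w t)) (k := 2 * Complex.I)
    (fun t => by
      convert! (dz t).add ((dy t).sub (dw t)) using 1
      ring) t
  have h2 := eq_mul_exp_of_hasDerivAt (f := fun t => z t - (y t - w t)) (k := -(2 * Complex.I))
    (fun t => by
      convert! (dz t).sub ((dy t).sub (dw t)) using 1
      ring) t
  have h3 := eq_mul_exp_of_hasDerivAt (f := fun t => y t + w t) (k := 0)
    (fun t => by
      convert! (dy t).add (dw t) using 1
      ring) t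
  simp only [y0, w0, z0, sub_zero, add_zero, one_mul, zero_mul] at h1 h2 h3
  have e1 : 2 * Complex.I * (t : ℂ) = 2 * t * Complex.I := by ring
  rw [e1, Complex.exp_mul_I] at h1
  rw [neg_mul, e1, ← neg_mul, Complex.exp_mul_I, Complex.cos_neg, Complex.sin_neg] at h2
  refine ⟨?_, ?_⟩
  · have : cooperField (rotatedVacuum d t) = y t :=
      evolve_site p 1 0 t (vacuum d) (mem_wordSpan_true (pair_mem 0))
    rw [this]
    linear_combination (h1 - h2) / 4 + h3 / 2
  · have h4 : rotatedVacuum d t (1 - (num (0 : Site d) up + num 0 dn)) = z t :=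
      evolve_site p 1 0 t (vacuum d) (mem_wordSpan_true one_sub_num_mem)
    rw [(isProductState_rotatedVacuum t).1.apply_one_sub_num] at h4
    have h5 : ((1 - electronDensity (rotatedVacuum d t) : ℝ) : ℂ) = ((Real.cos (2 * t) : ℝ) : ℂ) := by
      rw [h4]
      push_cast
      linear_combination (h1 + h2) / 2
    have h6 := Complex.ofReal_injective h5
    linarith

end RotatedVacuum

/-! ### Convex combinations and the beating of two frequencies. -/

section Mixtures

variable {d n : ℕ}

lemma mixture_apply (u : Fin n → ℝ) (ρ : Fin n → U d →L[ℂ] ℂ) (A : U d) :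
    mixture u ρ A = ∑ j, (u j : ℂ) * ρ j A := by
  simp only [mixture, sum_apply, smul_apply, smul_eq_mul]

lemma IsInfiniteVolumeEvolution.mixture {p : Params} (u : Fin n → ℝ) {ρ : Fin n → U d →L[ℂ] ℂ}
    {ρt : Fin n → ℝ → U d →L[ℂ] ℂ} (h : ∀ j, IsInfiniteVolumeEvolution p (ρ j) (ρt j)) :
    IsInfiniteVolumeEvolution p (mixture u ρ) fun t => mixture u fun j => ρt j t := by
  intro t A
  simp only [mixture_apply]
  exact tendsto_finsetSum _ fun j _ => (h j t A).const_mul _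

lemma cooperField_mixture (u : Fin n → ℝ) (ρ : Fin n → U d →L[ℂ] ℂ) :
    cooperField (mixture u ρ) = ∑ j, (u j : ℂ) * cooperField (ρ j) :=
  mixture_apply u ρ _

lemma cooperField_eq (ρ : U d →L[ℂ] ℂ) :
    cooperField ρ = (√(kappa ρ) : ℂ) * Complex.exp (Complex.I * theta ρ) := by
  rw [kappa, Real.sqrt_sq (norm_nonneg _), theta]
  have h := Complex.norm_mul_exp_arg_mul_I (cooperField ρ)
  split_ifs with hπ
  -- The values `π` and `-π` of the phase give the same exponential.
  · rw [hπ] at h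
    rw [← h]
    simp [mul_comm Complex.I, Complex.exp_neg, Complex.exp_pi_mul_I]
  · rw [mul_comm Complex.I, h]

lemma rotatingField_cooperField (ρ : U d →L[ℂ] ℂ) (ν t : ℝ) :
    rotatingField (cooperField ρ) ν t
      = (√(kappa ρ) : ℂ) * Complex.exp (Complex.I * (t * ν + theta ρ)) := by
  rw [rotatingField, cooperField_eq, mul_assoc, ← Complex.exp_add]
  congr 2
  ring

lemma isInfiniteVolumeEvolution_evolve (hd : 1 ≤ d) (p : Params) {ρ : U d →L[ℂ] ℂ}
    (h : IsProductState ρ) :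
    IsInfiniteVolumeEvolution p ρ fun t => evolve p (cooperField ρ) (nu p ρ) t ρ :=
  fun t A => tendsto_tau hd p h t A

/-- The beating of two product states with the same Cooper field and different frequencies. -/
lemma exists_kappa_ne (hd : 1 ≤ d) {p : Params} (hgam : 0 < p.gam) :
    ∃ (n : ℕ) (u : Fin n → ℝ) (ρ : Fin n → U d →L[ℂ] ℂ) (ρt : ℝ → U d →L[ℂ] ℂ),
      (∀ j, u j ∈ Set.Icc (0 : ℝ) 1) ∧ ∑ j, u j = 1 ∧ (∀ j, IsProductState (ρ j)) ∧
      IsInfiniteVolumeEvolution p (mixture u ρ) ρt ∧ ∃ t : ℝ, kappa (ρt t) ≠ kappa (ρt 0) := by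
  -- The doubled angles `π/4` and `3π/4` have equal sines, hence equal Cooper fields, and opposite
  -- cosines, hence different densities and frequencies.
  set s : Fin 2 → ℝ := ![Real.pi / 8, 3 * Real.pi / 8] with hs
  set ρ : Fin 2 → U d →L[ℂ] ℂ := fun j => rotatedVacuum d (s j) with hρ
  have hprod (j : Fin 2) : IsProductState (ρ j) := isProductState_rotatedVacuum _
  have hs0 : 2 * s 0 = Real.pi / 4 := by simp [hs]; ring
  have hs1 : 2 * s 1 = Real.pi - Real.pi / 4 := by simp [hs]; ring
  have hfield (j : Fin 2) : cooperField (ρ j) = Complex.I / 2 * ((√2 / 2 : ℝ) : ℂ) := by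
    have h : Real.sin (2 * s j) = √2 / 2 := by
      fin_cases j
      · exact (congrArg Real.sin hs0).trans Real.sin_pi_div_four
      · exact (congrArg Real.sin hs1).trans ((Real.sin_pi_sub _).trans Real.sin_pi_div_four)
    rw [hρ, (rotatedVacuum_eq _).1, ← h]
    push_cast
    rfl
  have hden0 : electronDensity (ρ 0) = 1 - √2 / 2 := by
    rw [hρ, (rotatedVacuum_eq _).2, hs0, Real.cos_pi_div_four]
  have hden1 : electronDensity (ρ 1) = 1 + √2 / 2 := by
    rw [hρ, (rotatedVacuum_eq _).2, hs1, Real.cos_pi_sub, Real.cos_pi_div_four, sub_neg_eq_add]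
  have h2 : 0 < √2 := Real.sqrt_pos.2 two_pos
  have hnu : nu p (ρ 0) = nu p (ρ 1) + p.gam * √2 := by
    rw [nu, nu, hden0, hden1]
    ring
  set c : ℂ := Complex.I / 2 * ((√2 / 2 : ℝ) : ℂ) with hc
  have hc0 : c ≠ 0 := by
    rw [hc]
    refine mul_ne_zero (div_ne_zero Complex.I_ne_zero two_ne_zero) (Complex.ofReal_ne_zero.2 ?_)
    positivity
  have hev (t : ℝ) : cooperField (mixture ![1 / 2, 1 / 2] fun j =>
      evolve p (cooperField (ρ j)) (nu p (ρ j)) t (ρ j))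
      = (rotatingField c (nu p (ρ 0)) t + rotatingField c (nu p (ρ 1)) t) / 2 := by
    rw [cooperField_mixture, Fin.sum_univ_two, cooperField_evolve p (hprod 0).1,
      cooperField_evolve p (hprod 1).1, hfield, hfield]
    simp
    ring
  -- The frequencies differ by `γ √2`, so at time `π / (γ √2)` the two fields are in opposite phase
  -- and, with equal weights, cancel; at time zero the common field is nonzero.
  refine ⟨2, ![1 / 2, 1 / 2], ρ, fun t => mixture ![1 / 2, 1 / 2] fun j =>
      evolve p (cooperField (ρ j)) (nu p (ρ j)) t (ρ j), fun j => ?_, ?_, hprod,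
    IsInfiniteVolumeEvolution.mixture _ fun j => isInfiniteVolumeEvolution_evolve hd p (hprod j),
    Real.pi / (p.gam * √2), ?_⟩
  · fin_cases j <;> norm_num
  · rw [Fin.sum_univ_two]
    norm_num
  · have e0 : (rotatingField c (nu p (ρ 0)) 0 + rotatingField c (nu p (ρ 1)) 0) / 2 = c := by
      simp [rotatingField]
    have e1 : rotatingField c (nu p (ρ 0)) (Real.pi / (p.gam * √2))
        + rotatingField c (nu p (ρ 1)) (Real.pi / (p.gam * √2)) = 0 := by
      have e : Complex.I * (nu p (ρ 0) : ℂ) * ((Real.pi / (p.gam * √2) : ℝ) : ℂ)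
          = Complex.I * (nu p (ρ 1) : ℂ) * ((Real.pi / (p.gam * √2) : ℝ) : ℂ)
            + Real.pi * Complex.I := by
        have hr : (p.gam * √2) * (Real.pi / (p.gam * √2)) = Real.pi := by
          field_simp
        rw [hnu]
        have hr' := congrArg (fun r : ℝ => (r : ℂ)) hr
        simp only [Complex.ofReal_mul] at hr'
        push_cast at hr' ⊢
        linear_combination Complex.I * hr'
      rw [rotatingField, rotatingField, e, Complex.exp_add, Complex.exp_pi_mul_I]
      ring
    rw [kappa, kappa, hev, hev, e1, e0, zero_div, norm_zero]
    exact ne_of_lt (by rw [zero_pow two_ne_zero]; exact pow_pos (norm_pos_iff.2 hc0) 2)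

end Mixtures

end CooperField
end

theorem mainTheorem2 (d : ℕ) (hd : 1 ≤ d) (p : CooperField.Params)
    (hlam : 0 ≤ p.lam) (hgam : 0 ≤ p.gam) :
    -- the evolution of a convex combination of product states
    (∀ (n : ℕ) (u : Fin n → ℝ) (ρ : Fin n → CooperField.U d →L[ℂ] ℂ),
      (∀ j, u j ∈ Set.Icc (0 : ℝ) 1) → ∑ j, u j = 1 →
      (∀ j, CooperField.IsProductState (ρ j)) →
      ∃ (ϖ : Fin n → ℝ → CooperField.siteAlgebra (0 : CooperField.Site d) →L[ℂ] ℂ)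
        (ρt : Fin n → ℝ → CooperField.U d →L[ℂ] ℂ),
        -- `ϖ j` is the unique solution of the self-consistency equation for `ρ j`
        (∀ j, CooperField.IsSelfConsistent p (CooperField.restrictSite (ρ j)) (ϖ j)) ∧
        (∀ j ω, CooperField.IsSelfConsistent p (CooperField.restrictSite (ρ j)) ω → ω = ϖ j) ∧
        -- the infinite-volume dynamics associated with `ϖ j` exists
        (∀ j t s A, Tendsto
          (fun L : ℕ => CooperField.approxTau d p L
            (fun r => CooperField.orderParam (ϖ j r)) t s A) atTop
          (𝓝 (CooperField.approxTauInf p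
            (fun r => CooperField.orderParam (ϖ j r)) t s A))) ∧
        -- each product state evolves as `ρ j ∘ τ_{t,0}^{ϖ j} = ⊗ ϖ j t`
        (∀ j, CooperField.IsInfiniteVolumeEvolution p (ρ j) (ρt j)) ∧
        (∀ j t A, ρt j t A = ρ j (CooperField.approxTauInf p
          (fun r => CooperField.orderParam (ϖ j r)) t 0 A)) ∧
        (∀ j t, CooperField.IsProductOf (ρt j t) (ϖ j t)) ∧
        -- the convex combination evolves as the convex combination of the evolved states
        CooperField.IsInfiniteVolumeEvolution p (CooperField.mixture u ρ)
          (fun t => CooperField.mixture u (fun j => ρt j t)) ∧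
        -- the Cooper field
        (∀ t : ℝ, CooperField.cooperField (CooperField.mixture u (fun j => ρt j t)) =
          ∑ j, (u j : ℂ) * (√(CooperField.kappa (ρ j)) : ℂ) *
            Complex.exp (Complex.I *
              (t * CooperField.nu p (ρ j) + CooperField.theta (ρ j))))) ∧
    -- the condensate density of a convex combination need not be constant in time
    (0 < p.gam →
      ∃ (n : ℕ) (u : Fin n → ℝ) (ρ : Fin n → CooperField.U d →L[ℂ] ℂ)
        (ρt : ℝ → CooperField.U d →L[ℂ] ℂ),
        (∀ j, u j ∈ Set.Icc (0 : ℝ) 1) ∧ ∑ j, u j = 1 ∧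
        (∀ j, CooperField.IsProductState (ρ j)) ∧
        CooperField.IsInfiniteVolumeEvolution p (CooperField.mixture u ρ) ρt ∧
        ∃ t : ℝ, CooperField.kappa (ρt t) ≠ CooperField.kappa (ρt 0)) := by

  refine ⟨fun n u ρ _ _ hρ => ?_, fun h => CooperField.exists_kappa_ne hd h⟩
  have horder (j : Fin n) := CooperField.orderParam_evolve p (hρ j).1
  have hinf (j : Fin n) := CooperField.isInfiniteVolumeEvolution_evolve hd p (hρ j)
  -- The solution `ϖ j` is taken as the on-site restriction of the evolved state, so the product
  -- property of `ρt j t` is exactly that of an evolved product state.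
  refine ⟨fun j t => CooperField.restrictSite (CooperField.evolve p (CooperField.cooperField (ρ j))
      (CooperField.nu p (ρ j)) t (ρ j)),
    fun j t => CooperField.evolve p (CooperField.cooperField (ρ j)) (CooperField.nu p (ρ j)) t (ρ j),
    fun j => CooperField.isSelfConsistent_evolve p (hρ j).1,
    fun j ω hω => CooperField.IsSelfConsistent.eq_evolve p (hρ j).1 hω, fun j t s A => ?_, hinf,
    fun j t A => ?_, fun j t => (hρ j).evolve p _ _ t,
    CooperField.IsInfiniteVolumeEvolution.mixture u hinf, fun t => ?_⟩
  · rw [horder j]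
    exact CooperField.tendsto_approxTau p _ _ t s A
  · rw [horder j]
    rfl
  · rw [CooperField.cooperField_mixture]
    refine Finset.sum_congr rfl fun j _ => ?_
    rw [CooperField.cooperField_evolve p (hρ j).1, CooperField.rotatingField_cooperField, mul_assoc]
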